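/- Let $k$ be a field, $A$ an associative unital $k$-algebra, $\mathfrak g$ a Lie $k$-algebra and $E=A\#_fU(\mathfrak g)$ a crossed product. That is, $(h,a)\mapsto a^h$ is a weak action of $U(\mathfrak g)$ on $A$ (a $k$-bilinear map with $(ab)^h=\sum a^{h^{(1)}}b^{h^{(2)}}$, $1^h=\epsilon(h)1$ and $a^1=a$), $f\colon U(\mathfrak g)\otimes_kU(\mathfrak g)\to A$ is $k$-linear, and $E$ is the vector space $A\otimes_kU(\mathfrak g)$, with $a\# h$ denoting $a\otimes h$, and with the multiplication $$(a\#h)(b\#l)=\sum a\,b^{h^{(1)}}f(h^{(2)},l^{(1)})\#h^{(3)}l^{(2)},$$ which is assumed to be associative with identity $1\#1$. We identify $a\in A$ with $a\#1\in E$. Let $K$ be a subalgebra of $A$ such that $\lambda^x\in K$ for all $\lambda\in K$, $x\in\mathfrak g$. Write $\otimes=\otimes_K$, $\overline A=A/K$, and $$X_{rs}=(E\otimes_k\mathfrak g^{\wedge s})\otimes\overline A^{\otimes r}\otimes E\qquad(r,s\ge0),$$ an $E$-bimodule, where $E\otimes_k\mathfrak g^{\wedge s}$ is a right $K$-module via $(c\otimes_k\mathbf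 x)\lambda=c\lambda\otimes_k\mathbf x$. For $x_1,\dots,x_s\in\mathfrak g$ and $a_1,\dots,a_r\in A$ write $\mathbf x_{1s}=x_1\wedge\cdots\wedge x_s$ and $\mathbf a_{ij}=a_i\otimes\cdots\otimes a_j$; a hat over an index of $\mathbf x$ means that the factor is omitted. Let $Y_*$ be the graded algebra generated by the algebra $A$ and elements $y_x,z_x$ in degree $0$ and $e_x$ in degree $1$ ($x\in\mathfrak g$), which are $k$-linear in $x$, subject to $$y_xa=a^x+ay_x,\quad z_xa=a^x+az_x,\quad e_xa=ae_x,\quad e_{x'}y_x=y_xe_{x'}+e_{[x',x]},\quad e_{x'}z_x=z_xe_{x'},\quad e_x^2=0,$$ $$y_{x'}y_x=y_xy_{x'}+y_{[x',x]}+\phi,\quad z_{x'}y_x=y_xz_{x'}+z_{[x',x]}+\phi,\quad z_{x'}z_x=z_xz_{x'}+z_{[x',x]}+\phi,$$ where $\phi=f(x',x)-f(x,x')$. Let $\partial\colon Y_*\to Y_{*-1}$ be the graded derivation with $\partial(e_x)=z_x-y_x$. Regard $Y_*$ as a left $E$-module, with $a$ and $1\#x$ acting as left multiplication by $a$ and $y_x$.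 Put $\mu(1\otimes_k\mathbf x_{1s}\otimes1)=e_{x_1}\cdots e_{x_s}$. Let $d^0\colon X_{rs}\to X_{r-1,s}$ ($r\ge1$) be the $E$-bimodule map with $$d^0(1\otimes_k\mathbf x_{1s}\otimes\mathbf a_{1r}\otimes1)=(-1)^sa_1\otimes_k\mathbf x_{1s}\otimes\mathbf a_{2r}\otimes1+\sum_{i=1}^{r-1}(-1)^{i+s}\otimes_k\mathbf x_{1s}\otimes\mathbf a_{1,i-1}\otimes a_ia_{i+1}\otimes\mathbf a_{i+2,r}\otimes1+(-1)^{r+s}\otimes_k\mathbf x_{1s}\otimes\mathbf a_{1,r-1}\otimes a_r,$$ and let $\sigma^0\colon Y_s\to X_{0s}$ and $\sigma^0\colon X_{rs}\to X_{r+1,s}$ be the left $E$-linear maps with $$\sigma^0(e_{x_1}\cdots e_{x_s}z_{x_{s+1}}\cdots z_{x_n})=\sum_ja_j\otimes_k\mathbf x_{1s}\otimes1\#w_j,\qquad\text{where }\sum_ja_j\#w_j=(1\#x_{s+1})\cdots(1\#x_n),$$ $$\sigma^0(1\otimes_k\mathbf x_{1s}\otimes\mathbf a_{1r}\otimes a_{r+1}\#w)=(-1)^{r+s+1}\otimes_k\mathbf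 x_{1s}\otimes\mathbf a_{1,r+1}\otimes1\#w.$$ **Theorem.** There are unique $E$-bimodule maps $d^l\colon X_{rs}\to X_{r+l-1,s-l}$ ($r\ge0$, $1\le l\le s$) such that, for all $\mathbf y=1\otimes_k\mathbf x_{1s}\otimes\mathbf a_{1r}\otimes1$, $$d^l(\mathbf y)=\begin{cases}-\sigma^0\circ\partial\circ\mu(\mathbf y)&\text{if }l=1,\ r=0,\\-\sigma^0\circ d^1\circ d^0(\mathbf y)&\text{if }l=1,\ r>0,\\-\sum_{j=1}^{l-1}\sigma^0\circ d^{l-j}\circ d^j(\mathbf y)&\text{if }l>1,\ r=0,\\-\sum_{j=0}^{l-1}\sigma^0\circ d^{l-j}\circ d^j(\mathbf y)&\text{if }l>1,\ r>0.\end{cases}$$ They are given by the following formulas, where $\widehat f_{ij}=f(x_i,x_j)-f(x_j,x_i)$: $$\begin{aligned}d^1(\mathbf y)={}&\sum_{i=1}^s(-1)^{i+1}\#x_i\otimes_k\mathbf x_{1\hat\imath s}\otimes\mathbf a_{1r}\otimes1+\sum_{i=1}^s(-1)^i\otimes_k\mathbf x_{1\hat\imath s}\otimes\mathbf a_{1r}\otimes1\#x_i\\&+\sum_{i=1}^s\sum_{h=1}^r(-1)^i\otimes_k\mathbf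 x_{1\hat\imath s}\otimes\mathbf a_{1,h-1}\otimes a_h^{x_i}\otimes\mathbf a_{h+1,r}\otimes1\\&+\sum_{1\le i<j\le s}(-1)^{i+j}\otimes_k[x_i,x_j]\wedge\mathbf x_{1\hat\imath\hat\jmath s}\otimes\mathbf a_{1r}\otimes1,\end{aligned}$$ $$d^2(\mathbf y)=\sum_{1\le i<j\le s}\ \sum_{h=0}^r(-1)^{i+j+h+s}\otimes_k\mathbf x_{1\hat\imath\hat\jmath s}\otimes\mathbf a_{1h}\otimes\widehat f_{ij}\otimes\mathbf a_{h+1,r}\otimes1,$$ and $d^l=0$ for all $l\ge3$. -/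

import Mathlib

open scoped TensorProduct

noncomputable section

namespace DiffOp

universe u v w

section HopfStructure

variable (k : Type u) [Field k] (g : Type w) [LieRing g] [LieAlgebra k g]

/-- The enveloping algebra `U(g)`. -/
abbrev U : Type _ := UniversalEnvelopingAlgebra k g

section

attribute [local instance] LieRing.ofAssociativeRing

/-- The canonical map `g → U(g)`. -/
def U.of : g →ₗ[k] U k g := (UniversalEnvelopingAlgebra.ι k : g →ₗ⁅k⁆ U k g)

theorem U.of_lie (x y : g) :
    U.of k g ⁅x, y⁆ = U.of k g x * U.of k g y - U.of k g y * U.of k g x := by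
  have h := (UniversalEnvelopingAlgebra.ι k : g →ₗ⁅k⁆ U k g).map_lie x y
  rw [LieRing.of_associative_ring_bracket] at h
  exact h

/-- The comultiplication of `U(g)`: the algebra map with `Δ(x) = x ⊗ 1 + 1 ⊗ x` for `x` in `g`. -/
def U.comul : U k g →ₐ[k] U k g ⊗[k] U k g :=
  UniversalEnvelopingAlgebra.lift k
    { toFun := fun x => U.of k g x ⊗ₜ[k] 1 + 1 ⊗ₜ[k] U.of k g x
      map_add' := fun x y => by
        simp only [map_add, TensorProduct.add_tmul, TensorProduct.tmul_add]; abel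
      map_smul' := fun c x => by
        simp only [map_smul, TensorProduct.smul_tmul', TensorProduct.tmul_smul, smul_add,
          RingHom.id_apply]
      map_lie' := fun {x y} => by
        simp only [U.of_lie, LieRing.of_associative_ring_bracket, mul_add, add_mul,
          Algebra.TensorProduct.tmul_mul_tmul, one_mul, mul_one, TensorProduct.sub_tmul,
          TensorProduct.tmul_sub]
        abel }

theorem U.comul_of (x : g) :
    U.comul k g (U.of k g x) = U.of k g x ⊗ₜ[k] 1 + 1 ⊗ₜ[k] U.of k g x :=
  UniversalEnvelopingAlgebra.lift_ι_apply k _ x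

/-- The counit of `U(g)`: the algebra map vanishing on `g`. -/
def U.counit : U k g →ₐ[k] k :=
  UniversalEnvelopingAlgebra.lift k (0 : g →ₗ⁅k⁆ k)

theorem U.counit_of (x : g) : U.counit k g (U.of k g x) = 0 :=
  UniversalEnvelopingAlgebra.lift_ι_apply k _ x

end

/-- The iterated comultiplication `h ↦ h⁽¹⁾ ⊗ (h⁽²⁾ ⊗ h⁽³⁾)`. -/
def U.comul₃ : U k g →ₗ[k] U k g ⊗[k] (U k g ⊗[k] U k g) :=
  LinearMap.lTensor (U k g) (U.comul k g).toLinearMap ∘ₗ (U.comul k g).toLinearMap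

end HopfStructure

section Crossed

variable {k : Type u} [Field k] {A : Type v} [Ring A] [Algebra k A]
  {g : Type w} [LieRing g] [LieAlgebra k g]

/-- The linear map `(h ⊗ h') , (l ⊗ l') ↦ f(h, l) ⊗ h' l'`. -/
def twistCore (f : U k g →ₗ[k] U k g →ₗ[k] A) :
    (U k g ⊗[k] U k g) →ₗ[k] (U k g ⊗[k] U k g) →ₗ[k] A ⊗[k] U k g :=
  TensorProduct.curry
    (TensorProduct.map (TensorProduct.lift f) (LinearMap.mul' k (U k g)) ∘ₗ
      (TensorProduct.tensorTensorTensorComm k (U k g) (U k g) (U k g) (U k g)).toLinearMap)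

/-- Left multiplication on the first factor: `a , (b ⊗ h) ↦ ab ⊗ h`. -/
def leftMulA : A →ₗ[k] (A ⊗[k] U k g) →ₗ[k] A ⊗[k] U k g :=
  LinearMap.rTensorHom (U k g) ∘ₗ LinearMap.mul k A

/-- The linear map `h ⊗ (h' ⊗ h'') , b ⊗ (l ⊗ l') ↦ b ^ h f(h', l) ⊗ h'' l'`. -/
def crossCore (act : U k g →ₗ[k] A →ₗ[k] A) (f : U k g →ₗ[k] U k g →ₗ[k] A) :
    (U k g ⊗[k] (U k g ⊗[k] U k g)) →ₗ[k] (A ⊗[k] (U k g ⊗[k] U k g)) →ₗ[k] A ⊗[k] U k g :=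
  TensorProduct.curry
    (TensorProduct.lift leftMulA ∘ₗ
      TensorProduct.map (TensorProduct.lift act) (TensorProduct.lift (twistCore f)) ∘ₗ
      (TensorProduct.tensorTensorTensorComm k (U k g) (U k g ⊗[k] U k g) A
        (U k g ⊗[k] U k g)).toLinearMap)

/-- The multiplication of `A #_f U(g)` on the space `A ⊗ U(g)`:
`(a ⊗ h)(b ⊗ l) = ∑ a b ^ h⁽¹⁾ f(h⁽²⁾, l⁽¹⁾) ⊗ h⁽³⁾ l⁽²⁾`; here `act h b` is `b ^ h`. -/
def crossMul (act : U k g →ₗ[k] A →ₗ[k] A) (f : U k g →ₗ[k] U k g →ₗ[k] A) :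
    (A ⊗[k] U k g) →ₗ[k] (A ⊗[k] U k g) →ₗ[k] A ⊗[k] U k g :=
  TensorProduct.curry
    (TensorProduct.lift leftMulA ∘ₗ
      LinearMap.lTensor A (TensorProduct.lift
        ((crossCore act f).compl₁₂ (U.comul₃ k g)
          (LinearMap.lTensor A (U.comul k g).toLinearMap))) ∘ₗ
      (TensorProduct.assoc k A (U k g) (A ⊗[k] U k g)).toLinearMap)

/-- The multiplication of `A #_f U(g)` in Sweedler form, for any presentation of the iterated
coproduct of `h` and of the coproduct of `l` by pure tensors. -/
theorem crossMul_tmul (act : U k g →ₗ[k] A →ₗ[k] A) (f : U k g →ₗ[k] U k g →ₗ[k] A)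
    (a b : A) (h l : U k g) {ι κ : Type} (s : Finset ι) (t : Finset κ)
    (h₁ h₂ h₃ : ι → U k g) (l₁ l₂ : κ → U k g)
    (hh : U.comul₃ k g h = ∑ i ∈ s, h₁ i ⊗ₜ[k] (h₂ i ⊗ₜ[k] h₃ i))
    (hl : U.comul k g l = ∑ j ∈ t, l₁ j ⊗ₜ[k] l₂ j) :
    crossMul act f (a ⊗ₜ h) (b ⊗ₜ l) =
      ∑ i ∈ s, ∑ j ∈ t, (a * (act (h₁ i) b * f (h₂ i) (l₁ j))) ⊗ₜ[k] (h₃ i * l₂ j) := by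
  simp [crossMul, hh, hl, crossCore, twistCore, leftMulA, TensorProduct.tmul_sum,
    LinearMap.sum_apply, map_sum]
  exact Finset.sum_comm

theorem crossMul_leftMulA (act : U k g →ₗ[k] A →ₗ[k] A) (f : U k g →ₗ[k] U k g →ₗ[k] A)
    (a : A) (p q : A ⊗[k] U k g) :
    crossMul act f (leftMulA a p) q = leftMulA a (crossMul act f p q) := by
  have key : ∀ (b : A) (r : A ⊗[k] U k g), leftMulA (k := k) (a * b) r =
      leftMulA (k := k) a (leftMulA (k := k) b r) := by
    intro b r
    induction r using TensorProduct.induction_on with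
    | zero => simp
    | tmul c h => simp [leftMulA, mul_assoc]
    | add x y hx hy => simp only [map_add, hx, hy]
  induction p using TensorProduct.induction_on with
  | zero => simp
  | tmul b h =>
    have : leftMulA (k := k) a (b ⊗ₜ[k] h) = (a * b) ⊗ₜ[k] h := by simp [leftMulA]
    rw [this]
    simp only [crossMul, TensorProduct.curry_apply, LinearMap.comp_apply, LinearEquiv.coe_coe,
      TensorProduct.assoc_tmul, LinearMap.lTensor_tmul, TensorProduct.lift.tmul, key]
  | add x y hx hy => simp only [map_add, LinearMap.add_apply, hx, hy]

end Crossed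

/-- The data of a crossed product `E = A #_f U(g)`: a weak action `act h a = a ^ h` of `U(g)`
on `A` and a `k`-linear map `f` from `U(g) ⊗ U(g)` to `A` such that the multiplication
of `A #_f U(g)` is associative with identity `1 # 1`. -/
structure CrossedProduct (k : Type u) [Field k] (A : Type v) [Ring A] [Algebra k A]
    (g : Type w) [LieRing g] [LieAlgebra k g] where
  /-- the weak action, `act h a` is `a ^ h` -/
  act : U k g →ₗ[k] A →ₗ[k] A
  /-- `(ab) ^ h = ∑ a ^ h⁽¹⁾ b ^ h⁽²⁾` -/
  act_mul : ∀ (h : U k g) (a b : A), act h (a * b) =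
    LinearMap.mul' k A (TensorProduct.map (act.flip a) (act.flip b) (U.comul k g h))
  act_one : ∀ h : U k g, act h 1 = algebraMap k A (U.counit k g h)
  one_act : ∀ a : A, act 1 a = a
  /-- the cocycle -/
  f : U k g →ₗ[k] U k g →ₗ[k] A
  assoc : ∀ p q r : A ⊗[k] U k g,
    crossMul act f (crossMul act f p q) r = crossMul act f p (crossMul act f q r)
  one_cross : ∀ p : A ⊗[k] U k g, crossMul act f (1 ⊗ₜ 1) p = p
  cross_one : ∀ p : A ⊗[k] U k g, crossMul act f p (1 ⊗ₜ 1) = p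

namespace CrossedProduct

variable {k : Type u} [Field k] {A : Type v} [Ring A] [Algebra k A]
  {g : Type w} [LieRing g] [LieAlgebra k g]

/-- The algebra `E = A #_f U(g)`. -/
def E (_C : CrossedProduct k A g) : Type (max u v w) := A ⊗[k] U k g

variable (C : CrossedProduct k A g)

instance : AddCommGroup C.E := inferInstanceAs (AddCommGroup (A ⊗[k] U k g))

instance : Module k C.E := inferInstanceAs (Module k (A ⊗[k] U k g))

/-- The underlying vector space of `E` is `A ⊗ U(g)`. -/
def toE : A ⊗[k] U k g ≃ₗ[k] C.E := LinearEquiv.refl k _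

instance : Ring C.E :=
  { (inferInstance : AddCommGroup C.E) with
    mul := fun p q => C.toE (crossMul C.act C.f (C.toE.symm p) (C.toE.symm q))
    one := C.toE (1 ⊗ₜ 1)
    mul_assoc := fun p q r => C.assoc p q r
    one_mul := fun p => C.one_cross p
    mul_one := fun p => C.cross_one p
    left_distrib := fun p q r => map_add (crossMul C.act C.f p) q r
    right_distrib := fun p q r => LinearMap.map_add₂ (crossMul C.act C.f) p q r
    zero_mul := fun p => LinearMap.map_zero₂ (crossMul C.act C.f) p
    mul_zero := fun p => map_zero (crossMul C.act C.f p) }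

instance : Algebra k C.E :=
  Algebra.ofModule
    (fun c p q => LinearMap.map_smul₂ (crossMul C.act C.f) c p q)
    (fun c p q => map_smul (crossMul C.act C.f p) c q)

/-- The element `a # h` of `E`. -/
def hash (a : A) (h : U k g) : C.E := C.toE (a ⊗ₜ h)

/-- The inclusion `a ↦ a # 1` of `A` in `E`. -/
def inA : A →ₗ[k] C.E := C.toE.toLinearMap ∘ₗ (TensorProduct.mk k A (U k g)).flip 1

/-- The map `x ↦ 1 # x` from `g` to `E`. -/
def inG : g →ₗ[k] C.E := C.toE.toLinearMap ∘ₗ TensorProduct.mk k A (U k g) 1 ∘ₗ U.of k g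

theorem inA_mul_hash (a b : A) (h : U k g) : C.inA a * C.hash b h = C.hash (a * b) h := by
  have h1 : C.inA a = leftMulA (k := k) a (1 ⊗ₜ[k] (1 : U k g)) := by
    simp only [leftMulA, LinearMap.comp_apply, LinearMap.mul_apply', LinearMap.coe_rTensorHom,
      LinearMap.rTensor_tmul, mul_one]
    rfl
  have h2 : C.hash (a * b) h = leftMulA (k := k) a (b ⊗ₜ[k] h) := by
    simp only [leftMulA, LinearMap.comp_apply, LinearMap.mul_apply', LinearMap.coe_rTensorHom,
      LinearMap.rTensor_tmul]
    rfl
  rw [h1, h2]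
  have := crossMul_leftMulA C.act C.f a (1 ⊗ₜ[k] (1 : U k g)) (b ⊗ₜ[k] h)
  rw [C.one_cross] at this
  exact this

theorem inA_one : C.inA 1 = 1 := rfl

theorem inA_mul (a b : A) : C.inA (a * b) = C.inA a * C.inA b :=
  (C.inA_mul_hash a b 1).symm

theorem hash_eq (a : A) (h : U k g) : C.hash a h = C.inA a * C.hash 1 h := by
  rw [inA_mul_hash, mul_one]

theorem act_of_mul (x : g) (a b : A) : C.act (U.of k g x) (a * b) =
    C.act (U.of k g x) a * b + a * C.act (U.of k g x) b := by
  rw [C.act_mul, U.comul_of]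
  simp [C.one_act]

theorem act_of_one (x : g) : C.act (U.of k g x) 1 = 0 := by
  rw [C.act_one, U.counit_of, map_zero]

theorem counit_right_injective {a b : A}
    (h : a ⊗ₜ[k] (1 : U k g) = b ⊗ₜ[k] (1 : U k g)) : a = b := by
  have := congrArg (TensorProduct.lift
    ((LinearMap.lsmul k A).flip.compl₂ (U.counit k g).toLinearMap)) h
  simpa using this

theorem f_one_one : C.f 1 1 = 1 := by
  have h := C.one_cross (1 ⊗ₜ 1)
  rw [crossMul_tmul C.act C.f 1 1 1 1 {0} {0} (fun _ : Fin 1 => 1) (fun _ => 1) (fun _ => 1)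
    (fun _ : Fin 1 => 1) (fun _ => 1) (by simp [U.comul₃, Algebra.TensorProduct.one_def])
    (by simp [Algebra.TensorProduct.one_def])] at h
  simp [C.one_act] at h
  exact counit_right_injective h

theorem f_one_of (x : g) : C.f 1 (U.of k g x) = 0 := by
  have h := C.one_cross (1 ⊗ₜ U.of k g x)
  rw [crossMul_tmul C.act C.f 1 1 1 (U.of k g x) {0} {0, 1}
    (fun _ : Fin 1 => 1) (fun _ => 1) (fun _ => 1)
    ![U.of k g x, 1] ![1, U.of k g x] (by simp [U.comul₃, Algebra.TensorProduct.one_def])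
    (by simp [U.comul_of])] at h
  simp [C.one_act, C.f_one_one] at h
  have := congrArg (TensorProduct.lift
    ((LinearMap.lsmul k A).flip.compl₂ (U.counit k g).toLinearMap)) h
  simpa using this

theorem f_of_one (x : g) : C.f (U.of k g x) 1 = 0 := by
  have h := C.cross_one (1 ⊗ₜ U.of k g x)
  rw [crossMul_tmul C.act C.f 1 1 (U.of k g x) 1 {0, 1, 2} {0}
    ![U.of k g x, 1, 1] ![1, U.of k g x, 1] ![1, 1, U.of k g x]
    (fun _ : Fin 1 => 1) (fun _ => 1)
    (by simp [U.comul₃, U.comul_of, Algebra.TensorProduct.one_def, TensorProduct.tmul_add])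
    (by simp [Algebra.TensorProduct.one_def])] at h
  simp [C.one_act, C.f_one_one, C.act_of_one] at h
  exact counit_right_injective (b := (0 : A)) (by simpa using h)

theorem inG_mul_inA (x : g) (a : A) :
    C.inG x * C.inA a = C.inA (C.act (U.of k g x) a) + C.inA a * C.inG x := by
  have h : crossMul C.act C.f (1 ⊗ₜ U.of k g x) (a ⊗ₜ 1) =
      C.act (U.of k g x) a ⊗ₜ 1 + a ⊗ₜ U.of k g x := by
    rw [crossMul_tmul C.act C.f 1 a (U.of k g x) 1 {0, 1, 2} {0}
      ![U.of k g x, 1, 1] ![1, U.of k g x, 1] ![1, 1, U.of k g x]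
      (fun _ : Fin 1 => 1) (fun _ => 1)
      (by simp [U.comul₃, U.comul_of, Algebra.TensorProduct.one_def, TensorProduct.tmul_add])
      (by simp [Algebra.TensorProduct.one_def])]
    simp [C.one_act, C.f_one_one, C.f_of_one]
  have h2 : C.inA a * C.inG x = C.hash a (U.of k g x) := by
    rw [C.hash_eq]; rfl
  rw [h2]
  exact h

theorem inG_mul_inG (x y : g) : C.inG x * C.inG y =
    C.inA (C.f (U.of k g x) (U.of k g y)) + C.hash 1 (U.of k g x * U.of k g y) := by
  have h : crossMul C.act C.f (1 ⊗ₜ U.of k g x) (1 ⊗ₜ U.of k g y) =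
      C.f (U.of k g x) (U.of k g y) ⊗ₜ 1 + 1 ⊗ₜ (U.of k g x * U.of k g y) := by
    rw [crossMul_tmul C.act C.f 1 1 (U.of k g x) (U.of k g y) {0, 1, 2} {0, 1}
      ![U.of k g x, 1, 1] ![1, U.of k g x, 1] ![1, 1, U.of k g x]
      ![U.of k g y, 1] ![1, U.of k g y]
      (by simp [U.comul₃, U.comul_of, Algebra.TensorProduct.one_def, TensorProduct.tmul_add])
      (by simp [U.comul_of])]
    simp [C.one_act, C.f_one_one, C.f_of_one, C.f_one_of, C.act_of_one]
  exact h

/-- `f̂(x, y) = f(x, y) - f(y, x)` for `x, y` in `g`. -/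
def fhat (x y : g) : A := C.f (U.of k g x) (U.of k g y) - C.f (U.of k g y) (U.of k g x)

theorem inG_commutator (x y : g) :
    C.inG x * C.inG y - C.inG y * C.inG x = C.inG ⁅x, y⁆ + C.inA (C.fhat x y) := by
  have h : C.inG ⁅x, y⁆ = C.hash 1 (U.of k g x * U.of k g y) -
      C.hash 1 (U.of k g y * U.of k g x) := by
    simp only [inG, hash, LinearMap.comp_apply, U.of_lie, map_sub, TensorProduct.mk_apply]
    rfl
  rw [h, inG_mul_inG, inG_mul_inG, fhat, map_sub]
  abel

end CrossedProduct
end DiffOp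

namespace DiffOp

universe u v w

/-- The generators of `Y`: the elements of `A`, and `y_x`, `z_x`, `e_x` for `x` in `g`. -/
inductive YGen (A : Type v) (g : Type w) : Type (max v w)
  | a : A → YGen A g
  | y : g → YGen A g
  | z : g → YGen A g
  | e : g → YGen A g

/-- The degree of a generator: `e_x` has degree one, the others have degree zero. -/
def YGen.deg {A : Type v} {g : Type w} : YGen A g → ℕ
  | .e _ => 1
  | _ => 0

namespace CrossedProduct

variable {k : Type u} [Field k] {A : Type v} [Ring A] [Algebra k A]
  {g : Type w} [LieRing g] [LieAlgebra k g] (C : CrossedProduct k A g)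

/-- A generator, seen in the free algebra. -/
abbrev fr (p : YGen A g) : FreeAlgebra k (YGen A g) := FreeAlgebra.ι k p

/-- The defining relations of `Y`. The first four say that `A` maps to `Y` by a map of algebras. -/
inductive YRel : FreeAlgebra k (YGen A g) → FreeAlgebra k (YGen A g) → Prop
  | a_add (a b : A) : YRel (fr (.a (a + b))) (fr (.a a) + fr (.a b))
  | a_mul (a b : A) : YRel (fr (.a (a * b))) (fr (.a a) * fr (.a b))
  | a_smul (c : k) (a : A) : YRel (fr (.a (c • a))) (c • fr (.a a))
  | a_one : YRel (fr (.a 1)) 1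
  | y_lin (c : k) (x x' : g) : YRel (fr (.y (c • x + x'))) (c • fr (.y x) + fr (.y x'))
  | z_lin (c : k) (x x' : g) : YRel (fr (.z (c • x + x'))) (c • fr (.z x) + fr (.z x'))
  | e_lin (c : k) (x x' : g) : YRel (fr (.e (c • x + x'))) (c • fr (.e x) + fr (.e x'))
  | y_a (x : g) (a : A) : YRel (fr (.y x) * fr (.a a))
      (fr (.a (C.act (U.of k g x) a)) + fr (.a a) * fr (.y x))
  | z_a (x : g) (a : A) : YRel (fr (.z x) * fr (.a a))
      (fr (.a (C.act (U.of k g x) a)) + fr (.a a) * fr (.z x))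
  | e_a (x : g) (a : A) : YRel (fr (.e x) * fr (.a a)) (fr (.a a) * fr (.e x))
  | e_y (x' x : g) : YRel (fr (.e x') * fr (.y x)) (fr (.y x) * fr (.e x') + fr (.e ⁅x', x⁆))
  | e_z (x' x : g) : YRel (fr (.e x') * fr (.z x)) (fr (.z x) * fr (.e x'))
  | e_e (x : g) : YRel (fr (.e x) * fr (.e x)) 0
  | y_y (x' x : g) : YRel (fr (.y x') * fr (.y x))
      (fr (.y x) * fr (.y x') + fr (.y ⁅x', x⁆) + fr (.a (C.fhat x' x)))
  | z_y (x' x : g) : YRel (fr (.z x') * fr (.y x))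
      (fr (.y x) * fr (.z x') + fr (.z ⁅x', x⁆) + fr (.a (C.fhat x' x)))
  | z_z (x' x : g) : YRel (fr (.z x') * fr (.z x))
      (fr (.z x) * fr (.z x') + fr (.z ⁅x', x⁆) + fr (.a (C.fhat x' x)))

/-- The algebra `Y`, by generators and relations. -/
def Y : Type (max u v w) := RingQuot C.YRel

instance : Ring C.Y := inferInstanceAs (Ring (RingQuot C.YRel))

instance : Algebra k C.Y := inferInstanceAs (Algebra k (RingQuot C.YRel))

/-- The quotient map onto `Y`. -/
def mkY : FreeAlgebra k (YGen A g) →ₐ[k] C.Y := RingQuot.mkAlgHom k C.YRel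

/-- The class of a generator in `Y`. -/
def yGen (p : YGen A g) : C.Y := C.mkY (fr p)

/-- The element `a` of `Y`. -/
def Ya (a : A) : C.Y := C.yGen (.a a)
/-- The element `y_x` of `Y`. -/
def Yy (x : g) : C.Y := C.yGen (.y x)
/-- The element `z_x` of `Y`. -/
def Yz (x : g) : C.Y := C.yGen (.z x)
/-- The element `e_x` of `Y`. -/
def Ye (x : g) : C.Y := C.yGen (.e x)

/-- The homogeneous component `Y_s`: the span of the products of generators of total degree `s`. -/
def Ydeg (s : ℕ) : Submodule k C.Y :=
  Submodule.span k {u | ∃ l : List (YGen A g), (l.map YGen.deg).sum = s ∧ u = (l.map C.yGen).prod}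

section YRelations

variable {C}

theorem mk_rel {p q : FreeAlgebra k (YGen A g)} (h : C.YRel p q) :
    C.mkY p = C.mkY q := RingQuot.mkAlgHom_rel k h

variable (C)

theorem Ya_add (a b : A) : C.Ya (a + b) = C.Ya a + C.Ya b := by
  simpa [Ya, yGen] using mk_rel (YRel.a_add (C := C) a b)
theorem Ya_mul (a b : A) : C.Ya (a * b) = C.Ya a * C.Ya b := by
  simpa [Ya, yGen] using mk_rel (YRel.a_mul (C := C) a b)
theorem Ya_smul (c : k) (a : A) : C.Ya (c • a) = c • C.Ya a := by
  simpa [Ya, yGen] using mk_rel (YRel.a_smul (C := C) c a)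
theorem Ya_one : C.Ya 1 = 1 := by
  simpa [Ya, yGen] using mk_rel (YRel.a_one (C := C))
theorem Yy_lin (c : k) (x x' : g) : C.Yy (c • x + x') = c • C.Yy x + C.Yy x' := by
  simpa [Yy, yGen] using mk_rel (YRel.y_lin (C := C) c x x')
theorem Yz_lin (c : k) (x x' : g) : C.Yz (c • x + x') = c • C.Yz x + C.Yz x' := by
  simpa [Yz, yGen] using mk_rel (YRel.z_lin (C := C) c x x')
theorem Ye_lin (c : k) (x x' : g) : C.Ye (c • x + x') = c • C.Ye x + C.Ye x' := by
  simpa [Ye, yGen] using mk_rel (YRel.e_lin (C := C) c x x')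
theorem Yy_a (x : g) (a : A) :
    C.Yy x * C.Ya a = C.Ya (C.act (U.of k g x) a) + C.Ya a * C.Yy x := by
  simpa [Yy, Ya, yGen] using mk_rel (YRel.y_a (C := C) x a)
theorem Yz_a (x : g) (a : A) :
    C.Yz x * C.Ya a = C.Ya (C.act (U.of k g x) a) + C.Ya a * C.Yz x := by
  simpa [Yz, Ya, yGen] using mk_rel (YRel.z_a (C := C) x a)
theorem Ye_a (x : g) (a : A) : C.Ye x * C.Ya a = C.Ya a * C.Ye x := by
  simpa [Ye, Ya, yGen] using mk_rel (YRel.e_a (C := C) x a)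
theorem Ye_y (x' x : g) : C.Ye x' * C.Yy x = C.Yy x * C.Ye x' + C.Ye ⁅x', x⁆ := by
  simpa [Yy, Ye, yGen] using mk_rel (YRel.e_y (C := C) x' x)
theorem Ye_z (x' x : g) : C.Ye x' * C.Yz x = C.Yz x * C.Ye x' := by
  simpa [Yz, Ye, yGen] using mk_rel (YRel.e_z (C := C) x' x)
theorem Ye_e (x : g) : C.Ye x * C.Ye x = 0 := by
  simpa [Ye, yGen] using mk_rel (YRel.e_e (C := C) x)
theorem Yy_y (x' x : g) :
    C.Yy x' * C.Yy x = C.Yy x * C.Yy x' + C.Yy ⁅x', x⁆ + C.Ya (C.fhat x' x) := by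
  simpa [Yy, Ya, yGen] using mk_rel (YRel.y_y (C := C) x' x)
theorem Yz_y (x' x : g) :
    C.Yz x' * C.Yy x = C.Yy x * C.Yz x' + C.Yz ⁅x', x⁆ + C.Ya (C.fhat x' x) := by
  simpa [Yy, Yz, Ya, yGen] using mk_rel (YRel.z_y (C := C) x' x)
theorem Yz_z (x' x : g) :
    C.Yz x' * C.Yz x = C.Yz x * C.Yz x' + C.Yz ⁅x', x⁆ + C.Ya (C.fhat x' x) := by
  simpa [Yz, Ya, yGen] using mk_rel (YRel.z_z (C := C) x' x)

/-- The universal property of `Y`. -/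
def liftY {B : Type*} [Ring B] [Algebra k B] (φ : YGen A g → B)
    (h : ∀ ⦃p q : FreeAlgebra k (YGen A g)⦄, C.YRel p q →
      FreeAlgebra.lift k φ p = FreeAlgebra.lift k φ q) : C.Y →ₐ[k] B :=
  RingQuot.liftAlgHom k ⟨FreeAlgebra.lift k φ, h⟩

theorem liftY_yGen {B : Type*} [Ring B] [Algebra k B] (φ : YGen A g → B)
    (h : ∀ ⦃p q : FreeAlgebra k (YGen A g)⦄, C.YRel p q →
      FreeAlgebra.lift k φ p = FreeAlgebra.lift k φ q) (p : YGen A g) :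
    C.liftY φ h (C.yGen p) = φ p := by
  have := RingQuot.liftAlgHom_mkAlgHom_apply k (FreeAlgebra.lift k φ) h (fr p)
  rw [FreeAlgebra.lift_ι_apply] at this
  exact this

theorem fhat_swap (x x' : g) : C.fhat x x' = -C.fhat x' x := by simp [fhat]

theorem Ye_zero : C.Ye 0 = 0 := by
  have := C.Ye_lin 1 0 0
  simpa only [smul_zero, add_zero, one_smul, left_eq_add] using this

theorem Yz_zero : C.Yz 0 = 0 := by
  have := C.Yz_lin 1 0 0
  simpa only [smul_zero, add_zero, one_smul, left_eq_add] using this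

theorem Yy_zero : C.Yy 0 = 0 := by
  have := C.Yy_lin 1 0 0
  simpa only [smul_zero, add_zero, one_smul, left_eq_add] using this

theorem Yz_neg (x : g) : C.Yz (-x) = -C.Yz x := by
  have := C.Yz_lin (-1) x 0
  simpa [Yz_zero, -neg_smul, neg_one_smul] using this

theorem Ya_neg (a : A) : C.Ya (-a) = -C.Ya a := by
  have := C.Ya_smul (-1) a
  simpa using this

end YRelations

section Derivation

/-- Auxiliary: the matrix `[[parity u, ∂ u], [0, u]]` on generators. -/
def delMatGen : YGen A g → Matrix (Fin 2) (Fin 2) C.Y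
  | .a a => !![C.Ya a, 0; 0, C.Ya a]
  | .y x => !![C.Yy x, 0; 0, C.Yy x]
  | .z x => !![C.Yz x, 0; 0, C.Yz x]
  | .e x => !![-C.Ye x, C.Yz x - C.Yy x; 0, C.Ye x]

theorem delMat_rel ⦃p q : FreeAlgebra k (YGen A g)⦄ (h : C.YRel p q) :
    FreeAlgebra.lift k C.delMatGen p = FreeAlgebra.lift k C.delMatGen q := by
  induction h with
  | a_add a b => ext i j; fin_cases i <;> fin_cases j <;> simp [delMatGen, Ya_add]
  | a_mul a b =>
    simp [delMatGen, Ya_mul]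
  | a_smul c a => ext i j; fin_cases i <;> fin_cases j <;> simp [delMatGen, Ya_smul]
  | a_one => ext i j; fin_cases i <;> fin_cases j <;> simp [delMatGen, Ya_one]
  | y_lin c x x' => ext i j; fin_cases i <;> fin_cases j <;> simp [delMatGen, Yy_lin]
  | z_lin c x x' => ext i j; fin_cases i <;> fin_cases j <;> simp [delMatGen, Yz_lin]
  | e_lin c x x' =>
    ext i j; fin_cases i <;> fin_cases j <;>
      simp [delMatGen, Ye_lin, Yz_lin, Yy_lin, smul_sub] <;> abel
  | y_a x a => ext i j; fin_cases i <;> fin_cases j <;> simp [delMatGen, Yy_a]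
  | z_a x a => ext i j; fin_cases i <;> fin_cases j <;> simp [delMatGen, Yz_a]
  | e_a x a =>
    ext i j; fin_cases i <;> fin_cases j <;>
      simp [delMatGen, Ye_a, sub_mul, mul_sub, Yz_a, Yy_a]
  | e_y x' x =>
    ext i j; fin_cases i <;> fin_cases j <;>
      simp [delMatGen, Ye_y, sub_mul, mul_sub, Yz_y, C.Yy_y x' x] <;> abel
  | e_z x' x =>
    ext i j; fin_cases i <;> fin_cases j <;>
      simp [delMatGen, Ye_z, sub_mul, mul_sub, C.Yz_z x' x]
    have h1 := C.Yz_y x x'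
    have h2 : C.Yz ⁅x, x'⁆ = -C.Yz ⁅x', x⁆ := by rw [← lie_skew, Yz_neg]
    rw [h2, C.fhat_swap, Ya_neg] at h1
    rw [h1]; abel
  | e_e x =>
    have h1 := C.Ye_z x x
    have h2 := C.Ye_y x x
    rw [lie_self, Ye_zero, add_zero] at h2
    ext i j; fin_cases i <;> fin_cases j <;>
      simp [delMatGen, Ye_e, sub_mul, mul_sub, h1, h2]
  | y_y x' x => 
    ext i j; fin_cases i <;> fin_cases j <;> simp [delMatGen, C.Yy_y x' x]
  | z_y x' x =>
    ext i j; fin_cases i <;> fin_cases j <;> simp [delMatGen, C.Yz_y x' x]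
  | z_z x' x =>
    ext i j; fin_cases i <;> fin_cases j <;> simp [delMatGen, C.Yz_z x' x]

/-- Auxiliary: the algebra map `u ↦ [[parity u, ∂ u], [0, u]]`. -/
def delMat : C.Y →ₐ[k] Matrix (Fin 2) (Fin 2) C.Y :=
  C.liftY C.delMatGen C.delMat_rel

theorem delMat_yGen (p : YGen A g) : C.delMat (C.yGen p) = C.delMatGen p :=
  C.liftY_yGen _ _ p

theorem delMat_list (l : List (YGen A g)) :
    C.delMat (l.map C.yGen).prod 1 0 = 0 ∧
    C.delMat (l.map C.yGen).prod 1 1 = (l.map C.yGen).prod ∧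
    C.delMat (l.map C.yGen).prod 0 0 = (-1) ^ (l.map YGen.deg).sum * (l.map C.yGen).prod := by
  induction l with
  | nil => simp
  | cons p l ih =>
    obtain ⟨h1, h2, h3⟩ := ih
    simp only [List.map_cons, List.prod_cons, map_mul, List.sum_cons, Matrix.mul_apply,
      Fin.sum_univ_two, h1, h2, h3, delMat_yGen, pow_add, mul_zero, add_zero]
    have hc : ∀ (n : ℕ) (u : C.Y), u * (-1) ^ n = (-1) ^ n * u := fun n u =>
      (((Commute.one_right u).neg_right).pow_right n).eq
    cases p <;>
      simp [delMatGen, YGen.deg, yGen, Ya, Yy, Yz, Ye, ← mul_assoc, hc]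

theorem delMat_mem {s : ℕ} {u : C.Y} (hu : u ∈ C.Ydeg s) :
    C.delMat u 1 0 = 0 ∧ C.delMat u 1 1 = u ∧ C.delMat u 0 0 = (-1) ^ s * u := by
  induction hu using Submodule.span_induction with
  | mem u h =>
    obtain ⟨l, hl, rfl⟩ := h
    rw [← hl]
    exact C.delMat_list l
  | zero => simp
  | add u v _ _ h h' =>
    obtain ⟨h1, h2, h3⟩ := h
    obtain ⟨h1', h2', h3'⟩ := h'
    simp [h1, h2, h3, h1', h2', h3', mul_add]
  | smul c u _ h =>
    obtain ⟨h1, h2, h3⟩ := h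
    simp [h1, h2, h3]

theorem Ydeg_span (u : C.Y) :
    u ∈ Submodule.span k {u | ∃ l : List (YGen A g), u = (l.map C.yGen).prod} := by
  obtain ⟨p, rfl⟩ : ∃ p, C.mkY p = u := RingQuot.mkAlgHom_surjective k C.YRel u
  induction p using FreeAlgebra.induction with
  | grade0 c =>
    rw [AlgHom.commutes, Algebra.algebraMap_eq_smul_one]
    exact Submodule.smul_mem _ _ (Submodule.subset_span ⟨[], by simp⟩)
  | grade1 p => exact Submodule.subset_span ⟨[p], by simp [yGen]⟩
  | add p q hp hq => rw [map_add]; exact Submodule.add_mem _ hp hq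
  | mul p q hp hq =>
    rw [map_mul]
    refine Submodule.span_induction ?_ ?_ ?_ ?_ hp
    · rintro _ ⟨l, rfl⟩
      refine Submodule.span_induction ?_ ?_ ?_ ?_ hq
      · rintro _ ⟨l', rfl⟩
        exact Submodule.subset_span ⟨l ++ l', by simp⟩
      · simp
      · intro u v _ _ hu hv; rw [mul_add]; exact Submodule.add_mem _ hu hv
      · intro c u _ hu; rw [mul_smul_comm]; exact Submodule.smul_mem _ _ hu
    · simp
    · intro u v _ _ hu hv; rw [add_mul]; exact Submodule.add_mem _ hu hv
    · intro c u _ hu; rw [smul_mul_assoc]; exact Submodule.smul_mem _ _ hu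

theorem delMat_one_one (u : C.Y) : C.delMat u 1 1 = u := by
  refine Submodule.span_induction ?_ ?_ ?_ ?_ (C.Ydeg_span u)
  · rintro _ ⟨l, rfl⟩; exact (C.delMat_list l).2.1
  · simp
  · intro u v _ _ hu hv; simp [hu, hv]
  · intro c u _ hu; simp [hu]

/-- Auxiliary: the derivation `∂`. -/
def delAux : C.Y →ₗ[k] C.Y :=
  LinearMap.proj (R := k) (φ := fun _ : Fin 2 => C.Y) 1 ∘ₗ
    LinearMap.proj (R := k) (φ := fun _ : Fin 2 => Fin 2 → C.Y) 0 ∘ₗ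
    (C.delMat.toLinearMap : C.Y →ₗ[k] (Fin 2 → Fin 2 → C.Y))

theorem delAux_apply (u : C.Y) : C.delAux u = C.delMat u 0 1 := rfl

theorem delAux_mul {s : ℕ} {u : C.Y} (hu : u ∈ C.Ydeg s) (v : C.Y) :
    C.delAux (u * v) = C.delAux u * v + (-1) ^ s * (u * C.delAux v) := by
  simp only [delAux_apply, map_mul, Matrix.mul_apply, Fin.sum_univ_two, (C.delMat_mem hu).2.2,
    C.delMat_one_one v, mul_assoc]
  abel

theorem delAux_e (x : g) : C.delAux (C.Ye x) = C.Yz x - C.Yy x := by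
  rw [delAux_apply, Ye, delMat_yGen]; simp [delMatGen]

theorem yGen_mem (p : YGen A g) : C.yGen p ∈ C.Ydeg p.deg :=
  Submodule.subset_span ⟨[p], by simp⟩

theorem Ydeg_mul {s t : ℕ} {u v : C.Y} (hu : u ∈ C.Ydeg s) (hv : v ∈ C.Ydeg t) :
    u * v ∈ C.Ydeg (s + t) := by
  refine Submodule.span_induction ?_ ?_ ?_ ?_ hu
  · rintro _ ⟨l, hl, rfl⟩
    refine Submodule.span_induction ?_ ?_ ?_ ?_ hv
    · rintro _ ⟨l', hl', rfl⟩
      exact Submodule.subset_span ⟨l ++ l', by simp [hl, hl'], by simp⟩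
    · simp
    · intro u v _ _ hu hv; rw [mul_add]; exact Submodule.add_mem _ hu hv
    · intro c u _ hu; rw [mul_smul_comm]; exact Submodule.smul_mem _ _ hu
  · simp
  · intro u v _ _ hu hv; rw [add_mul]; exact Submodule.add_mem _ hu hv
  · intro c u _ hu; rw [smul_mul_assoc]; exact Submodule.smul_mem _ _ hu

theorem neg_one_pow_mem {s : ℕ} (n : ℕ) {u : C.Y} (hu : u ∈ C.Ydeg s) :
    (-1) ^ n * u ∈ C.Ydeg s := by
  rcases neg_one_pow_eq_or C.Y n with h | h <;> simp [h, hu]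

theorem delAux_list (l : List (YGen A g)) :
    (∀ s, (l.map YGen.deg).sum = s + 1 → C.delAux (l.map C.yGen).prod ∈ C.Ydeg s) ∧
    ((l.map YGen.deg).sum = 0 → C.delAux (l.map C.yGen).prod = 0) := by
  have hl : ∀ l : List (YGen A g), (l.map C.yGen).prod ∈ C.Ydeg (l.map YGen.deg).sum :=
    fun l => Submodule.subset_span ⟨l, rfl, rfl⟩
  induction l with
  | nil => simp [delAux_apply]
  | cons p l ih =>
    obtain ⟨h1, h2⟩ := ih
    simp only [List.map_cons, List.prod_cons, List.sum_cons, C.delAux_mul (C.yGen_mem p)]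
    have hp : p.deg = 0 → C.delAux (C.yGen p) = 0 := by
      intro h
      rw [delAux_apply, delMat_yGen]
      cases p <;> simp_all [delMatGen, YGen.deg]
    have hp' : p.deg = 0 ∨ p.deg = 1 := by cases p <;> simp [YGen.deg]
    rcases hp' with h0 | h0
    · rw [hp h0, h0]
      simp only [zero_mul, zero_add, pow_zero, one_mul]
      constructor
      · intro s hs
        have := C.Ydeg_mul (C.yGen_mem p) (h1 s hs)
        rwa [h0, zero_add] at this
      · intro hs; rw [h2 hs, mul_zero]
    · rw [h0]
      constructor
      · intro s hs
        refine Submodule.add_mem _ ?_ (C.neg_one_pow_mem 1 ?_)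
        · have hd : C.delAux (C.yGen p) ∈ C.Ydeg 0 := by
            cases p with
            | e x =>
              have : C.delAux (C.yGen (.e x)) = C.Yz x - C.Yy x := C.delAux_e x
              rw [this]
              exact Submodule.sub_mem _ (C.yGen_mem (.z x)) (C.yGen_mem (.y x))
            | _ => simp [YGen.deg] at h0
          have := C.Ydeg_mul hd (hl l)
          rwa [zero_add, show (l.map YGen.deg).sum = s by omega] at this
        · have hs' : (l.map YGen.deg).sum = s := by omega
          cases s with
          | zero => rw [h2 hs', mul_zero]; exact Submodule.zero_mem _
          | succ t =>
            have := C.Ydeg_mul (C.yGen_mem p) (h1 t hs')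
            rwa [h0, add_comm] at this
      · intro hs; omega

theorem delAux_mem {s : ℕ} {u : C.Y} (hu : u ∈ C.Ydeg (s + 1)) : C.delAux u ∈ C.Ydeg s := by
  refine Submodule.span_induction ?_ ?_ ?_ ?_ hu
  · rintro _ ⟨l, hl, rfl⟩; exact (C.delAux_list l).1 s hl
  · simp
  · intro u v _ _ hu hv; rw [map_add]; exact Submodule.add_mem _ hu hv
  · intro c u _ hu; rw [map_smul]; exact Submodule.smul_mem _ _ hu

theorem delAux_zero {u : C.Y} (hu : u ∈ C.Ydeg 0) : C.delAux u = 0 := by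
  refine Submodule.span_induction ?_ ?_ ?_ ?_ hu
  · rintro _ ⟨l, hl, rfl⟩; exact (C.delAux_list l).2 hl
  · simp
  · intro u v _ _ hu hv; rw [map_add, hu, hv, add_zero]
  · intro c u _ hu; rw [map_smul, hu, smul_zero]

end Derivation

end CrossedProduct
end DiffOp

namespace DiffOp

universe u v w

namespace CrossedProduct

variable {k : Type u} [Field k] {A : Type v} [Ring A] [Algebra k A]
  {g : Type w} [LieRing g] [LieAlgebra k g] (C : CrossedProduct k A g) (K : Subalgebra k A)

/-- The tensor `a₁ ⊗ ⋯ ⊗ aᵣ`, over `k`. -/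
def tens (as : List A) : TensorAlgebra k A := (as.map (TensorAlgebra.ι k)).prod

/-- The element `x₁ ∧ ⋯ ∧ xₛ`. -/
def wedge (xs : List g) : ExteriorAlgebra k g := (xs.map (ExteriorAlgebra.ι k)).prod

/-- The direct sum over `r` and `s` of the spaces `E ⊗ ⋀ˢ g ⊗ A^{⊗ r} ⊗ E`, where all tensor
products are over `k`. -/
abbrev T : Type _ := C.E ⊗[k] (ExteriorAlgebra k g ⊗[k] (TensorAlgebra k A ⊗[k] C.E))

/-- The element `c ⊗ ω ⊗ a₁ ⊗ ⋯ ⊗ aᵣ ⊗ e`, with tensor products over `k`. -/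
def pt (c : C.E) (ω : ExteriorAlgebra k g) (as : List A) (e : C.E) : C.T :=
  c ⊗ₜ[k] (ω ⊗ₜ[k] (tens as ⊗ₜ[k] e))

/-- The elements that have to vanish in order to pass from tensor products over `k` to tensor
products over `K`, and from `A` to `A / K`. -/
inductive XRel : C.T → Prop
  | nil (c : C.E) (ω : ExteriorAlgebra k g) (m : A) (hm : m ∈ K) (e : C.E) :
      XRel (C.pt (c * C.inA m) ω [] e - C.pt c ω [] (C.inA m * e))
  | left (c : C.E) (ω : ExteriorAlgebra k g) (m : A) (hm : m ∈ K) (a : A) (as : List A)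
      (e : C.E) : XRel (C.pt (c * C.inA m) ω (a :: as) e - C.pt c ω (m * a :: as) e)
  | mid (c : C.E) (ω : ExteriorAlgebra k g) (as : List A) (a m : A) (hm : m ∈ K) (b : A)
      (bs : List A) (e : C.E) :
      XRel (C.pt c ω (as ++ a * m :: b :: bs) e - C.pt c ω (as ++ a :: m * b :: bs) e)
  | right (c : C.E) (ω : ExteriorAlgebra k g) (as : List A) (a m : A) (hm : m ∈ K) (e : C.E) :
      XRel (C.pt c ω (as ++ [a * m]) e - C.pt c ω (as ++ [a]) (C.inA m * e))
  | norm (c : C.E) (ω : ExteriorAlgebra k g) (as : List A) (m : A) (hm : m ∈ K) (bs : List A)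
      (e : C.E) : XRel (C.pt c ω (as ++ m :: bs) e)

/-- The `E`-bimodule `X`, the direct sum over `r` and `s` of the
`X_{rs} = (E ⊗_k ⋀ˢ g) ⊗_K (A / K)^{⊗_K r} ⊗_K E`. -/
def X : Type _ := C.T ⧸ Submodule.span k {t | C.XRel K t}

instance : AddCommGroup (C.X K) :=
  inferInstanceAs (AddCommGroup (C.T ⧸ Submodule.span k {t | C.XRel K t}))

instance : Module k (C.X K) :=
  inferInstanceAs (Module k (C.T ⧸ Submodule.span k {t | C.XRel K t}))

/-- The quotient map onto `X`. -/
def mkX : C.T →ₗ[k] C.X K := Submodule.mkQ _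

/-- The class of `c ⊗ ω ⊗ a₁ ⊗ ⋯ ⊗ aᵣ ⊗ e` in `X`. -/
def pureX (c : C.E) (ω : ExteriorAlgebra k g) (as : List A) (e : C.E) : C.X K :=
  C.mkX K (C.pt c ω as e)

/-- The element `c ⊗ x₁ ∧ ⋯ ∧ xₛ ⊗ a₁ ⊗ ⋯ ⊗ aᵣ ⊗ e` of `X_{rs}`. -/
def gen (c : C.E) (xs : List g) (as : List A) (e : C.E) : C.X K := C.pureX K c (wedge xs) as e

/-- Linear maps out of `X`. -/
def liftX {N : Type*} [AddCommGroup N] [Module k N] (φ : C.T →ₗ[k] N)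
    (h : ∀ t, C.XRel K t → φ t = 0) : C.X K →ₗ[k] N :=
  Submodule.liftQ _ φ (by
    rw [Submodule.span_le]
    intro t ht
    exact h t ht)

theorem liftX_pureX {N : Type*} [AddCommGroup N] [Module k N] (φ : C.T →ₗ[k] N)
    (h : ∀ t, C.XRel K t → φ t = 0) (c : C.E) (ω : ExteriorAlgebra k g) (as : List A) (e : C.E) :
    C.liftX K φ h (C.pureX K c ω as e) = φ (C.pt c ω as e) := rfl

variable {C K} in
theorem XRel.eq {t : C.T} (h : C.XRel K t) : C.mkX K t = 0 :=
  (Submodule.Quotient.mk_eq_zero _).2 (Submodule.subset_span h)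

/-- The left action of `E` on `X`. -/
def lact (b : C.E) : C.X K →ₗ[k] C.X K :=
  C.liftX K (C.mkX K ∘ₗ LinearMap.rTensor _ (LinearMap.mulLeft k b)) (by
    have hp : ∀ c ω as e, LinearMap.rTensor _ (LinearMap.mulLeft k b) (C.pt c ω as e) =
      C.pt (b * c) ω as e := fun c ω as e => rfl
    intro t ht
    rw [LinearMap.comp_apply]
    refine XRel.eq ?_
    cases ht with
    | nil c ω m hm e => simp only [map_sub, hp, ← mul_assoc]; exact .nil _ _ _ hm _
    | left c ω m hm a as e => simp only [map_sub, hp, ← mul_assoc]; exact .left _ _ _ hm _ _ _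
    | mid c ω as a m hm b' bs e => simp only [map_sub, hp]; exact .mid _ _ _ _ _ hm _ _ _
    | right c ω as a m hm e => simp only [map_sub, hp]; exact .right _ _ _ _ _ hm _
    | norm c ω as m hm bs e => simp only [hp]; exact .norm _ _ _ _ hm _ _)

/-- The right action of `E` on `X`. -/
def ract (b : C.E) : C.X K →ₗ[k] C.X K :=
  C.liftX K (C.mkX K ∘ₗ LinearMap.lTensor _ (LinearMap.lTensor _ (LinearMap.lTensor _
    (LinearMap.mulRight k b)))) (by
    have hp : ∀ c ω as e, LinearMap.lTensor _ (LinearMap.lTensor _ (LinearMap.lTensor _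
      (LinearMap.mulRight k b))) (C.pt c ω as e) = C.pt c ω as (e * b) := fun c ω as e => rfl
    intro t ht
    rw [LinearMap.comp_apply]
    refine XRel.eq ?_
    cases ht with
    | nil c ω m hm e => simp only [map_sub, hp, mul_assoc]; exact .nil _ _ _ hm _
    | left c ω m hm a as e => simp only [map_sub, hp]; exact .left _ _ _ hm _ _ _
    | mid c ω as a m hm b' bs e => simp only [map_sub, hp]; exact .mid _ _ _ _ _ hm _ _ _
    | right c ω as a m hm e => simp only [map_sub, hp, mul_assoc]; exact .right _ _ _ _ _ hm _
    | norm c ω as m hm bs e => simp only [hp]; exact .norm _ _ _ _ hm _ _)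

theorem lact_pureX (b c : C.E) (ω : ExteriorAlgebra k g) (as : List A) (e : C.E) :
    C.lact K b (C.pureX K c ω as e) = C.pureX K (b * c) ω as e := rfl

theorem ract_pureX (b c : C.E) (ω : ExteriorAlgebra k g) (as : List A) (e : C.E) :
    C.ract K b (C.pureX K c ω as e) = C.pureX K c ω as (e * b) := rfl

/-- A `k`-linear endomorphism of `X` is a map of left `E`-modules. -/
def IsLeftLinear (φ : C.X K →ₗ[k] C.X K) : Prop :=
  ∀ (c : C.E) (m : C.X K), φ (C.lact K c m) = C.lact K c (φ m)

/-- A `k`-linear endomorphism of `X` is a map of `E`-bimodules. -/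
def IsBimoduleMap (φ : C.X K →ₗ[k] C.X K) : Prop :=
  ∀ (c : C.E) (m : C.X K),
    φ (C.lact K c m) = C.lact K c (φ m) ∧ φ (C.ract K c m) = C.ract K c (φ m)

theorem tens_span (t : TensorAlgebra k A) :
    t ∈ Submodule.span k {t | ∃ as : List A, t = tens as} := by
  induction t using TensorAlgebra.induction with
  | algebraMap c =>
    rw [Algebra.algebraMap_eq_smul_one]
    exact Submodule.smul_mem _ _ (Submodule.subset_span ⟨[], by simp [tens]⟩)
  | ι a => exact Submodule.subset_span ⟨[a], by simp [tens]⟩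
  | add p q hp hq => exact Submodule.add_mem _ hp hq
  | mul p q hp hq =>
    refine Submodule.span_induction ?_ ?_ ?_ ?_ hp
    · rintro _ ⟨l, rfl⟩
      refine Submodule.span_induction ?_ ?_ ?_ ?_ hq
      · rintro _ ⟨l', rfl⟩
        exact Submodule.subset_span ⟨l ++ l', by simp [tens]⟩
      · simp
      · intro u v _ _ hu hv; rw [mul_add]; exact Submodule.add_mem _ hu hv
      · intro c u _ hu; rw [mul_smul_comm]; exact Submodule.smul_mem _ _ hu
    · simp
    · intro u v _ _ hu hv; rw [add_mul]; exact Submodule.add_mem _ hu hv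
    · intro c u _ hu; rw [smul_mul_assoc]; exact Submodule.smul_mem _ _ hu

theorem E_induction {P : C.E → Prop} (zero : P 0) (hash : ∀ a h, P (C.hash a h))
    (add : ∀ p q, P p → P q → P (p + q)) (e : C.E) : P e :=
  TensorProduct.induction_on (motive := P) e zero hash add

theorem T_induction {P : C.T → Prop} (zero : P 0)
    (pt : ∀ c ω as e, P (C.pt c ω as e)) (add : ∀ p q, P p → P q → P (p + q)) (t : C.T) : P t := by
  induction t using TensorProduct.induction_on with
  | zero => exact zero
  | add p q hp hq => exact add p q hp hq
  | tmul c t =>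
    induction t using TensorProduct.induction_on with
    | zero => simpa using zero
    | add p q hp hq => rw [TensorProduct.tmul_add]; exact add _ _ hp hq
    | tmul ω t =>
      induction t using TensorProduct.induction_on with
      | zero => simpa using zero
      | add p q hp hq => rw [TensorProduct.tmul_add, TensorProduct.tmul_add]; exact add _ _ hp hq
      | tmul t e =>
        have := tens_span (k := k) t
        induction this using Submodule.span_induction generalizing c with
        | zero => simpa using zero
        | mem t ht => obtain ⟨as, rfl⟩ := ht; exact pt c ω as e
        | add p q _ _ hp hq =>
          rw [TensorProduct.add_tmul, TensorProduct.tmul_add, TensorProduct.tmul_add]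
          exact add _ _ (hp c) (hq c)
        | smul r p _ hp =>
          have := hp (r • c)
          simpa only [TensorProduct.smul_tmul, TensorProduct.tmul_smul,
            ← TensorProduct.smul_tmul'] using this

theorem X_induction {P : C.X K → Prop} (zero : P 0)
    (pure : ∀ c ω as e, P (C.pureX K c ω as e)) (add : ∀ p q, P p → P q → P (p + q))
    (m : C.X K) : P m := by
  obtain ⟨t, rfl⟩ : ∃ t, C.mkX K t = m := Submodule.mkQ_surjective _ m
  induction t using C.T_induction with
  | zero => simpa using zero
  | pt c ω as e => exact pure c ω as e
  | add p q hp hq => rw [map_add]; exact add _ _ hp hq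

theorem X_hom_ext {N : Type*} [AddCommGroup N] [Module k N] {φ ψ : C.X K →ₗ[k] N}
    (h : ∀ c ω as e, φ (C.pureX K c ω as e) = ψ (C.pureX K c ω as e)) : φ = ψ := by
  ext m
  induction m using C.X_induction K with
  | zero => simp
  | pure c ω as e => exact h c ω as e
  | add p q hp hq => simp [hp, hq]

theorem pureX_add (c : C.E) (ω : ExteriorAlgebra k g) (as : List A) (e e' : C.E) :
    C.pureX K c ω as (e + e') = C.pureX K c ω as e + C.pureX K c ω as e' := by
  simp only [pureX, pt, TensorProduct.tmul_add, map_add]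

theorem pt_add (c : C.E) (ω : ExteriorAlgebra k g) (as : List A) (e e' : C.E) :
    C.pt c ω as (e + e') = C.pt c ω as e + C.pt c ω as e' := by
  simp only [pt, TensorProduct.tmul_add]

theorem pt_zero (c : C.E) (ω : ExteriorAlgebra k g) (as : List A) :
    C.pt c ω as 0 = 0 := by
  simp only [pt, TensorProduct.tmul_zero]

theorem pureX_zero (c : C.E) (ω : ExteriorAlgebra k g) (as : List A) :
    C.pureX K c ω as 0 = 0 := by
  rw [pureX, pt_zero, map_zero]

theorem tens_append (as bs : List A) : tens (k := k) (as ++ bs) = tens as * tens bs := by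
  simp [tens]

/-- To check that a linear map out of `T` vanishes on the relations, it is enough to do it for
elements whose last factor is `a # h`. -/
theorem XRel.map_eq_zero {N : Type*} [AddCommGroup N] [Module k N] (φ : C.T →ₗ[k] N)
    (nil : ∀ (c : C.E) (ω : ExteriorAlgebra k g) (m : A) (_ : m ∈ K) (a : A) (h : U k g),
      φ (C.pt (c * C.inA m) ω [] (C.hash a h)) = φ (C.pt c ω [] (C.hash (m * a) h)))
    (left : ∀ (c : C.E) (ω : ExteriorAlgebra k g) (m : A) (_ : m ∈ K) (b : A) (as : List A)
      (a : A) (h : U k g), φ (C.pt (c * C.inA m) ω (b :: as) (C.hash a h)) =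
        φ (C.pt c ω (m * b :: as) (C.hash a h)))
    (mid : ∀ (c : C.E) (ω : ExteriorAlgebra k g) (as : List A) (b m : A) (_ : m ∈ K) (b' : A)
      (bs : List A) (a : A) (h : U k g), φ (C.pt c ω (as ++ b * m :: b' :: bs) (C.hash a h)) =
        φ (C.pt c ω (as ++ b :: m * b' :: bs) (C.hash a h)))
    (right : ∀ (c : C.E) (ω : ExteriorAlgebra k g) (as : List A) (b m : A) (_ : m ∈ K)
      (a : A) (h : U k g), φ (C.pt c ω (as ++ [b * m]) (C.hash a h)) =
        φ (C.pt c ω (as ++ [b]) (C.hash (m * a) h)))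
    (norm : ∀ (c : C.E) (ω : ExteriorAlgebra k g) (as : List A) (m : A) (_ : m ∈ K) (bs : List A)
      (a : A) (h : U k g), φ (C.pt c ω (as ++ m :: bs) (C.hash a h)) = 0)
    (t : C.T) (ht : C.XRel K t) : φ t = 0 := by
  cases ht with
  | nil c ω m hm e =>
    induction e using C.E_induction with
    | zero => simp [pt_zero]
    | hash a h => rw [map_sub, inA_mul_hash, nil c ω m hm, sub_self]
    | add p q hp hq =>
      rw [mul_add, pt_add, pt_add, add_sub_add_comm, map_add, hp, hq, add_zero]
  | left c ω m hm b as e =>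
    induction e using C.E_induction with
    | zero => simp [pt_zero]
    | hash a h => rw [map_sub, left c ω m hm, sub_self]
    | add p q hp hq =>
      rw [pt_add, pt_add, add_sub_add_comm, map_add, hp, hq, add_zero]
  | mid c ω as b m hm b' bs e =>
    induction e using C.E_induction with
    | zero => simp [pt_zero]
    | hash a h => rw [map_sub, mid c ω as b m hm, sub_self]
    | add p q hp hq =>
      rw [pt_add, pt_add, add_sub_add_comm, map_add, hp, hq, add_zero]
  | right c ω as b m hm e =>
    induction e using C.E_induction with
    | zero => simp [pt_zero]
    | hash a h => rw [map_sub, inA_mul_hash, right c ω as b m hm, sub_self]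
    | add p q hp hq =>
      rw [mul_add, pt_add, pt_add, add_sub_add_comm, map_add, hp, hq, add_zero]
  | norm c ω as m hm bs e =>
    induction e using C.E_induction with
    | zero => simp [pt_zero]
    | hash a h => exact norm c ω as m hm bs a h
    | add p q hp hq =>
      rw [pt_add, map_add, hp, hq, add_zero]

section Shift

/-- Auxiliary: `t ⊗ (b # h) ↦ (t ⊗ b) ⊗ (1 # h)`. -/
def shiftAux : TensorAlgebra k A ⊗[k] C.E →ₗ[k] TensorAlgebra k A ⊗[k] C.E :=
  LinearMap.lTensor _ (C.toE.toLinearMap ∘ₗ TensorProduct.mk k A (U k g) 1) ∘ₗ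
  LinearMap.rTensor _ (LinearMap.mul' k (TensorAlgebra k A) ∘ₗ
    LinearMap.lTensor _ (TensorAlgebra.ι k)) ∘ₗ
  (TensorProduct.assoc k (TensorAlgebra k A) A (U k g)).symm.toLinearMap ∘ₗ
  LinearMap.lTensor _ C.toE.symm.toLinearMap

/-- Auxiliary: `c ⊗ ω ⊗ t ⊗ (b # h) ↦ c ⊗ ω ⊗ t ⊗ b ⊗ (1 # h)`. -/
def shiftT : C.T →ₗ[k] C.T :=
  LinearMap.lTensor _ (LinearMap.lTensor _ C.shiftAux)

theorem shiftT_pt (c : C.E) (ω : ExteriorAlgebra k g) (as : List A) (a : A) (h : U k g) :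
    C.shiftT (C.pt c ω as (C.hash a h)) = C.pt c ω (as ++ [a]) (C.hash 1 h) := by
  have : tens (k := k) (as ++ [a]) = tens as * TensorAlgebra.ι k a := by simp [tens]
  rw [pt, pt, this]
  rfl

/-- Auxiliary: the map induced by `shiftT`. -/
def shift : C.X K →ₗ[k] C.X K :=
  C.liftX K (C.mkX K ∘ₗ C.shiftT) (by
    apply XRel.map_eq_zero
    all_goals intros
    all_goals simp only [LinearMap.comp_apply, shiftT_pt, List.append_assoc, List.cons_append,
      List.nil_append]
    · rw [← sub_eq_zero, ← map_sub]; exact (XRel.left _ _ _ ‹_› _ _ _).eq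
    · rw [← sub_eq_zero, ← map_sub]; exact (XRel.left _ _ _ ‹_› _ _ _).eq
    · rw [← sub_eq_zero, ← map_sub]; exact (XRel.mid _ _ _ _ _ ‹_› _ _ _).eq
    · rw [← sub_eq_zero, ← map_sub]; exact (XRel.mid _ _ _ _ _ ‹_› _ _ _).eq
    · exact (XRel.norm _ _ _ _ ‹_› _ _).eq)

theorem shift_pureX (c : C.E) (ω : ExteriorAlgebra k g) (as : List A) (a : A) (h : U k g) :
    C.shift K (C.pureX K c ω as (C.hash a h)) = C.pureX K c ω (as ++ [a]) (C.hash 1 h) := by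
  rw [shift, liftX_pureX, LinearMap.comp_apply, shiftT_pt, pureX]

/-- Auxiliary: `c ⊗ (a # h) ↦ ca ⊗ (1 # h)`. -/
def absorbAux : C.E ⊗[k] C.E →ₗ[k] C.E ⊗[k] C.E :=
  LinearMap.lTensor _ (C.toE.toLinearMap ∘ₗ TensorProduct.mk k A (U k g) 1) ∘ₗ
  LinearMap.rTensor _ (LinearMap.mul' k C.E ∘ₗ LinearMap.lTensor _ C.inA) ∘ₗ
  (TensorProduct.assoc k C.E A (U k g)).symm.toLinearMap ∘ₗ
  LinearMap.lTensor _ C.toE.symm.toLinearMap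

theorem absorbAux_tmul (c : C.E) (a : A) (h : U k g) :
    C.absorbAux (c ⊗ₜ C.hash a h) = (c * C.inA a) ⊗ₜ C.hash 1 h := rfl

/-- Auxiliary: `c ⊗ ω ⊗ e ↦ c ⊗ ω ⊗ 1 ⊗ e`. -/
def insX : C.E ⊗[k] (ExteriorAlgebra k g ⊗[k] C.E) →ₗ[k] C.X K :=
  C.mkX K ∘ₗ LinearMap.lTensor _ (LinearMap.lTensor _ (TensorProduct.mk k (TensorAlgebra k A) _ 1))

theorem insX_tmul (c : C.E) (ω : ExteriorAlgebra k g) (e : C.E) :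
    C.insX K (c ⊗ₜ (ω ⊗ₜ e)) = C.pureX K c ω [] e := rfl

/-- Auxiliary: `c ⊗ ω ⊗ (a # h) ↦ ca ⊗ ω ⊗ (1 # h)`. -/
def absorbW : C.E ⊗[k] (ExteriorAlgebra k g ⊗[k] C.E) →ₗ[k] C.X K :=
  C.insX K ∘ₗ (TensorProduct.leftComm k _ _ _).toLinearMap ∘ₗ
    LinearMap.lTensor _ C.absorbAux ∘ₗ (TensorProduct.leftComm k _ _ _).toLinearMap

theorem absorbW_tmul (c : C.E) (ω : ExteriorAlgebra k g) (a : A) (h : U k g) :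
    C.absorbW K (c ⊗ₜ (ω ⊗ₜ C.hash a h)) = C.pureX K (c * C.inA a) ω [] (C.hash 1 h) := by
  simp only [absorbW, LinearMap.comp_apply, LinearEquiv.coe_coe, TensorProduct.leftComm_tmul,
    LinearMap.lTensor_tmul, absorbAux_tmul, insX_tmul]

/-- Auxiliary: `c ⊗ ω ⊗ t ⊗ e ↦ ε(t) c ⊗ ω ⊗ e`. -/
def augT : C.T →ₗ[k] C.E ⊗[k] (ExteriorAlgebra k g ⊗[k] C.E) :=
  LinearMap.lTensor _ (LinearMap.lTensor _ ((TensorProduct.lid k C.E).toLinearMap ∘ₗ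
    LinearMap.rTensor _ (TensorAlgebra.algebraMapInv (R := k) (M := A)).toLinearMap))

theorem augT_nil (c : C.E) (ω : ExteriorAlgebra k g) (e : C.E) :
    C.augT (C.pt c ω [] e) = c ⊗ₜ (ω ⊗ₜ e) := by
  simp [augT, pt, tens]

theorem augT_append (c : C.E) (ω : ExteriorAlgebra k g) (as : List A) (a : A) (bs : List A)
    (e : C.E) : C.augT (C.pt c ω (as ++ a :: bs) e) = 0 := by
  simp [augT, pt, tens, TensorAlgebra.algebraMapInv]

theorem augT_cons (c : C.E) (ω : ExteriorAlgebra k g) (a : A) (bs : List A)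
    (e : C.E) : C.augT (C.pt c ω (a :: bs) e) = 0 := C.augT_append c ω [] a bs e

/-- Auxiliary: the composite of the augmentation of the rows with its section. -/
def absorb : C.X K →ₗ[k] C.X K :=
  C.liftX K (C.absorbW K ∘ₗ C.augT) (by
    apply XRel.map_eq_zero
    all_goals intros
    all_goals simp only [LinearMap.comp_apply, augT_append, augT_cons, augT_nil, absorbW_tmul,
      map_zero, inA_mul, mul_assoc])

theorem absorb_nil (c : C.E) (ω : ExteriorAlgebra k g) (a : A) (h : U k g) :
    C.absorb K (C.pureX K c ω [] (C.hash a h)) = C.pureX K (c * C.inA a) ω [] (C.hash 1 h) := by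
  rw [absorb, liftX_pureX, LinearMap.comp_apply, augT_nil, absorbW_tmul]

theorem absorb_append (c : C.E) (ω : ExteriorAlgebra k g) (as : List A) (a : A) (bs : List A)
    (e : C.E) : C.absorb K (C.pureX K c ω (as ++ a :: bs) e) = 0 := by
  rw [absorb, liftX_pureX, LinearMap.comp_apply, augT_append, map_zero]

/-- Auxiliary: the involution `ω ↦ (-1) ^ s ω` of the exterior algebra. -/
def invExt : ExteriorAlgebra k g →ₗ[k] ExteriorAlgebra k g :=
  (ExteriorAlgebra.map (-LinearMap.id : g →ₗ[k] g)).toLinearMap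

theorem invExt_wedge (xs : List g) :
    invExt (k := k) (wedge xs) = ((-1 : k) ^ xs.length) • wedge xs := by
  induction xs with
  | nil => simp [invExt, wedge]
  | cons x xs ih =>
    simp only [invExt, wedge, List.map_cons, List.prod_cons, AlgHom.toLinearMap_apply, map_mul,
      List.length_cons] at ih ⊢
    rw [ih, ExteriorAlgebra.map_apply_ι]
    simp [pow_succ]

/-- Auxiliary: the involution `t ↦ (-1) ^ r t` of the tensor algebra. -/
def invTens : TensorAlgebra k A →ₗ[k] TensorAlgebra k A :=
  (TensorAlgebra.lift k (-TensorAlgebra.ι k : A →ₗ[k] TensorAlgebra k A)).toLinearMap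

theorem invTens_tens (as : List A) :
    invTens (k := k) (tens as) = ((-1 : k) ^ as.length) • tens as := by
  induction as with
  | nil => simp [invTens, tens]
  | cons x xs ih =>
    simp only [invTens, tens, List.map_cons, List.prod_cons, AlgHom.toLinearMap_apply, map_mul,
      List.length_cons] at ih ⊢
    rw [ih, TensorAlgebra.lift_ι_apply]
    simp [pow_succ]

/-- Auxiliary: multiplication by `(-1) ^ s` on `X_{rs}`. -/
def signExt : C.X K →ₗ[k] C.X K :=
  C.liftX K (C.mkX K ∘ₗ LinearMap.lTensor _ (LinearMap.rTensor _ invExt)) (by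
    have hp : ∀ c ω as e, LinearMap.lTensor C.E (LinearMap.rTensor (TensorAlgebra k A ⊗[k] C.E)
      (invExt (k := k))) (C.pt c ω as e) = C.pt c (invExt ω) as e := fun c ω as e => rfl
    intro t ht
    rw [LinearMap.comp_apply]
    refine XRel.eq ?_
    cases ht with
    | nil c ω m hm e => simp only [map_sub, hp]; exact .nil _ _ _ hm _
    | left c ω m hm a as e => simp only [map_sub, hp]; exact .left _ _ _ hm _ _ _
    | mid c ω as a m hm b' bs e => simp only [map_sub, hp]; exact .mid _ _ _ _ _ hm _ _ _
    | right c ω as a m hm e => simp only [map_sub, hp]; exact .right _ _ _ _ _ hm _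
    | norm c ω as m hm bs e => simp only [hp]; exact .norm _ _ _ _ hm _ _)

theorem signExt_pureX (c : C.E) (ω : ExteriorAlgebra k g) (as : List A) (e : C.E) :
    C.signExt K (C.pureX K c ω as e) = C.pureX K c (invExt ω) as e := rfl

theorem signExt_gen (c : C.E) (xs : List g) (as : List A) (e : C.E) :
    C.signExt K (C.gen K c xs as e) = ((-1 : k) ^ xs.length) • C.gen K c xs as e := by
  rw [gen, signExt_pureX, invExt_wedge]
  simp only [pureX, pt, ← TensorProduct.smul_tmul', TensorProduct.tmul_smul, map_smul]

/-- Auxiliary: multiplication by `(-1) ^ r` on `X_{rs}`. -/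
def signTens : C.X K →ₗ[k] C.X K :=
  C.liftX K (C.mkX K ∘ₗ LinearMap.lTensor _ (LinearMap.lTensor _
    (LinearMap.rTensor _ invTens))) (by
    have hp : ∀ c ω as e, LinearMap.lTensor C.E (LinearMap.lTensor (ExteriorAlgebra k g)
      (LinearMap.rTensor C.E (invTens (k := k)))) (C.pt c ω as e) =
        ((-1 : k) ^ as.length) • C.pt c ω as e := fun c ω as e => by
      simp only [pt, LinearMap.lTensor_tmul, LinearMap.rTensor_tmul, invTens_tens,
        ← TensorProduct.smul_tmul', TensorProduct.tmul_smul]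
    intro t ht
    rw [LinearMap.comp_apply]
    have hq := XRel.eq ht
    cases ht <;>
      simp only [map_sub, hp, map_smul, List.length_append, List.length_cons, ← smul_sub] at hq ⊢ <;>
      rw [hq, smul_zero])

theorem signTens_pureX (c : C.E) (ω : ExteriorAlgebra k g) (as : List A) (e : C.E) :
    C.signTens K (C.pureX K c ω as e) = ((-1 : k) ^ as.length) • C.pureX K c ω as e := by
  rw [signTens, liftX_pureX]
  simp only [pureX, pt, LinearMap.comp_apply, LinearMap.lTensor_tmul, LinearMap.rTensor_tmul,
    invTens_tens, ← TensorProduct.smul_tmul', TensorProduct.tmul_smul, map_smul]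

end Shift

end CrossedProduct
end DiffOp

namespace DiffOp

universe u v w

namespace CrossedProduct

variable {k : Type u} [Field k] {A : Type v} [Ring A] [Algebra k A]
  {g : Type w} [LieRing g] [LieAlgebra k g] (C : CrossedProduct k A g) (K : Subalgebra k A)

theorem X_hom_ext' {N : Type*} [AddCommGroup N] [Module k N] {φ ψ : C.X K →ₗ[k] N}
    (h : ∀ c ω as a h, φ (C.pureX K c ω as (C.hash a h)) = ψ (C.pureX K c ω as (C.hash a h))) :
    φ = ψ := by
  apply X_hom_ext
  intro c ω as e
  induction e using C.E_induction with
  | zero => simp [pureX_zero]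
  | hash a l => exact h c ω as a l
  | add p q hp hq => simp only [pureX_add, map_add, hp, hq]

theorem pureX_norm (c : C.E) (ω : ExteriorAlgebra k g) (as : List A) (m : A) (hm : m ∈ K)
    (bs : List A) (e : C.E) : C.pureX K c ω (as ++ m :: bs) e = 0 :=
  (XRel.norm c ω as m hm bs e).eq

theorem list_cases_append {B : Type*} (as : List B) : as = [] ∨ ∃ bs b, as = bs ++ [b] := by
  rcases List.eq_nil_or_concat as with h | ⟨bs, b, h⟩
  · exact Or.inl h
  · exact Or.inr ⟨bs, b, by simpa using h⟩

section Differential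

/-- Auxiliary: the right action, as a linear map in the scalar. -/
def ractLin : C.E →ₗ[k] Module.End k (C.X K) where
  toFun := C.ract K
  map_add' p q := by
    apply X_hom_ext
    intro c ω as e
    simp only [ract_pureX, LinearMap.add_apply, mul_add, pureX_add]
  map_smul' r p := by
    apply X_hom_ext
    intro c ω as e
    rw [LinearMap.smul_apply, RingHom.id_apply, ract_pureX, ract_pureX, mul_smul_comm]
    simp only [pureX, pt, TensorProduct.tmul_smul, map_smul]

theorem ractLin_apply (b : C.E) : C.ractLin K b = C.ract K b := rfl

theorem ract_mul (p q : C.E) (m : C.X K) : C.ract K (p * q) m = C.ract K q (C.ract K p m) := by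
  have : C.ract K (p * q) = C.ract K q ∘ₗ C.ract K p := by
    apply X_hom_ext
    intro c ω as e
    simp only [ract_pureX, LinearMap.comp_apply, mul_assoc]
  rw [this, LinearMap.comp_apply]

theorem lact_ract (p q : C.E) (m : C.X K) :
    C.ract K q (C.lact K p m) = C.lact K p (C.ract K q m) := by
  have : C.ract K q ∘ₗ C.lact K p = C.lact K p ∘ₗ C.ract K q := X_hom_ext _ _ fun _ _ _ _ => rfl
  exact LinearMap.congr_fun this m

theorem lact_shift (p : C.E) (m : C.X K) :
    C.shift K (C.lact K p m) = C.lact K p (C.shift K m) := by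
  have : C.shift K ∘ₗ C.lact K p = C.lact K p ∘ₗ C.shift K := by
    apply X_hom_ext'
    intro c ω as a h
    simp only [LinearMap.comp_apply, lact_pureX, shift_pureX]
  exact LinearMap.congr_fun this m

theorem lact_absorb (p : C.E) (m : C.X K) :
    C.absorb K (C.lact K p m) = C.lact K p (C.absorb K m) := by
  have : C.absorb K ∘ₗ C.lact K p = C.lact K p ∘ₗ C.absorb K := by
    apply X_hom_ext'
    intro c ω as a h
    cases as with
    | nil => simp only [LinearMap.comp_apply, lact_pureX, absorb_nil, mul_assoc]
    | cons b bs =>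
      have := C.absorb_append K (p * c) ω [] b bs (C.hash a h)
      have h2 := C.absorb_append K c ω [] b bs (C.hash a h)
      simp only [List.nil_append] at this h2
      simp only [LinearMap.comp_apply, lact_pureX, this, h2, map_zero]
  exact LinearMap.congr_fun this m

/-- Auxiliary: one step of the recursive construction of the bar differential. -/
def barStep : A →ₗ[k] Module.End k (C.X K × C.X K) where
  toFun b := LinearMap.prod
    (-(C.shift K ∘ₗ C.ractLin K (C.inA b) ∘ₗ LinearMap.fst k _ _))
    (C.shift K ∘ₗ C.ractLin K (C.inA b) ∘ₗ LinearMap.snd k _ _ -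
      C.ractLin K (C.inA b) ∘ₗ LinearMap.fst k _ _ +
      C.absorb K ∘ₗ C.ractLin K (C.inA b) ∘ₗ LinearMap.fst k _ _)
  map_add' b b' := by
    apply LinearMap.ext
    rintro ⟨p, v⟩
    apply Prod.ext
    · simp only [LinearMap.prod_apply, Function.prod_apply, map_add, LinearMap.add_apply,
        LinearMap.comp_apply, LinearMap.neg_apply, LinearMap.fst_apply,
        Prod.fst_add]
      abel
    · simp only [LinearMap.prod_apply, Function.prod_apply, map_add, LinearMap.add_apply,
        LinearMap.comp_apply, LinearMap.sub_apply, LinearMap.fst_apply, LinearMap.snd_apply,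
        Prod.snd_add]
      abel
  map_smul' r b := by
    apply LinearMap.ext
    rintro ⟨p, v⟩
    apply Prod.ext
    · simp only [LinearMap.prod_apply, Function.prod_apply, map_smul, LinearMap.smul_apply,
        LinearMap.comp_apply, LinearMap.neg_apply, LinearMap.fst_apply,
        Prod.smul_fst, RingHom.id_apply, smul_neg]
    · simp only [LinearMap.prod_apply, Function.prod_apply, map_smul, LinearMap.smul_apply,
        LinearMap.add_apply, LinearMap.comp_apply, LinearMap.sub_apply, LinearMap.fst_apply,
        LinearMap.snd_apply, Prod.smul_snd, RingHom.id_apply, smul_add, smul_sub]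

theorem barStep_apply (b : A) (p v : C.X K) : C.barStep K b (p, v) =
    (-C.shift K (C.ract K (C.inA b) p),
      C.shift K (C.ract K (C.inA b) v) - C.ract K (C.inA b) p +
        C.absorb K (C.ract K (C.inA b) p)) := rfl

/-- Auxiliary: iteration of `barStep`. -/
def barRun : TensorAlgebra k A →ₗ[k] Module.End k (C.X K × C.X K) :=
  (MulOpposite.opLinearEquiv k).symm.toLinearMap ∘ₗ
    (TensorAlgebra.lift k
      ((MulOpposite.opLinearEquiv k).toLinearMap ∘ₗ C.barStep K)).toLinearMap

theorem barRun_nil : C.barRun K (tens []) = 1 := by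
  simp [barRun, tens]

theorem barRun_append (as bs : List A) (m : C.X K × C.X K) :
    C.barRun K (tens (as ++ bs)) m = C.barRun K (tens bs) (C.barRun K (tens as) m) := by
  simp [barRun, tens_append]

theorem barRun_single (b : A) : C.barRun K (tens [b]) = C.barStep K b := by
  simp [barRun, tens]

/-- Auxiliary: the starting point of the recursion. -/
def barInit : C.E ⊗[k] ExteriorAlgebra k g →ₗ[k] C.X K × C.X K :=
  LinearMap.inl k _ _ ∘ₗ C.insX K ∘ₗ LinearMap.lTensor _
    ((TensorProduct.mk k (ExteriorAlgebra k g) C.E).flip 1)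

theorem barInit_tmul (c : C.E) (ω : ExteriorAlgebra k g) :
    C.barInit K (c ⊗ₜ ω) = (C.pureX K c ω [] 1, 0) := rfl

/-- Auxiliary: evaluation. -/
def barEval : (C.X K × C.X K) →ₗ[k]
    (Module.End k (C.X K × C.X K) ⊗[k] Module.End k (C.X K)) →ₗ[k] C.X K :=
  (TensorProduct.lift (LinearMap.mk₂ k
    (fun (F : Module.End k (C.X K × C.X K)) (G : Module.End k (C.X K)) =>
      G ∘ₗ LinearMap.snd k _ _ ∘ₗ F)
    (fun F F' G => by ext <;> simp) (fun r F G => by ext <;> simp)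
    (fun F G G' => by ext <;> simp) (fun r F G => by ext <;> simp))).flip

/-- Auxiliary: the bar differential, on `T`. -/
def barT : C.T →ₗ[k] C.X K :=
  TensorProduct.lift (C.barEval K) ∘ₗ
    TensorProduct.map (C.barInit K) (TensorProduct.map (C.barRun K) (C.ractLin K)) ∘ₗ
    (TensorProduct.assoc k C.E (ExteriorAlgebra k g) (TensorAlgebra k A ⊗[k] C.E)).symm.toLinearMap

/-- Auxiliary: the state of the recursion. -/
def barState (c : C.E) (ω : ExteriorAlgebra k g) (as : List A) : C.X K × C.X K :=
  C.barRun K (tens as) (C.pureX K c ω [] 1, 0)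

theorem barT_pt (c : C.E) (ω : ExteriorAlgebra k g) (as : List A) (e : C.E) :
    C.barT K (C.pt c ω as e) = C.ract K e (C.barState K c ω as).2 := rfl

theorem barState_nil (c : C.E) (ω : ExteriorAlgebra k g) :
    C.barState K c ω [] = (C.pureX K c ω [] 1, 0) := by
  rw [barState, barRun_nil]; rfl

theorem barState_append (c : C.E) (ω : ExteriorAlgebra k g) (as bs : List A) :
    C.barState K c ω (as ++ bs) = C.barRun K (tens bs) (C.barState K c ω as) :=
  C.barRun_append K as bs _

theorem barState_concat (c : C.E) (ω : ExteriorAlgebra k g) (as : List A) (b : A) :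
    C.barState K c ω (as ++ [b]) = C.barStep K b (C.barState K c ω as) := by
  rw [barState_append, barRun_single]

/-- Auxiliary: the elements whose last factor is in `A`. -/
def endA : Submodule k (C.X K) :=
  Submodule.span k {m | ∃ c ω as a, m = C.pureX K c ω as (C.inA a)}

theorem ract_mem_endA {m : C.X K} (hm : m ∈ C.endA K) (a : A) :
    C.ract K (C.inA a) m ∈ C.endA K := by
  refine Submodule.span_induction ?_ ?_ ?_ ?_ hm
  · rintro _ ⟨c, ω, as, b, rfl⟩
    rw [ract_pureX, ← inA_mul]
    exact Submodule.subset_span ⟨c, ω, as, _, rfl⟩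
  · simp
  · intro p q _ _ hp hq; rw [map_add]; exact Submodule.add_mem _ hp hq
  · intro r p _ hp; rw [map_smul]; exact Submodule.smul_mem _ _ hp

theorem inA_eq_hash (a : A) : C.inA a = C.hash a 1 := rfl

theorem one_eq_hash : (1 : C.E) = C.hash 1 1 := rfl

theorem shift_inA (c : C.E) (ω : ExteriorAlgebra k g) (as : List A) (a : A) :
    C.shift K (C.pureX K c ω as (C.inA a)) = C.pureX K c ω (as ++ [a]) 1 :=
  C.shift_pureX K c ω as a 1

theorem pure_one_mem (c : C.E) (ω : ExteriorAlgebra k g) (as : List A) :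
    C.pureX K c ω as 1 ∈ C.endA K := Submodule.subset_span ⟨c, ω, as, 1, rfl⟩

theorem absorb_inA (c : C.E) (ω : ExteriorAlgebra k g) (a : A) :
    C.absorb K (C.pureX K c ω [] (C.inA a)) = C.pureX K (c * C.inA a) ω [] 1 :=
  C.absorb_nil K c ω a 1

theorem shift_endA {m : C.X K} (hm : m ∈ C.endA K) :
    C.shift K m ∈ C.endA K ∧ C.absorb K m ∈ C.endA K ∧ C.shift K (C.shift K m) = 0 ∧
    C.absorb K (C.shift K m) = 0 ∧ C.shift K (C.absorb K m) = 0 ∧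
    ∀ n ∈ K, C.shift K (C.ract K (C.inA n) m) = C.ract K (C.inA n) (C.shift K m) ∧
      C.absorb K (C.ract K (C.inA n) m) = C.ract K (C.inA n) (C.absorb K m) := by
  refine Submodule.span_induction ?_ ?_ ?_ ?_ hm
  · rintro _ ⟨c, ω, as, a, rfl⟩
    have h1 : ∀ c as, C.shift K (C.pureX K c ω as 1) = 0 := fun c as => by
      have := C.shift_inA K c ω as 1
      rw [inA_one] at this
      rw [this]
      exact C.pureX_norm K c ω as 1 K.one_mem [] 1
    have h2 : C.absorb K (C.pureX K c ω as (C.inA a)) = 0 ∨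
        (as = [] ∧ C.absorb K (C.pureX K c ω as (C.inA a)) = C.pureX K (c * C.inA a) ω [] 1) := by
      rcases list_cases_append as with rfl | ⟨bs, b, rfl⟩
      · exact Or.inr ⟨rfl, C.absorb_inA K c ω a⟩
      · exact Or.inl (C.absorb_append K c ω bs b [] _)
    refine ⟨?_, ?_, ?_, ?_, ?_, ?_⟩
    · rw [shift_inA]; exact C.pure_one_mem K _ _ _
    · rcases h2 with h2 | ⟨_, h2⟩ <;> rw [h2]
      · exact Submodule.zero_mem _
      · exact C.pure_one_mem K _ _ _
    · rw [shift_inA, h1]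
    · rw [shift_inA]; exact C.absorb_append K c ω as a [] _
    · rcases h2 with h2 | ⟨_, h2⟩ <;> rw [h2]
      · simp
      · exact h1 _ _
    · intro n hn
      have h3 : C.ract K (C.inA n) (C.pureX K c ω as (C.inA a)) = C.pureX K c ω as (C.inA (a * n)) := by
        rw [ract_pureX, inA_mul]
      constructor
      · rw [h3, shift_inA, shift_inA, ract_pureX, one_mul, ← sub_eq_zero, pureX, pureX, ← map_sub]
        have := (XRel.right (C := C) (K := K) c ω as a n hn 1).eq
        rwa [mul_one] at this
      · rw [h3]
        rcases list_cases_append as with rfl | ⟨bs, b, rfl⟩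
        · rw [absorb_inA, absorb_inA, ract_pureX, one_mul, ← sub_eq_zero, pureX, pureX, ← map_sub,
            inA_mul, ← mul_assoc]
          have := (XRel.nil (C := C) (K := K) (c * C.inA a) ω n hn 1).eq
          rwa [mul_one] at this
        · rw [absorb_append, absorb_append, map_zero]
  · simp
  · intro p q _ _ hp hq
    obtain ⟨a1, a2, a3, a4, a5, a6⟩ := hp
    obtain ⟨b1, b2, b3, b4, b5, b6⟩ := hq
    refine ⟨?_, ?_, ?_, ?_, ?_, ?_⟩
    · rw [map_add]; exact Submodule.add_mem _ a1 b1
    · rw [map_add]; exact Submodule.add_mem _ a2 b2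
    · rw [map_add, map_add, a3, b3, add_zero]
    · rw [map_add, map_add, a4, b4, add_zero]
    · rw [map_add, map_add, a5, b5, add_zero]
    · intro n hn
      simp only [map_add, (a6 n hn).1, (a6 n hn).2, (b6 n hn).1, (b6 n hn).2, and_self]
  · intro r p _ hp
    obtain ⟨a1, a2, a3, a4, a5, a6⟩ := hp
    refine ⟨?_, ?_, ?_, ?_, ?_, ?_⟩
    · rw [map_smul]; exact Submodule.smul_mem _ _ a1
    · rw [map_smul]; exact Submodule.smul_mem _ _ a2
    · rw [map_smul, map_smul, a3, smul_zero]
    · rw [map_smul, map_smul, a4, smul_zero]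
    · rw [map_smul, map_smul, a5, smul_zero]
    · intro n hn
      simp only [map_smul, (a6 n hn).1, (a6 n hn).2, and_self]

theorem barState_inv (c : C.E) (ω : ExteriorAlgebra k g) (as : List A) :
    (C.barState K c ω as).1 = ((-1 : k) ^ as.length) • C.pureX K c ω as 1 ∧
    (C.barState K c ω as).2 ∈ C.endA K ∧
    C.shift K (C.barState K c ω as).2 - (C.barState K c ω as).1 +
      C.absorb K (C.barState K c ω as).1 = 0 := by
  induction as using List.reverseRecOn with
  | nil =>
    rw [barState_nil]
    have := C.absorb_inA K c ω 1
    rw [inA_one, mul_one] at this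
    simp [this]
  | append_singleton as b ih =>
    obtain ⟨h1, h2, h3⟩ := ih
    rw [barState_concat]
    generalize C.barState K c ω as = s at h1 h2 h3 ⊢
    obtain ⟨p, v⟩ := s
    dsimp only at h1 h2 h3
    rw [barStep_apply]
    have hp : p ∈ C.endA K := h1 ▸ Submodule.smul_mem _ _ (C.pure_one_mem K _ _ _)
    have hpb := C.shift_endA K (C.ract_mem_endA K hp b)
    have hvb := C.shift_endA K (C.ract_mem_endA K h2 b)
    refine ⟨?_, ?_, ?_⟩
    · simp only [h1, map_smul, ract_pureX, one_mul, shift_inA, List.length_append,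
        List.length_singleton, pow_succ, mul_neg, mul_one, neg_smul]
    · exact Submodule.add_mem _ (Submodule.sub_mem _ hvb.1 (C.ract_mem_endA K hp b)) hpb.2.1
    · simp only [map_add, map_sub, map_neg, hpb.2.2.2.1, hpb.2.2.2.2.1, hvb.2.2.1]
      abel

theorem barState_fst_mem (c : C.E) (ω : ExteriorAlgebra k g) (as : List A) :
    (C.barState K c ω as).1 ∈ C.endA K := by
  rw [(C.barState_inv K c ω as).1]
  exact Submodule.smul_mem _ _ (C.pure_one_mem K _ _ _)

theorem barStep_mul_right {p v : C.X K} (hp : p ∈ C.endA K) (hv : v ∈ C.endA K) (b n : A)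
    (hn : n ∈ K) : C.barStep K (b * n) (p, v) =
      (C.ract K (C.inA n) (C.barStep K b (p, v)).1,
        C.ract K (C.inA n) (C.barStep K b (p, v)).2) := by
  have hpb := (C.shift_endA K (C.ract_mem_endA K hp b)).2.2.2.2.2 n hn
  have hvb := (C.shift_endA K (C.ract_mem_endA K hv b)).2.2.2.2.2 n hn
  simp only [barStep_apply, inA_mul, ract_mul, hpb.1, hpb.2, hvb.1, map_neg, map_add, map_sub]

theorem barStep_ract (p v : C.X K) (b n : A) :
    C.barStep K b (C.ract K (C.inA n) p, C.ract K (C.inA n) v) = C.barStep K (n * b) (p, v) := by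
  simp only [barStep_apply, inA_mul, ract_mul]

theorem barStep_mem {p v : C.X K} (hp : p ∈ C.endA K) (hv : v ∈ C.endA K) (n : A)
    (hn : n ∈ K) : C.barStep K n (p, v) =
      (-C.ract K (C.inA n) (C.shift K p),
        C.ract K (C.inA n) (C.shift K v - p + C.absorb K p)) := by
  have hpb := (C.shift_endA K hp).2.2.2.2.2 n hn
  have hvb := (C.shift_endA K hv).2.2.2.2.2 n hn
  simp only [barStep_apply, hpb.1, hpb.2, hvb.1, map_add, map_sub]

theorem barT_rel (t : C.T) (ht : C.XRel K t) : C.barT K t = 0 := by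
  cases ht with
  | nil c ω m hm e => rw [map_sub, barT_pt, barT_pt, barState_nil, barState_nil]; simp
  | left c ω m hm a as e =>
    rw [map_sub, barT_pt, barT_pt, sub_eq_zero]
    have h1 : ∀ (c : C.E) (a : A), C.barState K c ω (a :: as) =
        C.barRun K (tens as) (C.barStep K a (C.pureX K c ω [] 1, 0)) := fun c a => by
      rw [← barState_nil, ← barState_concat, ← barState_append]; simp
    rw [h1, h1]
    simp only [barStep_apply, ract_pureX, one_mul, shift_inA, absorb_inA, List.nil_append]
    have h2 : C.pureX K (c * C.inA m) ω [a] 1 = C.pureX K c ω [m * a] 1 := by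
      rw [← sub_eq_zero, pureX, pureX, ← map_sub]; exact (XRel.left _ _ _ hm _ _ _).eq
    have h3 : C.pureX K (c * C.inA m) ω [] (C.inA a) = C.pureX K c ω [] (C.inA (m * a)) := by
      rw [← sub_eq_zero, pureX, pureX, ← map_sub, inA_mul]; exact (XRel.nil _ _ _ hm _).eq
    simp only [h2, h3, mul_assoc, inA_mul, map_zero]
  | mid c ω as a m hm b bs e =>
    rw [map_sub, barT_pt, barT_pt, sub_eq_zero]
    have h1 : ∀ a b : A, C.barState K c ω (as ++ a :: b :: bs) =
        C.barRun K (tens bs) (C.barStep K b (C.barStep K a (C.barState K c ω as))) :=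
        fun a b => by
      rw [← barState_concat, ← barState_concat, ← barState_append]; simp
    rw [h1, h1]
    have h2 := C.barState_fst_mem K c ω as
    have h3 := (C.barState_inv K c ω as).2.1
    generalize C.barState K c ω as = s at h2 h3 ⊢
    obtain ⟨p, v⟩ := s
    rw [C.barStep_mul_right K h2 h3 a m hm, barStep_ract]
  | right c ω as a m hm e =>
    rw [map_sub, barT_pt, barT_pt, sub_eq_zero, barState_concat, barState_concat]
    have h2 := C.barState_fst_mem K c ω as
    have h3 := (C.barState_inv K c ω as).2.1
    generalize C.barState K c ω as = s at h2 h3 ⊢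
    obtain ⟨p, v⟩ := s
    rw [C.barStep_mul_right K h2 h3 a m hm, ract_mul]
  | norm c ω as m hm bs e =>
    rw [barT_pt]
    have h1 : C.barState K c ω (as ++ m :: bs) =
        C.barRun K (tens bs) (C.barStep K m (C.barState K c ω as)) := by
      rw [← barState_concat, ← barState_append]; simp
    rw [h1]
    have h2 := C.barState_fst_mem K c ω as
    obtain ⟨h5, h3, h4⟩ := C.barState_inv K c ω as
    have h6 : C.shift K (C.barState K c ω as).1 = 0 := by
      have := C.shift_inA K c ω as 1
      rw [inA_one] at this
      rw [h5, map_smul, this, C.pureX_norm K c ω as 1 K.one_mem [] 1, smul_zero]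
    clear h5
    generalize C.barState K c ω as = s at h2 h3 h4 h6 ⊢
    obtain ⟨p, v⟩ := s
    dsimp only at h4 h6
    rw [C.barStep_mem K h2 h3 m hm, h4, h6, map_zero, neg_zero, Prod.mk_zero_zero, map_zero,
      Prod.snd_zero, map_zero]

/-- Auxiliary: the bar differential. -/
def barX : C.X K →ₗ[k] C.X K := C.liftX K (C.barT K) (C.barT_rel K)

theorem barX_pureX (c : C.E) (ω : ExteriorAlgebra k g) (as : List A) (e : C.E) :
    C.barX K (C.pureX K c ω as e) = C.ract K e (C.barState K c ω as).2 := rfl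

/-- `a₁ ⊗ ⋯ ⊗ aᵢ aᵢ₊₁ ⊗ ⋯ ⊗ aᵣ`, where `i` is counted from `0`. -/
def merge (as : List A) (i : Fin (as.length - 1)) : List A :=
  as.take i ++ (as[(i : ℕ)] * as[(i : ℕ) + 1]) :: as.drop (i + 2)

theorem barState_lact (b c : C.E) (ω : ExteriorAlgebra k g) (as : List A) :
    C.barState K (b * c) ω as =
      (C.lact K b (C.barState K c ω as).1, C.lact K b (C.barState K c ω as).2) := by
  induction as using List.reverseRecOn with
  | nil => simp [barState_nil, lact_pureX]
  | append_singleton as a ih =>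
    rw [barState_concat, barState_concat, ih]
    obtain ⟨p, v⟩ := C.barState K c ω as
    simp only [barStep_apply, lact_ract, lact_shift, lact_absorb, map_add, map_sub, map_neg]

theorem barX_bimod : C.IsBimoduleMap K (C.barX K) := by
  intro b m
  have h1 : C.barX K ∘ₗ C.lact K b = C.lact K b ∘ₗ C.barX K := by
    apply X_hom_ext
    intro c ω as e
    simp only [LinearMap.comp_apply, lact_pureX, barX_pureX, barState_lact, lact_ract]
  have h2 : C.barX K ∘ₗ C.ract K b = C.ract K b ∘ₗ C.barX K := by
    apply X_hom_ext
    intro c ω as e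
    simp only [LinearMap.comp_apply, ract_pureX, barX_pureX, ract_mul]
  exact ⟨LinearMap.congr_fun h1 m, LinearMap.congr_fun h2 m⟩

theorem merge_concat (as : List A) (b : A) (i : Fin (as.length - 1)) :
    merge (as ++ [b]) ⟨i, by have := i.2; simp; omega⟩ = merge as i ++ [b] := by
  have := i.2
  simp only [merge]
  rw [List.take_append_of_le_length (by omega), List.drop_append_of_le_length (by omega)]
  rw [List.getElem_append_left (by omega), List.getElem_append_left (by omega)]
  simp

theorem merge_last (as : List A) (a b : A) :
    merge (as ++ [a] ++ [b]) ⟨as.length, by simp⟩ = as ++ [a * b] := by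
  simp [merge]

theorem barState_snd (ω : ExteriorAlgebra k g) (as : List A) (h : as ≠ []) :
    (C.barState K 1 ω as).2 = C.pureX K (C.inA (as.head h)) ω as.tail 1 +
      ∑ i : Fin (as.length - 1), ((-1 : k) ^ ((i : ℕ) + 1)) • C.pureX K 1 ω (merge as i) 1 +
      ((-1 : k) ^ as.length) • C.pureX K 1 ω as.dropLast (C.inA (as.getLast h)) := by
  induction as using List.reverseRecOn with
  | nil => exact absurd rfl h
  | append_singleton as b ih =>
    rw [barState_concat]
    obtain ⟨h1, -, -⟩ := C.barState_inv K 1 ω as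
    rcases list_cases_append as with rfl | ⟨bs, a, rfl⟩
    · rw [barState_nil]
      simp [barStep_apply, ract_pureX, absorb_inA]
      abel
    · have hne : bs ++ [a] ≠ [] := by simp
      specialize ih hne
      generalize C.barState K 1 ω (bs ++ [a]) = s at h1 ih ⊢
      obtain ⟨p, v⟩ := s
      dsimp only at h1 ih
      have hhead : (bs ++ [a] ++ [b]).head h = (bs ++ [a]).head hne :=
        List.head_append_of_ne_nil hne
      have htail : (bs ++ [a] ++ [b]).tail = (bs ++ [a]).tail ++ [b] :=
        List.tail_append_of_ne_nil hne
      have hsum : ∑ i : Fin ((bs ++ [a] ++ [b]).length - 1), ((-1 : k) ^ ((i : ℕ) + 1)) •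
          C.pureX K 1 ω (merge (bs ++ [a] ++ [b]) i) 1 =
          ∑ i : Fin ((bs ++ [a]).length - 1), ((-1 : k) ^ ((i : ℕ) + 1)) •
            C.pureX K 1 ω (merge (bs ++ [a]) i ++ [b]) 1 +
          ((-1 : k) ^ (bs.length + 1)) • C.pureX K 1 ω (bs ++ [a * b]) 1 := by
        have hl : (bs ++ [a] ++ [b]).length - 1 = ((bs ++ [a]).length - 1) + 1 := by simp
        rw [← Fin.sum_congr' _ hl.symm, Fin.sum_univ_castSucc]
        congr 1
        · refine Finset.sum_congr rfl fun i _ => ?_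
          rw [← merge_concat]
          rfl
        · have := merge_last bs a b
          rw [← this]
          simp [Fin.cast]
      rw [hsum, hhead, htail]
      have hab : C.absorb K (C.ract K (C.inA b) p) = 0 := by
        rw [h1, map_smul, ract_pureX, map_smul, absorb_append, smul_zero]
      simp only [barStep_apply]
      rw [hab, add_zero, ih, h1]
      simp only [map_add, map_sum, map_smul, ract_pureX, one_mul, shift_inA, ← inA_mul,
        List.dropLast_concat, List.getLast_append_singleton, List.length_append,
        List.length_singleton, pow_succ, mul_neg, mul_one, neg_smul, sub_eq_add_neg,
        neg_neg, map_neg, add_assoc]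
      rw [pow_add (-1 : k) bs.length (1 + 1)]
      norm_num

/-- Auxiliary: the horizontal differential. -/
def d0Aux : C.X K →ₗ[k] C.X K := C.barX K ∘ₗ C.signExt K

theorem signExt_bimod : C.IsBimoduleMap K (C.signExt K) := by
  intro b m
  have h1 : C.signExt K ∘ₗ C.lact K b = C.lact K b ∘ₗ C.signExt K :=
    X_hom_ext _ _ fun _ _ _ _ => rfl
  have h2 : C.signExt K ∘ₗ C.ract K b = C.ract K b ∘ₗ C.signExt K :=
    X_hom_ext _ _ fun _ _ _ _ => rfl
  exact ⟨LinearMap.congr_fun h1 m, LinearMap.congr_fun h2 m⟩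

theorem d0Aux_bimod : C.IsBimoduleMap K (C.d0Aux K) := by
  intro b m
  simp only [d0Aux, LinearMap.comp_apply, (C.signExt_bimod K b _).1, (C.signExt_bimod K b _).2]
  exact C.barX_bimod K b _

theorem d0Aux_gen (xs : List g) (as : List A) (h : as ≠ []) : C.d0Aux K (C.gen K 1 xs as 1) =
    ((-1 : k) ^ xs.length) • C.gen K (C.inA (as.head h)) xs as.tail 1 +
    ∑ i : Fin (as.length - 1), ((-1 : k) ^ ((i : ℕ) + 1 + xs.length)) •
      C.gen K 1 xs (merge as i) 1 +
    ((-1 : k) ^ (as.length + xs.length)) •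
      C.gen K 1 xs as.dropLast (C.inA (as.getLast h)) := by
  have h1 : C.ract K 1 = LinearMap.id := by
    apply X_hom_ext; intro c ω as e; simp [ract_pureX]
  rw [d0Aux, LinearMap.comp_apply, signExt_gen, map_smul, gen, barX_pureX, h1, LinearMap.id_apply,
    C.barState_snd K _ as h]
  simp only [smul_add, Finset.smul_sum, smul_smul, gen]
  congr 2
  · refine Finset.sum_congr rfl fun i _ => ?_
    rw [← pow_add, add_comm xs.length]
  · rw [← pow_add, add_comm xs.length]

theorem d0Aux_nil (xs : List g) (c e : C.E) : C.d0Aux K (C.gen K c xs [] e) = 0 := by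
  rw [d0Aux, LinearMap.comp_apply, signExt_gen, map_smul, gen, barX_pureX, barState_nil]
  simp

/-- Auxiliary: the horizontal contracting homotopy in positive degrees. -/
def sigmaXAux : C.X K →ₗ[k] C.X K := -(C.shift K ∘ₗ C.signExt K ∘ₗ C.signTens K)

theorem sigmaXAux_left : C.IsLeftLinear K (C.sigmaXAux K) := by
  intro b m
  have h1 : C.sigmaXAux K ∘ₗ C.lact K b = C.lact K b ∘ₗ C.sigmaXAux K := by
    apply X_hom_ext
    intro c ω as e
    simp only [sigmaXAux, LinearMap.comp_apply, LinearMap.neg_apply, lact_pureX, signTens_pureX,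
      map_smul, signExt_pureX, map_neg, ← lact_shift]
  exact LinearMap.congr_fun h1 m

theorem sigmaXAux_gen (c : C.E) (xs : List g) (as : List A) (a : A) (h : U k g) :
    C.sigmaXAux K (C.gen K c xs as (C.hash a h)) =
      ((-1 : k) ^ (as.length + xs.length + 1)) • C.gen K c xs (as ++ [a]) (C.hash 1 h) := by
  have h1 := C.signTens_pureX K c (wedge xs) as (C.hash a h)
  have h2 := C.signExt_gen K c xs as (C.hash a h)
  have h3 := C.shift_pureX K c (wedge xs) as a h
  simp only [gen] at h2 ⊢
  rw [sigmaXAux, LinearMap.neg_apply, LinearMap.comp_apply, LinearMap.comp_apply, h1, map_smul,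
    h2, map_smul, map_smul, h3, smul_smul, ← pow_add, pow_succ, mul_neg, mul_one, neg_smul]

end Differential

end CrossedProduct
end DiffOp

namespace DiffOp

universe u v w

namespace CrossedProduct

variable {k : Type u} [Field k] {A : Type v} [Ring A] [Algebra k A]
  {g : Type w} [LieRing g] [LieAlgebra k g] (C : CrossedProduct k A g) (K : Subalgebra k A)

section WedgeDerivation

variable (k)

/-- Auxiliary: the matrix `[[ω, D ω], [0, ω]]`, where `D` is the derivation of the exterior
algebra with `D x' = [x', x]`. -/
def wedgeMat (x : g) : ExteriorAlgebra k g →ₐ[k] Matrix (Fin 2) (Fin 2) (ExteriorAlgebra k g) :=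
  ExteriorAlgebra.lift k ⟨
    { toFun := fun y => !![ExteriorAlgebra.ι k y, ExteriorAlgebra.ι k ⁅y, x⁆;
        0, ExteriorAlgebra.ι k y]
      map_add' := fun y y' => by
        ext i j; fin_cases i <;> fin_cases j <;> simp
      map_smul' := fun c y => by
        ext i j; fin_cases i <;> fin_cases j <;> simp }, fun y => by
      ext i j; fin_cases i <;> fin_cases j <;> simp [ExteriorAlgebra.ι_add_mul_swap]⟩

theorem wedgeMat_ι (x y : g) : wedgeMat k x (ExteriorAlgebra.ι k y) =
    !![ExteriorAlgebra.ι k y, ExteriorAlgebra.ι k ⁅y, x⁆; 0, ExteriorAlgebra.ι k y] := by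
  simp [wedgeMat]

theorem wedgeMat_diag (x : g) (ω : ExteriorAlgebra k g) :
    wedgeMat k x ω 0 0 = ω ∧ wedgeMat k x ω 1 0 = 0 ∧ wedgeMat k x ω 1 1 = ω := by
  induction ω using ExteriorAlgebra.induction with
  | algebraMap r => simp [Matrix.algebraMap_matrix_apply]
  | ι y => simp [wedgeMat_ι]
  | mul p q hp hq =>
    obtain ⟨h1, h2, h3⟩ := hp
    obtain ⟨h1', h2', h3'⟩ := hq
    simp [Matrix.mul_apply, h1, h2, h3, h1', h2', h3']
  | add p q hp hq =>
    obtain ⟨h1, h2, h3⟩ := hp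
    obtain ⟨h1', h2', h3'⟩ := hq
    simp [h1, h2, h3, h1', h2', h3']

/-- Auxiliary: the derivation of the exterior algebra with `x' ↦ [x', x]`. -/
def wedgeD (x : g) : ExteriorAlgebra k g →ₗ[k] ExteriorAlgebra k g where
  toFun ω := wedgeMat k x ω 0 1
  map_add' p q := by simp
  map_smul' c p := by simp

theorem wedgeD_apply (x : g) (ω : ExteriorAlgebra k g) : wedgeD k x ω = wedgeMat k x ω 0 1 := rfl

theorem wedgeD_ι (x y : g) : wedgeD k x (ExteriorAlgebra.ι k y) = ExteriorAlgebra.ι k ⁅y, x⁆ := by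
  simp [wedgeD_apply, wedgeMat_ι]

theorem wedgeD_mul (x : g) (p q : ExteriorAlgebra k g) :
    wedgeD k x (p * q) = p * wedgeD k x q + wedgeD k x p * q := by
  simp only [wedgeD_apply, map_mul, Matrix.mul_apply, Fin.sum_univ_two, (wedgeMat_diag k x _).1,
    (wedgeMat_diag k x _).2.2]

theorem wedgeD_algebraMap (x : g) (r : k) : wedgeD k x (algebraMap k _ r) = 0 := by
  simp [wedgeD_apply, Matrix.algebraMap_matrix_apply]

theorem wedgeD_one (x : g) : wedgeD k x 1 = 0 := by
  simp [wedgeD_apply]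

theorem wedgeD_lin (c : k) (x x' : g) (ω : ExteriorAlgebra k g) :
    wedgeD k (c • x + x') ω = c • wedgeD k x ω + wedgeD k x' ω := by
  induction ω using ExteriorAlgebra.induction with
  | algebraMap r => simp [wedgeD_algebraMap]
  | ι y => simp [wedgeD_ι]
  | mul p q hp hq =>
    simp only [wedgeD_mul, hp, hq, mul_add, add_mul, smul_add, mul_smul_comm, smul_mul_assoc]
    abel
  | add p q hp hq =>
    simp only [map_add, hp, hq, smul_add]; abel

theorem wedgeD_lie (x' x : g) (ω : ExteriorAlgebra k g) :
    wedgeD k x (wedgeD k x' ω) = wedgeD k x' (wedgeD k x ω) + wedgeD k ⁅x', x⁆ ω := by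
  induction ω using ExteriorAlgebra.induction with
  | algebraMap r => simp [wedgeD_algebraMap]
  | ι y =>
    simp only [wedgeD_ι, ← map_add]
    congr 1
    rw [lie_lie y x' x]
    rw [← lie_skew x' ⁅y, x⁆]
    abel
  | mul p q hp hq =>
    simp only [wedgeD_mul, map_add, hp, hq, mul_add, add_mul]
    abel
  | add p q hp hq =>
    simp only [map_add, hp, hq]; abel

end WedgeDerivation

section SigmaY

/-- Auxiliary: `E ⊗ Λ(g) ⊗ E` over `k`. -/
abbrev W₀ : Type _ := C.E ⊗[k] (ExteriorAlgebra k g ⊗[k] C.E)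

/-- Auxiliary: the elements to vanish in order to have a tensor product over `A`. -/
inductive WRel : C.W₀ → Prop
  | mk (c : C.E) (a : A) (ω : ExteriorAlgebra k g) (e : C.E) :
      WRel ((c * C.inA a) ⊗ₜ (ω ⊗ₜ e) - c ⊗ₜ (ω ⊗ₜ (C.inA a * e)))

/-- Auxiliary: the bimodule `(E ⊗ Λ(g)) ⊗_A E`. -/
def W : Type _ := C.W₀ ⧸ Submodule.span k {t | C.WRel t}

instance : AddCommGroup C.W := inferInstanceAs (AddCommGroup (C.W₀ ⧸ Submodule.span k {t | C.WRel t}))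

instance : Module k C.W := inferInstanceAs (Module k (C.W₀ ⧸ Submodule.span k {t | C.WRel t}))

/-- Auxiliary: the quotient map onto `W`. -/
def mkW : C.W₀ →ₗ[k] C.W := Submodule.mkQ _

/-- Auxiliary: a pure tensor. -/
def pureW : C.E →ₗ[k] ExteriorAlgebra k g →ₗ[k] C.E →ₗ[k] C.W :=
  LinearMap.mk₂ k (fun c ω => C.mkW ∘ₗ
      TensorProduct.mk k C.E _ c ∘ₗ TensorProduct.mk k (ExteriorAlgebra k g) C.E ω)
    (fun c c' ω => LinearMap.ext fun e => by
      change C.mkW ((c + c') ⊗ₜ (ω ⊗ₜ e)) = C.mkW (c ⊗ₜ (ω ⊗ₜ e)) + C.mkW (c' ⊗ₜ (ω ⊗ₜ e))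
      rw [TensorProduct.add_tmul, map_add])
    (fun r c ω => LinearMap.ext fun e => by
      change C.mkW ((r • c) ⊗ₜ (ω ⊗ₜ e)) = r • C.mkW (c ⊗ₜ (ω ⊗ₜ e))
      rw [← TensorProduct.smul_tmul', map_smul])
    (fun c ω ω' => LinearMap.ext fun e => by
      change C.mkW (c ⊗ₜ ((ω + ω') ⊗ₜ e)) = C.mkW (c ⊗ₜ (ω ⊗ₜ e)) + C.mkW (c ⊗ₜ (ω' ⊗ₜ e))
      rw [TensorProduct.add_tmul, TensorProduct.tmul_add, map_add])
    (fun r c ω => LinearMap.ext fun e => by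
      change C.mkW (c ⊗ₜ ((r • ω) ⊗ₜ e)) = r • C.mkW (c ⊗ₜ (ω ⊗ₜ e))
      rw [← TensorProduct.smul_tmul', TensorProduct.tmul_smul, map_smul])

theorem mkW_tmul (c : C.E) (ω : ExteriorAlgebra k g) (e : C.E) :
    C.mkW (c ⊗ₜ (ω ⊗ₜ e)) = C.pureW c ω e := rfl

theorem pureW_bal (c : C.E) (a : A) (ω : ExteriorAlgebra k g) (e : C.E) :
    C.pureW (c * C.inA a) ω e = C.pureW c ω (C.inA a * e) := by
  rw [← sub_eq_zero]
  exact (Submodule.Quotient.mk_eq_zero _).2 (Submodule.subset_span (WRel.mk c a ω e))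

theorem W_induction {P : C.W → Prop} (zero : P 0) (pure : ∀ c ω e, P (C.pureW c ω e))
    (add : ∀ p q, P p → P q → P (p + q)) (m : C.W) : P m := by
  obtain ⟨t, rfl⟩ : ∃ t, C.mkW t = m :=
    Submodule.mkQ_surjective _ m
  induction t using TensorProduct.induction_on with
  | zero => simpa using zero
  | add p q hp hq => rw [map_add]; exact add _ _ hp hq
  | tmul c t =>
    induction t using TensorProduct.induction_on with
    | zero => simpa using zero
    | add p q hp hq => rw [TensorProduct.tmul_add, map_add]; exact add _ _ hp hq
    | tmul ω e => exact pure c ω e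

theorem W_hom_ext {N : Type*} [AddCommGroup N] [Module k N] {φ ψ : C.W →ₗ[k] N}
    (h : ∀ c ω e, φ (C.pureW c ω e) = ψ (C.pureW c ω e)) : φ = ψ := by
  ext m
  induction m using C.W_induction with
  | zero => simp
  | pure c ω e => exact h c ω e
  | add p q hp hq => simp [hp, hq]

/-- Auxiliary: linear maps out of `W`. -/
def liftW {N : Type*} [AddCommGroup N] [Module k N] (φ : C.W₀ →ₗ[k] N)
    (h : ∀ c a ω e, φ ((c * C.inA a) ⊗ₜ (ω ⊗ₜ e)) = φ (c ⊗ₜ (ω ⊗ₜ (C.inA a * e)))) :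
    C.W →ₗ[k] N :=
  Submodule.liftQ _ φ (by
    rw [Submodule.span_le]
    rintro _ ⟨c, a, ω, e⟩
    have := h c a ω e
    rw [← sub_eq_zero, ← map_sub] at this
    exact this)

theorem liftW_pureW {N : Type*} [AddCommGroup N] [Module k N] (φ : C.W₀ →ₗ[k] N)
    (h : ∀ c a ω e, φ ((c * C.inA a) ⊗ₜ (ω ⊗ₜ e)) = φ (c ⊗ₜ (ω ⊗ₜ (C.inA a * e))))
    (c : C.E) (ω : ExteriorAlgebra k g) (e : C.E) :
    C.liftW φ h (C.pureW c ω e) = φ (c ⊗ₜ (ω ⊗ₜ e)) := rfl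

/-- Auxiliary: left multiplication by `b` on `W`. -/
def lactW (b : C.E) : C.W →ₗ[k] C.W :=
  C.liftW (C.mkW ∘ₗ LinearMap.rTensor _ (LinearMap.mulLeft k b)) (fun c a ω e => by
    simp only [LinearMap.comp_apply, LinearMap.rTensor_tmul, LinearMap.mulLeft_apply, mkW_tmul,
      ← mul_assoc, pureW_bal])

theorem lactW_pureW (b c : C.E) (ω : ExteriorAlgebra k g) (e : C.E) :
    C.lactW b (C.pureW c ω e) = C.pureW (b * c) ω e := rfl

/-- Auxiliary: right multiplication by `b` on `W`. -/
def opE (b : C.E) : C.W →ₗ[k] C.W :=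
  C.liftW (C.mkW ∘ₗ LinearMap.lTensor _ (LinearMap.lTensor _ (LinearMap.mulRight k b)))
    (fun c a ω e => by
      simp only [LinearMap.comp_apply, LinearMap.lTensor_tmul, LinearMap.mulRight_apply, mkW_tmul,
        pureW_bal, mul_assoc])

theorem opE_pureW (b c : C.E) (ω : ExteriorAlgebra k g) (e : C.E) :
    C.opE b (C.pureW c ω e) = C.pureW c ω (e * b) := rfl

/-- Auxiliary: right multiplication by `e_x` on `W`. -/
def opWedge (x : g) : C.W →ₗ[k] C.W :=
  C.liftW (C.mkW ∘ₗ LinearMap.lTensor _ (LinearMap.rTensor _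
    (LinearMap.mulRight k (ExteriorAlgebra.ι k x)))) (fun c a ω e => by
      simp only [LinearMap.comp_apply, LinearMap.lTensor_tmul, LinearMap.rTensor_tmul, mkW_tmul,
        pureW_bal])

theorem opWedge_pureW (x : g) (c : C.E) (ω : ExteriorAlgebra k g) (e : C.E) :
    C.opWedge x (C.pureW c ω e) = C.pureW c (ω * ExteriorAlgebra.ι k x) e := rfl

/-- Auxiliary: right multiplication by `y_x` on `W`. -/
def opY (x : g) : C.W →ₗ[k] C.W :=
  C.liftW (C.mkW ∘ₗ (LinearMap.rTensor _ (LinearMap.mulRight k (C.inG x)) +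
      LinearMap.lTensor _ (LinearMap.rTensor _ (wedgeD k x)) +
      LinearMap.lTensor _ (LinearMap.lTensor _
        (LinearMap.mulRight k (C.inG x) - LinearMap.mulLeft k (C.inG x)))))
    (fun c a ω e => by
      simp only [LinearMap.comp_apply, LinearMap.add_apply, LinearMap.lTensor_tmul,
        LinearMap.rTensor_tmul, map_add, mkW_tmul, LinearMap.mulRight_apply, LinearMap.sub_apply,
        LinearMap.mulLeft_apply, map_sub, pureW_bal]
      have h1 : c * C.inA a * C.inG x = c * C.inG x * C.inA a -
          c * C.inA (C.act (U.of k g x) a) := by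
        have := C.inG_mul_inA x a
        rw [mul_assoc c, mul_assoc c, this]
        noncomm_ring
      have h2 : C.inG x * (C.inA a * e) = C.inA (C.act (U.of k g x) a) * e +
          C.inA a * (C.inG x * e) := by
        rw [← mul_assoc, C.inG_mul_inA x a]
        noncomm_ring
      rw [h1, h2]
      simp only [map_sub, LinearMap.sub_apply, map_add, pureW_bal, mul_assoc (C.inA a) e]
      abel)

theorem opY_pureW (x : g) (c : C.E) (ω : ExteriorAlgebra k g) (e : C.E) :
    C.opY x (C.pureW c ω e) = C.pureW (c * C.inG x) ω e + C.pureW c (wedgeD k x ω) e +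
      (C.pureW c ω (e * C.inG x) - C.pureW c ω (C.inG x * e)) := by
  simp only [opY, liftW_pureW, LinearMap.comp_apply, LinearMap.add_apply, LinearMap.lTensor_tmul,
    LinearMap.rTensor_tmul, map_add, mkW_tmul, LinearMap.mulRight_apply, LinearMap.sub_apply,
    LinearMap.mulLeft_apply, map_sub]

/-- Auxiliary: the right action of the generators of `Y` on `W`. -/
def opGen : YGen A g → C.W →ₗ[k] C.W
  | .a a => C.opE (C.inA a)
  | .y x => C.opY x
  | .z x => C.opE (C.inG x)
  | .e x => C.opWedge x

/-- Auxiliary: the right action of the generators of `Y` on `W`. -/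
def opGen' (p : YGen A g) : (Module.End k C.W)ᵐᵒᵖ := MulOpposite.op (C.opGen p)

theorem inG_swap (x y : g) :
    C.inG x * C.inG y = C.inG y * C.inG x + C.inG ⁅x, y⁆ + C.inA (C.fhat x y) := by
  rw [add_assoc, ← C.inG_commutator, add_sub_cancel]

theorem opGen_rel ⦃p q : FreeAlgebra k (YGen A g)⦄ (h : C.YRel p q) :
    FreeAlgebra.lift k C.opGen' p = FreeAlgebra.lift k C.opGen' q := by
  apply MulOpposite.unop_injective
  apply W_hom_ext
  intro c ω e
  cases h <;>
    simp only [map_mul, map_add, map_smul, map_one, map_zero, FreeAlgebra.lift_ι_apply, opGen',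
      opGen, MulOpposite.unop_mul, MulOpposite.unop_add, MulOpposite.unop_smul,
      MulOpposite.unop_one, MulOpposite.unop_zero, MulOpposite.unop_op, Module.End.mul_apply,
      Module.End.one_apply, LinearMap.add_apply, LinearMap.smul_apply, LinearMap.zero_apply,
      opE_pureW, opWedge_pureW, opY_pureW, inA_mul, inA_one, mul_one, mul_add, add_mul,
      mul_assoc, wedgeD_lin, smul_mul_assoc, mul_smul_comm, ExteriorAlgebra.ι_sq_zero, mul_zero,
      wedgeD_mul, wedgeD_ι, map_sub, smul_sub, smul_add]
  case y_lin => abel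
  case y_a x a =>
    rw [← mul_assoc (C.inG x), C.inG_mul_inA]
    simp only [mul_add, map_add, mul_assoc]
    abel
  case z_a x a =>
    rw [C.inG_mul_inA]
    simp only [mul_add, map_add]
  case e_y x' x => abel
  case y_y x' x =>
    have h := C.inG_swap x' x
    have h' : C.inG x' * (C.inG x * e) = C.inG x * (C.inG x' * e) + C.inG ⁅x', x⁆ * e +
        C.inA (C.fhat x' x) * e := by
      rw [← mul_assoc, h, add_mul, add_mul, mul_assoc]
    rw [h, h', wedgeD_lie]
    simp only [mul_add, map_add, LinearMap.add_apply, pureW_bal]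
    abel
  case z_y x' x =>
    rw [C.inG_swap x' x]
    simp only [mul_add, map_add]
    abel
  case z_z x' x =>
    rw [C.inG_swap x' x]
    simp only [mul_add, map_add]

/-- Auxiliary: the right action of `Y` on `W`. -/
def rho : C.Y →ₐ[k] (Module.End k C.W)ᵐᵒᵖ := C.liftY C.opGen' C.opGen_rel

theorem rho_yGen (p : YGen A g) : C.rho (C.yGen p) = C.opGen' p := C.liftY_yGen _ _ p

/-- Auxiliary: the action of an element of `Y` on `1 ⊗ 1 ⊗ 1`. -/
def orbW : C.Y →ₗ[k] C.W :=
  LinearMap.applyₗ (C.pureW 1 1 1) ∘ₗ (MulOpposite.opLinearEquiv k).symm.toLinearMap ∘ₗ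
    C.rho.toLinearMap

theorem orbW_one : C.orbW 1 = C.pureW 1 1 1 := by
  simp [orbW]

theorem orbW_mul (u : C.Y) (p : YGen A g) : C.orbW (u * C.yGen p) = C.opGen p (C.orbW u) := by
  simp [orbW, rho_yGen, opGen']

theorem opGen_lactW (p : YGen A g) (b : C.E) (m : C.W) :
    C.opGen p (C.lactW b m) = C.lactW b (C.opGen p m) := by
  have h : C.opGen p ∘ₗ C.lactW b = C.lactW b ∘ₗ C.opGen p := by
    apply W_hom_ext
    intro c ω e
    cases p <;>
      simp only [opGen, LinearMap.comp_apply, lactW_pureW, opE_pureW, opWedge_pureW, opY_pureW,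
        map_add, map_sub, mul_assoc]
  exact LinearMap.congr_fun h m

theorem orbW_left (v : C.Y) (b : C.E) (h : C.orbW v = C.lactW b (C.pureW 1 1 1)) (u : C.Y) :
    C.orbW (v * u) = C.lactW b (C.orbW u) := by
  refine Submodule.span_induction ?_ ?_ ?_ ?_ (C.Ydeg_span u)
  · rintro _ ⟨l, rfl⟩
    induction l using List.reverseRecOn with
    | nil => rw [List.map_nil, List.prod_nil, mul_one, orbW_one, h]
    | append_singleton l p ih =>
      rw [List.map_append, List.prod_append, List.map_singleton, List.prod_singleton, ← mul_assoc,
        orbW_mul, orbW_mul, ih, opGen_lactW]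
  · simp
  · intro u v _ _ hu hv; rw [mul_add, map_add, map_add, map_add, hu, hv]
  · intro c u _ hu; rw [mul_smul_comm, map_smul, map_smul, map_smul, hu]

theorem orbW_a (a : A) (u : C.Y) : C.orbW (C.Ya a * u) = C.lactW (C.inA a) (C.orbW u) := by
  apply orbW_left
  rw [← one_mul (C.Ya a), Ya, orbW_mul, orbW_one]
  simp only [opGen, opE_pureW, lactW_pureW]
  have h := C.pureW_bal 1 a 1 1
  rw [one_mul, mul_one] at h
  rw [one_mul, mul_one, h]

theorem orbW_y (x : g) (u : C.Y) : C.orbW (C.Yy x * u) = C.lactW (C.inG x) (C.orbW u) := by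
  apply orbW_left
  rw [← one_mul (C.Yy x), Yy, orbW_mul, orbW_one]
  simp [opGen, opY_pureW, lactW_pureW, wedgeD_one]

theorem orbW_e (xs : List g) : C.orbW (xs.map C.Ye).prod = C.pureW 1 (wedge xs) 1 := by
  induction xs using List.reverseRecOn with
  | nil => simp [orbW_one, wedge]
  | append_singleton l x ih =>
    rw [List.map_append, List.prod_append, List.map_singleton, List.prod_singleton, Ye, orbW_mul,
      ih]
    simp [opGen, opWedge_pureW, wedge]

theorem orbW_e_z (xs zs : List g) : C.orbW ((xs.map C.Ye).prod * (zs.map C.Yz).prod) =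
    C.pureW 1 (wedge xs) (zs.map C.inG).prod := by
  induction zs using List.reverseRecOn with
  | nil => simp [orbW_e]
  | append_singleton l x ih =>
    rw [List.map_append, List.prod_append, List.map_singleton, List.prod_singleton, Yz,
      ← mul_assoc, orbW_mul, ih]
    simp [opGen, opE_pureW]

/-- Auxiliary: the map from `W` to `X`. -/
def projW : C.W →ₗ[k] C.X K :=
  C.liftW (C.absorbW K) (fun c a ω e => by
    induction e using C.E_induction with
    | zero => simp
    | hash b h => rw [inA_mul_hash, absorbW_tmul, absorbW_tmul, inA_mul, mul_assoc]
    | add p q hp hq => simp only [mul_add, TensorProduct.tmul_add, map_add, hp, hq])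

theorem projW_hash (c : C.E) (ω : ExteriorAlgebra k g) (a : A) (h : U k g) :
    C.projW K (C.pureW c ω (C.hash a h)) = C.pureX K (c * C.inA a) ω [] (C.hash 1 h) :=
  C.absorbW_tmul K c ω a h

theorem projW_lact (b : C.E) (m : C.W) : C.projW K (C.lactW b m) = C.lact K b (C.projW K m) := by
  have h : C.projW K ∘ₗ C.lactW b = C.lact K b ∘ₗ C.projW K := by
    apply W_hom_ext
    intro c ω e
    simp only [LinearMap.comp_apply, lactW_pureW]
    induction e using C.E_induction with
    | zero => simp
    | hash a h => rw [projW_hash, projW_hash, lact_pureX, mul_assoc]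
    | add p q hp hq => simp only [map_add, hp, hq]
  exact LinearMap.congr_fun h m

/-- Auxiliary: the map `σ⁰` on `Y`. -/
def sigmaYAux : C.Y →ₗ[k] C.X K := C.projW K ∘ₗ C.orbW

theorem sigmaYAux_a (a : A) (u : C.Y) :
    C.sigmaYAux K (C.Ya a * u) = C.lact K (C.inA a) (C.sigmaYAux K u) := by
  simp only [sigmaYAux, LinearMap.comp_apply, orbW_a, projW_lact]

theorem sigmaYAux_y (x : g) (u : C.Y) :
    C.sigmaYAux K (C.Yy x * u) = C.lact K (C.inG x) (C.sigmaYAux K u) := by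
  simp only [sigmaYAux, LinearMap.comp_apply, orbW_y, projW_lact]

theorem sigmaYAux_e_z (xs zs : List g) {n : ℕ} (a : Fin n → A) (w : Fin n → U k g)
    (h : (zs.map C.inG).prod = ∑ j, C.hash (a j) (w j)) :
    C.sigmaYAux K ((xs.map C.Ye).prod * (zs.map C.Yz).prod) =
      ∑ j, C.gen K (C.inA (a j)) xs [] (C.hash 1 (w j)) := by
  simp only [sigmaYAux, LinearMap.comp_apply, orbW_e_z, h, map_sum, projW_hash, one_mul, gen]

end SigmaY

end CrossedProduct
end DiffOp

namespace DiffOp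

universe u v w

namespace CrossedProduct

variable {k : Type u} [Field k] {A : Type v} [Ring A] [Algebra k A]
  {g : Type w} [LieRing g] [LieAlgebra k g] (C : CrossedProduct k A g) (K : Subalgebra k A)

/-- The element `μ(1 ⊗ x₁ ∧ ⋯ ∧ xₛ ⊗ 1) = e_{x₁} ⋯ e_{xₛ}` of `Y_s`. -/
def mu (xs : List g) : C.Y := (xs.map C.Ye).prod

/-- The maps from which the differentials are built, with their defining properties: `∂` on `Y`,
the horizontal differential `d⁰` of `X`, and the homotopy `σ⁰`, from `X` to `X` (`sigmaX`) and
from `Y` to `X` (`sigmaY`). They are constructed in `basicMaps`. -/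
structure BasicMaps where
  /-- the derivation `∂` -/
  del : C.Y →ₗ[k] C.Y
  del_mem : ∀ (s : ℕ) (u : C.Y), u ∈ C.Ydeg (s + 1) → del u ∈ C.Ydeg s
  del_zero : ∀ u ∈ C.Ydeg 0, del u = 0
  del_mul : ∀ (s : ℕ) (u : C.Y), u ∈ C.Ydeg s → ∀ v : C.Y,
    del (u * v) = del u * v + (-1) ^ s * (u * del v)
  del_e : ∀ x : g, del (C.Ye x) = C.Yz x - C.Yy x
  /-- the horizontal differential `d⁰`, set to zero on the `X_{0s}` -/
  d0 : C.X K →ₗ[k] C.X K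
  d0_bimod : C.IsBimoduleMap K d0
  d0_nil : ∀ xs : List g, d0 (C.gen K 1 xs [] 1) = 0
  d0_gen : ∀ (xs : List g) (as : List A) (h : as ≠ []), d0 (C.gen K 1 xs as 1) =
    ((-1 : k) ^ xs.length) • C.gen K (C.inA (as.head h)) xs as.tail 1 +
    ∑ i : Fin (as.length - 1), ((-1 : k) ^ ((i : ℕ) + 1 + xs.length)) •
      C.gen K 1 xs (merge as i) 1 +
    ((-1 : k) ^ (as.length + xs.length)) •
      C.gen K 1 xs as.dropLast (C.inA (as.getLast h))
  /-- the homotopy `σ⁰ : X_{rs} → X_{r+1,s}` -/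
  sigmaX : C.X K →ₗ[k] C.X K
  sigmaX_left : C.IsLeftLinear K sigmaX
  sigmaX_gen : ∀ (xs : List g) (as : List A) (a : A) (w : U k g),
    sigmaX (C.gen K 1 xs as (C.hash a w)) =
      ((-1 : k) ^ (as.length + xs.length + 1)) • C.gen K 1 xs (as ++ [a]) (C.hash 1 w)
  /-- the homotopy `σ⁰ : Y_s → X_{0s}`. It is a map of left `E`-modules, where `a` and `1 # x` in
  `E` act on `Y` by left multiplication by `a` and `y_x`. -/
  sigmaY : C.Y →ₗ[k] C.X K
  sigmaY_a : ∀ (a : A) (u : C.Y), sigmaY (C.Ya a * u) = C.lact K (C.inA a) (sigmaY u)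
  sigmaY_y : ∀ (x : g) (u : C.Y), sigmaY (C.Yy x * u) = C.lact K (C.inG x) (sigmaY u)
  sigmaY_e_z : ∀ (xs zs : List g) (n : ℕ) (a : Fin n → A) (w : Fin n → U k g),
    (zs.map C.inG).prod = ∑ j, C.hash (a j) (w j) →
    sigmaY ((xs.map C.Ye).prod * (zs.map C.Yz).prod) =
      ∑ j, C.gen K (C.inA (a j)) xs [] (C.hash 1 (w j))

/-- The maps `∂`, `d⁰` and `σ⁰`. -/
def basicMaps : C.BasicMaps K where
  del := C.delAux
  del_mem _ _ h := C.delAux_mem h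
  del_zero _ h := C.delAux_zero h
  del_mul _ _ h v := C.delAux_mul h v
  del_e := C.delAux_e
  d0 := C.d0Aux K
  d0_bimod := C.d0Aux_bimod K
  d0_nil xs := C.d0Aux_nil K xs 1 1
  d0_gen := C.d0Aux_gen K
  sigmaX := C.sigmaXAux K
  sigmaX_left := C.sigmaXAux_left K
  sigmaX_gen := C.sigmaXAux_gen K 1
  sigmaY := C.sigmaYAux K
  sigmaY_a := C.sigmaYAux_a K
  sigmaY_y := C.sigmaYAux_y K
  sigmaY_e_z xs zs _ a w h := C.sigmaYAux_e_z K xs zs a w h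

/-- The recursive definition of the maps `dˡ`. Here `d l` is the direct sum over `r` and `s` of the
maps `dˡ_{rs} : X_{rs} → X_{r+l-1,s-l}`, which is set to be zero on `X_{rs}` when `l > s`. -/
structure IsDifferential (d : ℕ → C.X K →ₗ[k] C.X K) : Prop where
  bimod : ∀ l, C.IsBimoduleMap K (d l)
  zero : d 0 = (C.basicMaps K).d0
  out_of_range : ∀ (l : ℕ) (xs : List g) (as : List A), xs.length < l →
    d l (C.gen K 1 xs as 1) = 0
  one_nil : ∀ xs : List g, 1 ≤ xs.length →
    d 1 (C.gen K 1 xs [] 1) = -(C.basicMaps K).sigmaY ((C.basicMaps K).del (C.mu xs))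
  one_pos : ∀ (xs : List g) (as : List A), 1 ≤ xs.length → as ≠ [] →
    d 1 (C.gen K 1 xs as 1) = -(C.basicMaps K).sigmaX (d 1 (d 0 (C.gen K 1 xs as 1)))
  rec_nil : ∀ (l : ℕ) (xs : List g), 1 < l → l ≤ xs.length →
    d l (C.gen K 1 xs [] 1) =
      -∑ j ∈ Finset.Ico 1 l, (C.basicMaps K).sigmaX (d (l - j) (d j (C.gen K 1 xs [] 1)))
  rec_pos : ∀ (l : ℕ) (xs : List g) (as : List A), 1 < l → l ≤ xs.length → as ≠ [] →
    d l (C.gen K 1 xs as 1) =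
      -∑ j ∈ Finset.range l, (C.basicMaps K).sigmaX (d (l - j) (d j (C.gen K 1 xs as 1)))

end CrossedProduct
end DiffOp

end

/-!
The recursion determines a family of bimodule maps: by induction on `l`, and for fixed `l` on the
number `r` of tensor factors, the right hand sides involve only values that are known, since `d⁰`
lowers `r` and a bimodule map is determined by its values on the elements
`1 ⊗ x₁ ∧ ⋯ ∧ xₛ ⊗ a₁ ⊗ ⋯ ⊗ aᵣ ⊗ 1` (`IsDifferential.unique`). It remains to show that the maps
given by the explicit formulas satisfy the recursion (`diff_isDifferential`).

These maps are defined without generators. The signed sums over `i` and over `i < j` are the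
contractions `contr : ⋀ g → g ⊗ ⋀ g` and `biContr β : ⋀ g → M ⊗ ⋀ g`, the second one along an
alternating map `β : g × g → M`. The map `d¹` is the contraction with the operators
`adX x : c ⊗ ω ⊗ t ⊗ e ↦ cx ⊗ ω ⊗ t ⊗ e - c ⊗ ω ⊗ tˣ ⊗ e - c ⊗ ω ⊗ t ⊗ xe`, plus the
Chevalley–Eilenberg differential of `⋀ g`. The map `d²` is, up to sign, the double contraction along
`f̂` with the operators that insert an element of `A` among the tensor factors. Such an insertion is
well defined on `X`, because the commutators of `f̂(x, y)` with the elements of `K` are in `K`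
(`fhat_mem`) and hence vanish in `A / K`.

The recursion holds since the homotopy `σ⁰` kills the elements with last factor in `1 # U(g)`: it
inserts `1`, which vanishes in `A / K` (`sigmaXAux_hashEnd`).
* For `r > 0`, only the last term of `d⁰` contributes to `σ⁰ dˡ d⁰` (`d0Aux_concat`): it moves the
  last tensor factor to the end, `dˡ` is applied, and `σ⁰` moves that factor back. Since `d¹`
  commutes with this shift, the recursion for `d¹` follows (`sigmaXAux_dOne`).
* In `d¹ d¹`, the only terms that `σ⁰` does not kill come from the products of two factors `1 # xᵢ`,
  `1 # xⱼ` at the right end, which contain `f(xᵢ, xⱼ) # 1`. Antisymmetrized, they insert `f̂(xᵢ, xⱼ)`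
  in the last place (`sigmaXAux_dOne_dOne`). The insertions in the other places are those of
  `σ⁰ d² d⁰`, and together they make up `d²` (`insFhat_concat`).
* For `l ≥ 3`, all terms are killed (`sigmaXAux_diff_diff`).
* In the column `r = 0`, the boundary `∂(e_{x₁} ⋯ e_{xₛ})`, with all `y` moved to the left, is a
  contraction minus the Chevalley–Eilenberg differential (`delAux_extY`), which yields `d¹`.
-/

noncomputable section

namespace DiffOp

namespace CrossedProduct

/-! ### Contractions of the exterior algebra -/

section Exterior

variable {k : Type*} [Field k] {g : Type*} [LieRing g] [LieAlgebra k g]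
  {M : Type*} [AddCommGroup M] [Module k M]

local notation "Λ" => ExteriorAlgebra k g
local notation "ιΛ" => ExteriorAlgebra.ι k

variable (k) in
/-- Left exterior multiplication by `x` on the second factor of `M ⊗ ⋀ g`, linear in `x`. -/
def wedgeL (M : Type*) [AddCommGroup M] [Module k M] : g →ₗ[k] Module.End k (M ⊗[k] Λ) :=
  LinearMap.lTensorHom M ∘ₗ LinearMap.mul k Λ ∘ₗ ιΛ

@[simp] theorem wedgeL_tmul (x : g) (m : M) (ω : Λ) :
    wedgeL k M x (m ⊗ₜ ω) = m ⊗ₜ (ιΛ x * ω) := rfl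

@[simp] theorem wedgeL_wedgeL (x : g) (w : M ⊗[k] Λ) : wedgeL k M x (wedgeL k M x w) = 0 := by
  induction w using TensorProduct.induction_on with
  | zero => simp
  | tmul m ω => simp [← mul_assoc]
  | add p q hp hq => simp [hp, hq]

theorem rTensor_wedgeL {N : Type*} [AddCommGroup N] [Module k N] (φ : M →ₗ[k] N) (x : g)
    (w : M ⊗[k] Λ) :
    LinearMap.rTensor Λ φ (wedgeL k M x w) = wedgeL k N x (LinearMap.rTensor Λ φ w) := by
  induction w using TensorProduct.induction_on with
  | zero => simp
  | tmul m ω => simp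
  | add p q hp hq => simp [hp, hq]

/-- The comultiplication `⋀ˢ g → g ⊗ ⋀ˢ⁻¹ g`, that is
`x₁ ∧ ⋯ ∧ xₛ ↦ ∑ᵢ (-1)ⁱ⁺¹ xᵢ ⊗ x₁ ∧ ⋯ x̂ᵢ ⋯ ∧ xₛ`; see `contr_wedge`. -/
def contr : Λ →ₗ[k] g ⊗[k] Λ :=
  CliffordAlgebra.foldr' _
    (LinearMap.mk₂ k (fun (x : g) (p : Λ × (g ⊗[k] Λ)) => x ⊗ₜ[k] p.1 - wedgeL k g x p.2)
      (fun x y p => by simp only [TensorProduct.add_tmul, map_add, LinearMap.add_apply]; abel)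
      (fun c x p => by
        simp only [← TensorProduct.smul_tmul', map_smul, LinearMap.smul_apply, smul_sub])
      (fun x p q => by simp only [Prod.fst_add, Prod.snd_add, TensorProduct.tmul_add, map_add]; abel)
      (fun c x p => by
        simp only [Prod.smul_fst, Prod.smul_snd, TensorProduct.tmul_smul, map_smul, smul_sub]))
    (fun x ω w => by
      simp only [LinearMap.mk₂_apply, map_sub, wedgeL_tmul, wedgeL_wedgeL]
      simp [ExteriorAlgebra.ι])
    0

theorem contr_algebraMap (r : k) : contr (g := g) (algebraMap k Λ r) = 0 :=
  (CliffordAlgebra.foldr'_algebraMap _ _ _ _ _).trans (smul_zero r)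

theorem contr_one : contr (1 : Λ) = 0 := by
  simpa using contr_algebraMap (g := g) (1 : k)

theorem contr_mul (x : g) (ω : Λ) : contr (ιΛ x * ω) = x ⊗ₜ ω - wedgeL k g x (contr ω) :=
  CliffordAlgebra.foldr'_ι_mul _ _ _ _ _ _

/-- The double contraction `⋀ˢ g → M ⊗ ⋀ˢ⁻² g` along an alternating map `β : g × g → M`, that is
`x₁ ∧ ⋯ ∧ xₛ ↦ ∑_{i<j} (-1)ⁱ⁺ʲ β(xᵢ, xⱼ) ⊗ x₁ ∧ ⋯ x̂ᵢ ⋯ x̂ⱼ ⋯ ∧ xₛ`; see `biContr_wedge`. -/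
def biContr (β : g →ₗ[k] g →ₗ[k] M) (hβ : ∀ x, β x x = 0) : Λ →ₗ[k] M ⊗[k] Λ :=
  CliffordAlgebra.foldr' _
    (LinearMap.mk₂ k (fun (x : g) (p : Λ × (M ⊗[k] Λ)) =>
        -LinearMap.rTensor Λ (β x) (contr p.1) + wedgeL k M x p.2)
      (fun x y p => by
        simp only [map_add, LinearMap.rTensor_add, LinearMap.add_apply]; abel)
      (fun c x p => by
        simp only [map_smul, LinearMap.rTensor_smul, LinearMap.smul_apply, smul_add, smul_neg])
      (fun x p q => by simp only [Prod.fst_add, Prod.snd_add, map_add]; abel)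
      (fun c x p => by
        simp only [Prod.smul_fst, Prod.smul_snd, map_smul, smul_add, smul_neg]))
    (fun x ω w => by
      simp only [LinearMap.mk₂_apply, map_add, map_neg, map_sub, contr_mul, rTensor_wedgeL,
        wedgeL_wedgeL, LinearMap.rTensor_tmul, hβ]
      simp)
    0

theorem biContr_algebraMap (β : g →ₗ[k] g →ₗ[k] M) (hβ : ∀ x, β x x = 0) (r : k) :
    biContr β hβ (algebraMap k Λ r) = 0 :=
  (CliffordAlgebra.foldr'_algebraMap _ _ _ _ _).trans (smul_zero r)

theorem biContr_one (β : g →ₗ[k] g →ₗ[k] M) (hβ : ∀ x, β x x = 0) :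
    biContr β hβ (1 : Λ) = 0 := by
  simpa using biContr_algebraMap β hβ (1 : k)

theorem biContr_mul (β : g →ₗ[k] g →ₗ[k] M) (hβ : ∀ x, β x x = 0) (x : g) (ω : Λ) :
    biContr β hβ (ιΛ x * ω) =
      -LinearMap.rTensor Λ (β x) (contr ω) + wedgeL k M x (biContr β hβ ω) :=
  CliffordAlgebra.foldr'_ι_mul _ _ _ _ _ _

theorem exterior_induction {P : Λ → Prop} (scalar : ∀ r : k, P (algebraMap k Λ r))
    (add : ∀ x y, P x → P y → P (x + y)) (ι_mul : ∀ x ω, P ω → P (ιΛ x * ω)) (ω : Λ) : P ω :=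
  CliffordAlgebra.left_induction (Q := 0) scalar add (fun ω x => ι_mul x ω) ω

/-! ### The parity of the exterior degree -/

theorem invExt_ι_mul (x : g) (ω : Λ) : invExt (ιΛ x * ω) = -(ιΛ x * invExt ω) := by
  simp [invExt]

theorem invExt_algebraMap (r : k) :
    invExt (g := g) (algebraMap k Λ r) = algebraMap k Λ r := by
  simp [invExt]

theorem invExt_invExt (ω : Λ) : invExt (invExt ω) = ω := by
  induction ω using exterior_induction with
  | scalar r => simp [invExt_algebraMap]
  | add p q hp hq => simp [hp, hq]
  | ι_mul x ω h => simp [invExt_ι_mul, h]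

theorem lTensor_invExt_wedgeL (x : g) (w : M ⊗[k] Λ) :
    LinearMap.lTensor M invExt (wedgeL k M x w) =
      -wedgeL k M x (LinearMap.lTensor M invExt w) := by
  induction w using TensorProduct.induction_on with
  | zero => simp
  | tmul m ω => simp [invExt_ι_mul, TensorProduct.tmul_neg]
  | add p q hp hq => simp only [map_add, hp, hq, neg_add]

theorem contr_invExt (ω : Λ) :
    contr (invExt ω) = -LinearMap.lTensor g invExt (contr ω) := by
  induction ω using exterior_induction with
  | scalar r => simp [invExt_algebraMap, contr_algebraMap]
  | add p q hp hq => simp only [map_add, hp, hq, neg_add]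
  | ι_mul x ω h =>
    rw [invExt_ι_mul, map_neg, contr_mul, h, contr_mul, map_sub, lTensor_invExt_wedgeL,
      map_neg, LinearMap.lTensor_tmul]

theorem biContr_invExt (β : g →ₗ[k] g →ₗ[k] M) (hβ : ∀ x, β x x = 0) (ω : Λ) :
    biContr β hβ (invExt ω) = LinearMap.lTensor M invExt (biContr β hβ ω) := by
  induction ω using exterior_induction with
  | scalar r => simp [invExt_algebraMap, biContr_algebraMap]
  | add p q hp hq => simp only [map_add, hp, hq]
  | ι_mul x ω h =>
    have hc : LinearMap.rTensor Λ (β x) (LinearMap.lTensor g invExt (contr ω)) =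
        LinearMap.lTensor M invExt (LinearMap.rTensor Λ (β x) (contr ω)) := by
      rw [← LinearMap.comp_apply, LinearMap.rTensor_comp_lTensor, ← LinearMap.lTensor_comp_rTensor,
        LinearMap.comp_apply]
    rw [invExt_ι_mul, map_neg, biContr_mul, biContr_mul, h, contr_invExt, map_add,
      lTensor_invExt_wedgeL, map_neg, map_neg, hc]
    abel

/-- The map `x ⊗ ω ↦ ∑ γ(x', x) ⊗ ω'`, where `∑ x' ⊗ ω'` is the contraction of `ω`. -/
def contrWith (γ : g →ₗ[k] g →ₗ[k] M) : g ⊗[k] Λ →ₗ[k] M ⊗[k] Λ :=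
  TensorProduct.lift ((LinearMap.rTensorHom Λ ∘ₗ γ.flip).compl₂ contr)

theorem contrWith_tmul (γ : g →ₗ[k] g →ₗ[k] M) (x : g) (ω : Λ) :
    contrWith γ (x ⊗ₜ ω) = LinearMap.rTensor Λ (γ.flip x) (contr ω) := rfl

/-- Contracting twice and applying a bilinear map `γ` to the removed vectors amounts to the
double contraction along the antisymmetrization of `γ`. -/
theorem contrWith_contr (γ β : g →ₗ[k] g →ₗ[k] M) (hβ : ∀ x, β x x = 0)
    (h : ∀ x y, β x y = γ x y - γ y x) (ω : Λ) :
    contrWith γ (contr ω) = biContr β hβ ω := by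
  have hl : ∀ (x : g) (w : g ⊗[k] Λ), contrWith γ (wedgeL k g x w) =
      LinearMap.rTensor Λ (γ x) w - wedgeL k M x (contrWith γ w) := by
    intro x w
    induction w using TensorProduct.induction_on with
    | zero => simp
    | tmul y ω => simp [contrWith_tmul, contr_mul, rTensor_wedgeL]
    | add p q hp hq => simp only [map_add, hp, hq]; abel
  induction ω using exterior_induction with
  | scalar r => simp [biContr_algebraMap, contr_algebraMap]
  | add p q hp hq => simp only [map_add, hp, hq]
  | ι_mul x ω ih =>
    have hx : β x = γ x - γ.flip x := LinearMap.ext (h x)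
    rw [contr_mul, map_sub, hl, ih, biContr_mul, contrWith_tmul, hx, LinearMap.rTensor_sub,
      LinearMap.sub_apply]
    abel

theorem rTensor_biContr {N : Type*} [AddCommGroup N] [Module k N] (φ : M →ₗ[k] N)
    (β : g →ₗ[k] g →ₗ[k] M) (hβ : ∀ x, β x x = 0) (β' : g →ₗ[k] g →ₗ[k] N)
    (hβ' : ∀ x, β' x x = 0) (h : ∀ x y, φ (β x y) = β' x y) (ω : Λ) :
    LinearMap.rTensor Λ φ (biContr β hβ ω) = biContr β' hβ' ω := by
  induction ω using exterior_induction with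
  | scalar r => simp [biContr_algebraMap]
  | add p q hp hq => simp only [map_add, hp, hq]
  | ι_mul x ω ih =>
    have hx : φ ∘ₗ β x = β' x := LinearMap.ext (h x)
    rw [biContr_mul, biContr_mul, map_add, map_neg, rTensor_wedgeL, ih, ← hx,
      LinearMap.rTensor_comp_apply]

theorem wedge_cons (x : g) (xs : List g) : wedge (k := k) (x :: xs) = ιΛ x * wedge xs := by
  simp [wedge]

theorem wedge_nil : wedge (k := k) ([] : List g) = 1 := rfl

theorem mem_span_wedge (ω : Λ) : ω ∈ Submodule.span k (Set.range (wedge (k := k) (g := g))) := by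
  induction ω using exterior_induction with
  | scalar r =>
    rw [Algebra.algebraMap_eq_smul_one]
    exact Submodule.smul_mem _ _ (Submodule.subset_span ⟨[], rfl⟩)
  | add p q hp hq => exact Submodule.add_mem _ hp hq
  | ι_mul x ω h =>
    induction h using Submodule.span_induction with
    | mem ω h =>
      obtain ⟨xs, rfl⟩ := h
      exact Submodule.subset_span ⟨x :: xs, wedge_cons x xs⟩
    | zero => simp
    | add p q _ _ hp hq => rw [mul_add]; exact Submodule.add_mem _ hp hq
    | smul c p _ hp => rw [mul_smul_comm]; exact Submodule.smul_mem _ _ hp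

theorem contr_wedge (xs : List g) : contr (wedge (k := k) xs) =
    ∑ i : Fin xs.length, ((-1 : k) ^ (i : ℕ)) • (xs.get i ⊗ₜ[k] wedge (xs.eraseIdx i)) := by
  induction xs with
  | nil => simp [wedge_nil, contr_one]
  | cons x xs ih =>
    rw [wedge_cons, contr_mul, ih]
    refine Eq.trans ?_ (Fin.sum_univ_succ (n := xs.length) _).symm
    simp [pow_succ, wedge_cons, Finset.sum_neg_distrib, sub_eq_add_neg]

theorem biContr_singleton (β : g →ₗ[k] g →ₗ[k] M) (hβ : ∀ x, β x x = 0) (x : g) :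
    biContr β hβ (wedge [x]) = 0 := by
  rw [wedge_cons, wedge_nil, biContr_mul, biContr_one, contr_one]
  simp

theorem sum_Iio_succ {N : Type*} [AddCommMonoid N] {n : ℕ} (j : Fin n) (F : Fin (n + 1) → N) :
    ∑ i ∈ Finset.Iio j.succ, F i = F 0 + ∑ i ∈ Finset.Iio j, F i.succ := by
  have h : Finset.Iio j.succ = insert 0 ((Finset.Iio j).map (Fin.succEmb n)) := by
    ext i
    cases i using Fin.cases <;> simp
  rw [h, Finset.sum_insert (by simp), Finset.sum_map]
  rfl

theorem biContr_wedge (β : g →ₗ[k] g →ₗ[k] M) (hβ : ∀ x, β x x = 0) (xs : List g) :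
    biContr β hβ (wedge xs) = ∑ j : Fin xs.length, ∑ i ∈ Finset.Iio j,
      ((-1 : k) ^ ((i : ℕ) + (j : ℕ))) •
        (β (xs.get i) (xs.get j) ⊗ₜ[k] wedge ((xs.eraseIdx j).eraseIdx i)) := by
  induction xs with
  | nil => simp [wedge_nil, biContr_one]
  | cons x xs ih =>
    have h0 : ∀ n : ℕ, Finset.Iio (0 : Fin (n + 1)) = ∅ := fun n => by ext i; simp
    rw [wedge_cons, biContr_mul, ih, contr_wedge]
    refine Eq.trans ?_ (Fin.sum_univ_succ (n := xs.length) _).symm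
    rw [h0, Finset.sum_empty, zero_add]
    refine Eq.trans ?_ (Finset.sum_congr rfl fun j _ => (sum_Iio_succ j _).symm)
    rw [Finset.sum_add_distrib]
    simp [pow_succ, pow_add, wedge_cons]

end Exterior

/-! ### The Chevalley–Eilenberg differential -/

section ChevalleyEilenberg

variable {k : Type*} [Field k] {g : Type*} [LieRing g] [LieAlgebra k g]

local notation "Λ" => ExteriorAlgebra k g
local notation "ιΛ" => ExteriorAlgebra.ι k

variable (k g) in
/-- The bracket of `g` as a bilinear map. -/
def bracket : g →ₗ[k] g →ₗ[k] g :=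
  LinearMap.mk₂ k (fun x y => ⁅x, y⁆) add_lie smul_lie lie_add (fun c x y => lie_smul c x y)

@[simp] theorem bracket_apply (x y : g) : bracket k g x y = ⁅x, y⁆ := rfl

theorem bracket_self (x : g) : bracket k g x x = 0 := lie_self x

/-- Exterior multiplication `g ⊗ ⋀ g → ⋀ g`. -/
def wedgeMul : g ⊗[k] Λ →ₗ[k] Λ := LinearMap.mul' k Λ ∘ₗ LinearMap.rTensor Λ ιΛ

@[simp] theorem wedgeMul_tmul (x : g) (ω : Λ) : wedgeMul (x ⊗ₜ[k] ω) = ιΛ x * ω := rfl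

theorem ι_mul_wedgeMul (x : g) (w : g ⊗[k] Λ) :
    wedgeMul (wedgeL k g x w) = -(ιΛ x * wedgeMul w) := by
  induction w using TensorProduct.induction_on with
  | zero => simp
  | tmul y ω =>
    have := ExteriorAlgebra.ι_add_mul_swap (R := k) x y
    rw [wedgeL_tmul, wedgeMul_tmul, wedgeMul_tmul, ← mul_assoc, ← mul_assoc, ← neg_mul,
      eq_neg_of_add_eq_zero_right this]
  | add p q hp hq => simp only [map_add, hp, hq, mul_add, neg_add]

/-- The Chevalley–Eilenberg differential `⋀ˢ g → ⋀ˢ⁻¹ g` with trivial coefficients. -/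
def ceDiff : Λ →ₗ[k] Λ := wedgeMul ∘ₗ biContr (bracket k g) bracket_self

theorem ceDiff_algebraMap (r : k) : ceDiff (g := g) (algebraMap k Λ r) = 0 := by
  simp [ceDiff, biContr_algebraMap]

theorem ceDiff_mul (x : g) (ω : Λ) : ceDiff (ιΛ x * ω) =
    -wedgeMul (LinearMap.rTensor Λ (bracket k g x) (contr ω)) - ιΛ x * ceDiff ω := by
  simp only [ceDiff, LinearMap.comp_apply, biContr_mul, map_add, map_neg, ι_mul_wedgeMul,
    sub_eq_add_neg]

theorem invExt_wedgeMul (w : g ⊗[k] Λ) :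
    invExt (wedgeMul w) = -wedgeMul (LinearMap.lTensor g invExt w) := by
  induction w using TensorProduct.induction_on with
  | zero => simp
  | tmul y ω => simp [invExt_ι_mul]
  | add p q hp hq => simp only [map_add, hp, hq, neg_add]

theorem ceDiff_invExt (ω : Λ) : ceDiff (invExt ω) = -invExt (ceDiff ω) := by
  simp [ceDiff, biContr_invExt, invExt_wedgeMul]

theorem ceDiff_wedge (xs : List g) : ceDiff (wedge (k := k) xs) =
    ∑ j : Fin xs.length, ∑ i ∈ Finset.Iio j, ((-1 : k) ^ ((i : ℕ) + (j : ℕ))) •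
      wedge (⁅xs.get i, xs.get j⁆ :: (xs.eraseIdx j).eraseIdx i) := by
  simp [ceDiff, biContr_wedge, wedge_cons, map_sum]

end ChevalleyEilenberg

/-! ### Derivations and insertions on the tensor algebra -/

section TensorRecursion

variable {k : Type*} [Field k] {A : Type*} [Ring A] [Algebra k A]

local notation "TA" => TensorAlgebra k A
local notation "ιT" => TensorAlgebra.ι k

theorem tens_cons (a : A) (as : List A) : tens (k := k) (a :: as) = ιT a * tens as := by
  simp [tens]

theorem tens_nil : tens (k := k) ([] : List A) = 1 := rfl

/-- To prove a linear statement about all tensors, it is enough to treat pure tensors. -/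
theorem tens_induction {P : TA → Prop} (zero : P 0) (add : ∀ s t, P s → P t → P (s + t))
    (smul : ∀ (c : k) t, P t → P (c • t)) (pure : ∀ as : List A, P (tens as)) (t : TA) : P t :=
  Submodule.span_induction (by rintro _ ⟨as, rfl⟩; exact pure as) zero
    (fun s t _ _ => add s t) (fun c t _ => smul c t) (tens_span (k := k) t)

/-- One step of the recursion `skewRec`. -/
def skewStep (ε : k) (φ : A →ₗ[k] TA) : A →ₗ[k] Module.End k (TA × TA) :=
  LinearMap.mk₂ k (fun (a : A) (p : TA × TA) => (ιT a * p.1, φ a * p.1 + ε • (ιT a * p.2)))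
    (fun a b p => by
      ext1
      · simp only [map_add, add_mul, Prod.fst_add]
      · simp only [map_add, add_mul, smul_add, Prod.snd_add]; abel)
    (fun c a p => by
      ext1
      · simp only [map_smul, smul_mul_assoc, Prod.smul_fst]
      · simp only [map_smul, smul_mul_assoc, smul_add, Prod.smul_snd, smul_comm c ε])
    (fun a p q => by
      ext1
      · simp only [mul_add, Prod.fst_add]
      · simp only [mul_add, smul_add, Prod.fst_add, Prod.snd_add]; abel)
    (fun c a p => by
      ext1
      · simp only [mul_smul_comm, Prod.smul_fst]
      · simp only [mul_smul_comm, smul_add, Prod.smul_fst, Prod.smul_snd, smul_comm c ε])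

/-- The linear endomorphism `J` of the tensor algebra with `J(1) = u` and
`J(a t) = φ(a) t + ε a J(t)` for `a` in `A`. For `u = 0` it is a derivation if `ε = 1`, and a
skew derivation if `ε = -1`. -/
def skewRec (ε : k) (φ : A →ₗ[k] TA) (u : TA) : TA →ₗ[k] TA :=
  LinearMap.snd k TA TA ∘ₗ LinearMap.applyₗ ((1, u) : TA × TA) ∘ₗ
    (TensorAlgebra.lift k (skewStep ε φ)).toLinearMap

variable (ε : k) (φ : A →ₗ[k] TensorAlgebra k A) (u₀ : TensorAlgebra k A)

theorem skewStep_apply (a : A) (p : TA × TA) :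
    skewStep ε φ a p = (ιT a * p.1, φ a * p.1 + ε • (ιT a * p.2)) := rfl

theorem skewRec_apply (t : TA) :
    skewRec ε φ u₀ t = (TensorAlgebra.lift k (skewStep ε φ) t (1, u₀)).2 := rfl

theorem skewRec_one : skewRec ε φ u₀ 1 = u₀ := by
  rw [skewRec_apply, map_one, Module.End.one_apply]

theorem skewRec_mul (a : A) (t : TA) :
    skewRec ε φ u₀ (ιT a * t) = φ a * t + ε • (ιT a * skewRec ε φ u₀ t) := by
  have key : ∀ t : TA, (TensorAlgebra.lift k (skewStep ε φ) t (1, u₀)).1 = t := by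
    intro t
    induction t using tens_induction with
    | zero => simp
    | add s t hs ht => simp [hs, ht]
    | smul c t ht => simp [ht]
    | pure as =>
      induction as with
      | nil => simp [tens_nil]
      | cons a as ih =>
        rw [tens_cons, map_mul, Module.End.mul_apply, TensorAlgebra.lift_ι_apply, skewStep_apply,
          ih]
  rw [skewRec_apply, map_mul, Module.End.mul_apply, TensorAlgebra.lift_ι_apply, skewStep_apply,
    key, ← skewRec_apply]

theorem skewRec_ι (a : A) : skewRec ε φ u₀ (ιT a) = φ a + ε • (ιT a * u₀) := by
  simpa [skewRec_one] using skewRec_mul ε φ u₀ a 1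

/-- The algebra endomorphism of the tensor algebra that multiplies by `ε ^ r` in degree `r`. -/
def degPow (ε : k) : TA →ₐ[k] TA := TensorAlgebra.lift k (ε • ιT)

theorem degPow_ι_mul (a : A) (t : TA) : degPow ε (ιT a * t) = ε • (ιT a * degPow ε t) := by
  simp [degPow]

theorem degPow_tens (as : List A) : degPow ε (tens as) = ε ^ as.length • tens as := by
  induction as with
  | nil => simp [tens_nil]
  | cons a as ih => rw [tens_cons, degPow_ι_mul, ih, List.length_cons, pow_succ', mul_smul_comm,
      smul_smul]

theorem degPow_one_apply (t : TA) : degPow (1 : k) t = t := by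
  induction t using tens_induction with
  | zero => simp
  | add s t hs ht => simp [hs, ht]
  | smul c t ht => simp [ht]
  | pure as => simp [degPow_tens]

theorem skewRec_mul_mul (s t : TA) :
    skewRec ε φ u₀ (s * t) = skewRec ε φ 0 s * t + degPow ε s * skewRec ε φ u₀ t := by
  induction s using tens_induction with
  | zero => simp
  | add s s' hs hs' => simp only [add_mul, map_add, hs, hs']; abel
  | smul c s hs => simp only [smul_mul_assoc, map_smul, hs, smul_add]
  | pure as =>
    induction as with
    | nil => simp [tens_nil, skewRec_one]
    | cons a as ih =>
      rw [tens_cons, mul_assoc, skewRec_mul, ih, skewRec_mul, degPow_ι_mul]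
      simp only [mul_add, add_mul, smul_add, mul_assoc, smul_mul_assoc]
      abel

theorem skewRec_lin (c : k) (ψ : A →ₗ[k] TA) (v t : TA) :
    skewRec ε (c • φ + ψ) (c • u₀ + v) t = c • skewRec ε φ u₀ t + skewRec ε ψ v t := by
  induction t using tens_induction with
  | zero => simp
  | add s t hs ht => simp only [map_add, hs, ht, smul_add]; abel
  | smul r t ht => simp only [map_smul, ht, smul_add, smul_comm c r]
  | pure as =>
    induction as with
    | nil => simp only [tens_nil, skewRec_one]
    | cons a as ih =>
      rw [tens_cons, skewRec_mul, ih, skewRec_mul, skewRec_mul]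
      simp only [LinearMap.add_apply, LinearMap.smul_apply, add_mul, smul_mul_assoc, mul_add,
        mul_smul_comm, smul_add, smul_comm c ε]
      abel

/-- The derivation of the tensor algebra that extends a linear endomorphism `δ` of `A`. -/
def derT (δ : A →ₗ[k] A) : TA →ₗ[k] TA := skewRec 1 (ιT ∘ₗ δ) 0

theorem derT_one (δ : A →ₗ[k] A) : derT δ (1 : TA) = 0 := skewRec_one _ _ _

theorem derT_ι (δ : A →ₗ[k] A) (a : A) : derT δ (ιT a) = ιT (δ a) := by
  simp [derT, skewRec_ι]

theorem derT_mul (δ : A →ₗ[k] A) (s t : TA) : derT δ (s * t) = derT δ s * t + s * derT δ t := by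
  rw [derT, skewRec_mul_mul, degPow_one_apply]

theorem derT_lin (c : k) (δ δ' : A →ₗ[k] A) (t : TA) :
    derT (c • δ + δ') t = c • derT δ t + derT δ' t := by
  have h := skewRec_lin 1 (ιT ∘ₗ δ) 0 c (ιT ∘ₗ δ') 0 t
  rwa [smul_zero, add_zero, ← LinearMap.comp_smul, ← LinearMap.comp_add] at h

theorem derT_tens (δ : A →ₗ[k] A) (as : List A) :
    derT δ (tens (k := k) as) = ∑ h : Fin as.length, tens (as.set h (δ (as.get h))) := by
  induction as with
  | nil => simp [tens_nil, derT_one]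
  | cons a as ih =>
    rw [tens_cons, derT_mul, derT_ι, ih]
    refine Eq.trans ?_ (Fin.sum_univ_succ (n := as.length) _).symm
    simp [tens_cons, Finset.mul_sum]

variable (k) in
/-- The signed sum of all the insertions of `a`, that is
`a₁ ⊗ ⋯ ⊗ aᵣ ↦ ∑ₕ (-1)ʰ a₁ ⊗ ⋯ ⊗ aₕ ⊗ a ⊗ aₕ₊₁ ⊗ ⋯ ⊗ aᵣ`. -/
def insT (a : A) : TA →ₗ[k] TA :=
  skewRec (-1) (LinearMap.mulLeft k (ιT a) ∘ₗ ιT) (ιT a)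

theorem insT_one (a : A) : insT k a 1 = ιT a := skewRec_one _ _ _

theorem insT_ι_mul (a b : A) (t : TA) :
    insT k a (ιT b * t) = ιT a * (ιT b * t) - ιT b * insT k a t := by
  rw [insT, skewRec_mul]
  simp [mul_assoc, sub_eq_add_neg]

variable (k) in
/-- The signed sum of the insertions of `a` in all places but the last one. -/
def preInsT (a : A) : TA →ₗ[k] TA :=
  skewRec (-1) (LinearMap.mulLeft k (ιT a) ∘ₗ ιT) 0

theorem insT_mul (a : A) (s t : TA) :
    insT k a (s * t) = preInsT k a s * t + degPow (-1) s * insT k a t := skewRec_mul_mul _ _ _ _ _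

theorem insT_eq (a : A) (s : TA) :
    insT k a s = preInsT k a s + degPow (-1) s * ιT a := by
  simpa [insT_one] using insT_mul a s 1

theorem insT_lin (c : k) (a b : A) (t : TA) :
    insT k (c • a + b) t = c • insT k a t + insT k b t := by
  have h := skewRec_lin (-1) (LinearMap.mulLeft k (ιT a) ∘ₗ ιT) (ιT a) c
    (LinearMap.mulLeft k (ιT b) ∘ₗ ιT) (ιT b) t
  have h' : LinearMap.mulLeft k (ιT (c • a + b)) ∘ₗ ιT =
      c • (LinearMap.mulLeft k (ιT a) ∘ₗ ιT) + LinearMap.mulLeft k (ιT b) ∘ₗ ιT := by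
    ext x
    simp [add_mul]
  rw [insT, h', map_add, map_smul, h]
  rfl

theorem insT_tens (a : A) (as : List A) : insT k a (tens as) =
    ∑ h ∈ Finset.range (as.length + 1), ((-1 : k) ^ h) • tens (as.insertIdx h a) := by
  induction as with
  | nil => simp [tens_nil, insT_one, tens_cons]
  | cons b as ih =>
    rw [tens_cons, insT_ι_mul, ih, List.length_cons, Finset.sum_range_succ' _ (as.length + 1)]
    simp [tens_cons, pow_succ, Finset.mul_sum, Finset.sum_neg_distrib, sub_eq_neg_add]

theorem invTens_eq_degPow (t : TA) : invTens t = degPow (-1) t := by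
  induction t using tens_induction with
  | zero => simp
  | add s t hs ht => simp [hs, ht]
  | smul c t ht => simp [ht]
  | pure as => rw [invTens_tens, degPow_tens]

theorem degPow_derT (δ : A →ₗ[k] A) (t : TA) : degPow ε (derT δ t) = derT δ (degPow ε t) := by
  induction t using tens_induction with
  | zero => simp
  | add s t hs ht => simp [hs, ht]
  | smul c t ht => simp [ht]
  | pure as => simp [derT_tens, degPow_tens, Finset.smul_sum]

theorem degPow_insT (a : A) (t : TA) :
    degPow (-1) (insT k a t) = -insT k a (degPow (-1) t) := by
  induction t using tens_induction with
  | zero => simp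
  | add s t hs ht => simp only [map_add, hs, ht, neg_add]
  | smul c t ht => simp [ht]
  | pure as =>
    rw [degPow_tens, map_smul, insT_tens, map_sum, Finset.smul_sum, ← Finset.sum_neg_distrib]
    refine Finset.sum_congr rfl fun h hh => ?_
    rw [map_smul, degPow_tens, List.length_insertIdx_of_le_length
      (Nat.lt_succ_iff.1 (Finset.mem_range.1 hh)), pow_succ, smul_comm]
    simp

end TensorRecursion

/-! ### Operators on `X` -/

section Operators

variable {k : Type*} [Field k] {A : Type*} [Ring A] [Algebra k A]
  {g : Type*} [LieRing g] [LieAlgebra k g] (C : CrossedProduct k A g) (K : Subalgebra k A)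

local notation "Λ" => ExteriorAlgebra k g
local notation "TA" => TensorAlgebra k A
local notation "ιT" => TensorAlgebra.ι k

/-- The class of `c ⊗ ω ⊗ t ⊗ e` in `X`, for an arbitrary element `t` of the tensor algebra, as a
multilinear map. -/
def pureT : C.E →ₗ[k] Λ →ₗ[k] TA →ₗ[k] C.E →ₗ[k] C.X K :=
  (TensorProduct.lcurry (.id k) Λ (TA ⊗[k] C.E) (C.X K) ∘ₗ TensorProduct.curry (C.mkX K)).compr₂
    (TensorProduct.lcurry (.id k) TA C.E (C.X K))

theorem pureT_apply (c : C.E) (ω : Λ) (t : TA) (e : C.E) :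
    C.pureT K c ω t e = C.mkX K (c ⊗ₜ (ω ⊗ₜ (t ⊗ₜ e))) := rfl

theorem pureX_eq_pureT (c : C.E) (ω : Λ) (as : List A) (e : C.E) :
    C.pureX K c ω as e = C.pureT K c ω (tens as) e := rfl

theorem lact_pureT (b c : C.E) (ω : Λ) (t : TA) (e : C.E) :
    C.lact K b (C.pureT K c ω t e) = C.pureT K (b * c) ω t e := rfl

theorem ract_pureT (b c : C.E) (ω : Λ) (t : TA) (e : C.E) :
    C.ract K b (C.pureT K c ω t e) = C.pureT K c ω t (e * b) := rfl

theorem signExt_pureT (c : C.E) (ω : Λ) (t : TA) (e : C.E) :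
    C.signExt K (C.pureT K c ω t e) = C.pureT K c (invExt ω) t e := rfl

theorem signTens_pureT (c : C.E) (ω : Λ) (t : TA) (e : C.E) :
    C.signTens K (C.pureT K c ω t e) = C.pureT K c ω (degPow (-1) t) e := by
  rw [← invTens_eq_degPow]
  rfl

theorem shift_pureT (c : C.E) (ω : Λ) (t : TA) (a : A) (h : U k g) :
    C.shift K (C.pureT K c ω t (C.hash a h)) = C.pureT K c ω (t * ιT a) (C.hash 1 h) := rfl

theorem shift_pureT_inA (c : C.E) (ω : Λ) (t : TA) (a : A) :
    C.shift K (C.pureT K c ω t (C.inA a)) = C.pureT K c ω (t * ιT a) 1 :=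
  C.shift_pureT K c ω t a 1

theorem X_hom_ext_pureT {N : Type*} [AddCommGroup N] [Module k N] {φ ψ : C.X K →ₗ[k] N}
    (h : ∀ c ω t e, φ (C.pureT K c ω t e) = ψ (C.pureT K c ω t e)) : φ = ψ :=
  X_hom_ext _ _ fun c ω as e => h c ω (tens as) e

/-! ### The relations of `X`, for arbitrary elements of the tensor algebra -/

section Relations

variable {K} (c : C.E) (ω : ExteriorAlgebra k g) {m : A} (hm : m ∈ K) (s t : TensorAlgebra k A)
  (a b : A) (e : C.E)

include hm

theorem pureT_nil : C.pureT K (c * C.inA m) ω 1 e = C.pureT K c ω 1 (C.inA m * e) := by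
  rw [← sub_eq_zero, pureT_apply, pureT_apply, ← map_sub]
  exact (XRel.nil c ω m hm e).eq

theorem pureT_left :
    C.pureT K (c * C.inA m) ω (ιT a * t) e = C.pureT K c ω (ιT (m * a) * t) e := by
  induction t using tens_induction with
  | zero => simp
  | add t t' ht ht' => simp only [mul_add, map_add, LinearMap.add_apply, ht, ht']
  | smul r t ht => simp only [mul_smul_comm, map_smul, LinearMap.smul_apply, ht]
  | pure as =>
    rw [← tens_cons, ← tens_cons, ← sub_eq_zero, pureT_apply, pureT_apply, ← map_sub]
    exact (XRel.left c ω m hm a as e).eq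

theorem pureT_mid : C.pureT K c ω (s * (ιT (a * m) * (ιT b * t))) e =
    C.pureT K c ω (s * (ιT a * (ιT (m * b) * t))) e := by
  induction s using tens_induction with
  | zero => simp
  | add t t' ht ht' => simp only [add_mul, map_add, LinearMap.add_apply, ht, ht']
  | smul r t ht => simp only [smul_mul_assoc, map_smul, LinearMap.smul_apply, ht]
  | pure as =>
    induction t using tens_induction with
    | zero => simp
    | add t t' ht ht' => simp only [mul_add, map_add, LinearMap.add_apply, ht, ht']
    | smul r t ht => simp only [mul_smul_comm, map_smul, LinearMap.smul_apply, ht]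
    | pure bs =>
      simp only [← tens_cons, ← tens_append]
      rw [← sub_eq_zero, pureT_apply, pureT_apply, ← map_sub]
      exact (XRel.mid c ω as a m hm b bs e).eq

theorem pureT_right : C.pureT K c ω (s * ιT (a * m)) e =
    C.pureT K c ω (s * ιT a) (C.inA m * e) := by
  induction s using tens_induction with
  | zero => simp
  | add t t' ht ht' => simp only [add_mul, map_add, LinearMap.add_apply, ht, ht']
  | smul r t ht => simp only [smul_mul_assoc, map_smul, LinearMap.smul_apply, ht]
  | pure as =>
    have h : ∀ a : A, tens (k := k) as * ιT a = tens (as ++ [a]) := fun a => by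
      rw [tens_append, tens_cons, tens_nil, mul_one]
    rw [h, h, ← sub_eq_zero, pureT_apply, pureT_apply, ← map_sub]
    exact (XRel.right c ω as a m hm e).eq

theorem pureT_norm : C.pureT K c ω (s * (ιT m * t)) e = 0 := by
  induction s using tens_induction with
  | zero => simp
  | add t t' ht ht' => simp only [add_mul, map_add, LinearMap.add_apply, ht, ht', add_zero]
  | smul r t ht => simp only [smul_mul_assoc, map_smul, LinearMap.smul_apply, ht, smul_zero]
  | pure as =>
    induction t using tens_induction with
    | zero => simp
    | add t t' ht ht' => simp only [mul_add, map_add, LinearMap.add_apply, ht, ht', add_zero]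
    | smul r t ht => simp only [mul_smul_comm, map_smul, LinearMap.smul_apply, ht, smul_zero]
    | pure bs =>
      rw [← tens_cons, ← tens_append]
      exact C.pureX_norm K c ω as m hm bs e

theorem pureT_norm_concat : C.pureT K c ω (s * ιT m) e = 0 := by
  simpa using C.pureT_norm c ω hm s 1 e

end Relations

/-- To define a linear map out of `X`, it is enough to define it on the
`c ⊗ ω ⊗ t ⊗ e` and to check the relations there. -/
theorem XRel.map_eq_zero' {N : Type*} [AddCommGroup N] [Module k N] (φ : C.T →ₗ[k] N)
    (F : C.E → Λ → TA → C.E → N)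
    (hF : ∀ c ω t e, φ (c ⊗ₜ (ω ⊗ₜ (t ⊗ₜ e))) = F c ω t e)
    (nil : ∀ c ω, ∀ m ∈ K, ∀ e, F (c * C.inA m) ω 1 e = F c ω 1 (C.inA m * e))
    (left : ∀ c ω, ∀ m ∈ K, ∀ a t e,
      F (c * C.inA m) ω (ιT a * t) e = F c ω (ιT (m * a) * t) e)
    (mid : ∀ c ω, ∀ m ∈ K, ∀ s a b t e, F c ω (s * (ιT (a * m) * (ιT b * t))) e =
      F c ω (s * (ιT a * (ιT (m * b) * t))) e)
    (right : ∀ c ω, ∀ m ∈ K, ∀ s a e,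
      F c ω (s * ιT (a * m)) e = F c ω (s * ιT a) (C.inA m * e))
    (norm : ∀ c ω, ∀ m ∈ K, ∀ s t e, F c ω (s * (ιT m * t)) e = 0)
    (t : C.T) (ht : C.XRel K t) : φ t = 0 := by
  cases ht with
  | nil c ω m hm e => simp only [map_sub, pt, hF, tens_nil, nil c ω m hm, sub_self]
  | left c ω m hm a as e => simp only [map_sub, pt, hF, tens_cons, left c ω m hm, sub_self]
  | mid c ω as a m hm b bs e =>
    simp only [map_sub, pt, hF, tens_append, tens_cons, mid c ω m hm, sub_self]
  | right c ω as a m hm e =>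
    simp only [map_sub, pt, hF, tens_append, tens_cons, tens_nil, mul_one, right c ω m hm,
      sub_self]
  | norm c ω as m hm bs e => simp only [pt, hF, tens_append, tens_cons, norm c ω m hm]

theorem isBimoduleMap_of_pureT (φ : C.X K →ₗ[k] C.X K)
    (h : ∀ b c ω t e, φ (C.pureT K (b * c) ω t e) = C.lact K b (φ (C.pureT K c ω t e)) ∧
      φ (C.pureT K c ω t (e * b)) = C.ract K b (φ (C.pureT K c ω t e))) :
    C.IsBimoduleMap K φ := by
  intro b m
  have h1 : φ ∘ₗ C.lact K b = C.lact K b ∘ₗ φ :=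
    C.X_hom_ext_pureT K fun c ω t e => (h b c ω t e).1
  have h2 : φ ∘ₗ C.ract K b = C.ract K b ∘ₗ φ :=
    C.X_hom_ext_pureT K fun c ω t e => (h b c ω t e).2
  exact ⟨LinearMap.congr_fun h1 m, LinearMap.congr_fun h2 m⟩

/-! ### Operations on the exterior factor -/

section Contract

variable {M : Type*} [AddCommGroup M] [Module k M]

/-- The linear map `ω ↦ c ⊗ ω ⊗ t ⊗ e`. -/
def extLin (c : C.E) (t : TA) (e : C.E) : Λ →ₗ[k] C.X K := ((C.pureT K c).flip t).flip e

@[simp] theorem extLin_apply (c : C.E) (t : TA) (e : C.E) (ω : Λ) :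
    C.extLin K c t e ω = C.pureT K c ω t e := rfl

theorem extLin_lact (b c : C.E) (t : TA) (e : C.E) :
    C.extLin K (b * c) t e = C.lact K b ∘ₗ C.extLin K c t e := rfl

theorem extLin_ract (b c : C.E) (t : TA) (e : C.E) :
    C.extLin K c t (e * b) = C.ract K b ∘ₗ C.extLin K c t e := rfl

/-- The map `X → M ⊗ X` obtained by applying `ψ : ⋀ g → M ⊗ ⋀ g` to the exterior factor. -/
def mapExt (ψ : Λ →ₗ[k] M ⊗[k] Λ) : C.X K →ₗ[k] M ⊗[k] C.X K :=
  C.liftX K (LinearMap.lTensor M (C.mkX K) ∘ₗ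
      (TensorProduct.leftComm k C.E M _).toLinearMap ∘ₗ
      LinearMap.lTensor C.E ((TensorProduct.assoc k M Λ (TA ⊗[k] C.E)).toLinearMap ∘ₗ
        LinearMap.rTensor _ ψ)) (by
    refine XRel.map_eq_zero' C K _
      (fun c ω t e => LinearMap.lTensor M (C.extLin K c t e) (ψ ω)) ?_ ?_ ?_ ?_ ?_ ?_
    · intro c ω t e
      simp only [LinearMap.comp_apply, LinearMap.lTensor_tmul, LinearMap.rTensor_tmul]
      induction ψ ω using TensorProduct.induction_on with
      | zero => simp
      | tmul m ω => simp [pureT_apply]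
      | add p q hp hq => simp only [TensorProduct.add_tmul, TensorProduct.tmul_add, map_add, hp, hq]
    · intro c ω m hm e
      congr 2
      exact LinearMap.ext fun ω => C.pureT_nil c ω hm e
    · intro c ω m hm a t e
      congr 2
      exact LinearMap.ext fun ω => C.pureT_left c ω hm t a e
    · intro c ω m hm s a b t e
      congr 2
      exact LinearMap.ext fun ω => C.pureT_mid c ω hm s t a b e
    · intro c ω m hm s a e
      congr 2
      exact LinearMap.ext fun ω => C.pureT_right c ω hm s a e
    · intro c ω m hm s t e
      have : C.extLin K c (s * (ιT m * t)) e = 0 :=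
        LinearMap.ext fun ω => C.pureT_norm c ω hm s t e
      rw [this, LinearMap.lTensor_zero, LinearMap.zero_apply])

theorem mapExt_pureT (ψ : Λ →ₗ[k] M ⊗[k] Λ) (c : C.E) (ω : Λ) (t : TA) (e : C.E) :
    C.mapExt K ψ (C.pureT K c ω t e) = LinearMap.lTensor M (C.extLin K c t e) (ψ ω) := by
  change (LinearMap.lTensor M (C.mkX K) ∘ₗ
      (TensorProduct.leftComm k C.E M _).toLinearMap ∘ₗ
      LinearMap.lTensor C.E ((TensorProduct.assoc k M Λ (TA ⊗[k] C.E)).toLinearMap ∘ₗ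
        LinearMap.rTensor _ ψ)) (c ⊗ₜ (ω ⊗ₜ (t ⊗ₜ e))) = _
  simp only [LinearMap.comp_apply, LinearMap.lTensor_tmul, LinearMap.rTensor_tmul]
  induction ψ ω using TensorProduct.induction_on with
  | zero => simp
  | tmul m ω => simp [pureT_apply]
  | add p q hp hq => simp only [TensorProduct.add_tmul, TensorProduct.tmul_add, map_add, hp, hq]

/-- The operator `c ⊗ ω ⊗ t ⊗ e ↦ ∑ Φ(m)(c ⊗ ω' ⊗ t ⊗ e)` of `X`, where `ψ(ω) = ∑ m ⊗ ω'`. -/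
def contract (Φ : M →ₗ[k] Module.End k (C.X K)) (ψ : Λ →ₗ[k] M ⊗[k] Λ) :
    C.X K →ₗ[k] C.X K :=
  TensorProduct.lift Φ ∘ₗ C.mapExt K ψ

theorem contract_pureT (Φ : M →ₗ[k] Module.End k (C.X K)) (ψ : Λ →ₗ[k] M ⊗[k] Λ)
    (c : C.E) (ω : Λ) (t : TA) (e : C.E) : C.contract K Φ ψ (C.pureT K c ω t e) =
      TensorProduct.lift Φ (LinearMap.lTensor M (C.extLin K c t e) (ψ ω)) := by
  rw [contract, LinearMap.comp_apply, mapExt_pureT]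

/-- If the operators `F` and `Φ(m)` satisfy `Φ(m) F n = F' Φ'(m) n` for all `n` in the image of
`G`, then so do the corresponding contractions. -/
theorem lift_lTensor_comm {N : Type*} [AddCommGroup N] [Module k N]
    (Φ Φ' : M →ₗ[k] Module.End k (C.X K)) (F F' : C.X K →ₗ[k] C.X K)
    (G : N →ₗ[k] C.X K) (h : ∀ m n, Φ m (F (G n)) = F' (Φ' m (G n))) (w : M ⊗[k] N) :
    TensorProduct.lift Φ (LinearMap.lTensor M (F ∘ₗ G) w) =
      F' (TensorProduct.lift Φ' (LinearMap.lTensor M G w)) := by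
  induction w using TensorProduct.induction_on with
  | zero => simp
  | tmul m n => simp [h]
  | add p q hp hq => simp only [map_add, hp, hq]

theorem contract_bimod (Φ : M →ₗ[k] Module.End k (C.X K)) (ψ : Λ →ₗ[k] M ⊗[k] Λ)
    (h : ∀ m, C.IsBimoduleMap K (Φ m)) : C.IsBimoduleMap K (C.contract K Φ ψ) := by
  refine C.isBimoduleMap_of_pureT K _ fun b c ω t e => ⟨?_, ?_⟩
  · rw [contract_pureT, contract_pureT, extLin_lact]
    exact C.lift_lTensor_comm K Φ Φ _ _ _ (fun m n => (h m b _).1) _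
  · rw [contract_pureT, contract_pureT, extLin_ract]
    exact C.lift_lTensor_comm K Φ Φ _ _ _ (fun m n => (h m b _).2) _

/-- The operator `c ⊗ ω ⊗ t ⊗ e ↦ c ⊗ φ(ω) ⊗ t ⊗ e` of `X`. -/
def extMap (φ : Λ →ₗ[k] Λ) : C.X K →ₗ[k] C.X K :=
  (TensorProduct.lid k (C.X K)).toLinearMap ∘ₗ
    C.mapExt K ((TensorProduct.lid k Λ).symm.toLinearMap ∘ₗ φ)

theorem extMap_pureT (φ : Λ →ₗ[k] Λ) (c : C.E) (ω : Λ) (t : TA) (e : C.E) :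
    C.extMap K φ (C.pureT K c ω t e) = C.pureT K c (φ ω) t e := by
  simp [extMap, mapExt_pureT]

theorem extMap_bimod (φ : Λ →ₗ[k] Λ) : C.IsBimoduleMap K (C.extMap K φ) :=
  C.isBimoduleMap_of_pureT K _ fun b c ω t e => by
    simp only [extMap_pureT, lact_pureT, ract_pureT, and_self]

end Contract

/-! ### The two families of operators that enter `d¹` and `d²` -/

/-- The action of `x` on `A`, as a `k`-linear map. -/
abbrev actOf (x : g) : A →ₗ[k] A := C.act (U.of k g x)

theorem inA_mul_inG (x : g) (a : A) :
    C.inA a * C.inG x = C.inG x * C.inA a - C.inA (C.actOf x a) := by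
  rw [inG_mul_inA, add_sub_cancel_left]

/-- Auxiliary: the operator `adX`, on `T`. -/
def adT (x : g) : C.T →ₗ[k] C.X K :=
  C.mkX K ∘ₗ (LinearMap.rTensor _ (LinearMap.mulRight k (C.inG x)) -
    LinearMap.lTensor _ (LinearMap.lTensor _ (LinearMap.rTensor _ (derT (C.actOf x)))) -
    LinearMap.lTensor _ (LinearMap.lTensor _ (LinearMap.lTensor _
      (LinearMap.mulLeft k (C.inG x)))))

theorem adT_tmul (x : g) (c : C.E) (ω : Λ) (t : TA) (e : C.E) :
    C.adT K x (c ⊗ₜ (ω ⊗ₜ (t ⊗ₜ e))) = C.pureT K (c * C.inG x) ω t e -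
      C.pureT K c ω (derT (C.actOf x) t) e - C.pureT K c ω t (C.inG x * e) := by
  simp only [adT, LinearMap.comp_apply, LinearMap.sub_apply, map_sub]
  rfl

variable {K}

theorem adT_rel (hK : ∀ (x : g), ∀ m ∈ K, C.act (U.of k g x) m ∈ K) (x : g) (t : C.T)
    (ht : C.XRel K t) : C.adT K x t = 0 := by
  refine XRel.map_eq_zero' C K _ _ (C.adT_tmul K x) ?_ ?_ ?_ ?_ ?_ t ht
  · intro c ω m hm e
    have h1 : c * C.inA m * C.inG x = c * C.inG x * C.inA m - c * C.inA (C.actOf x m) := by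
      rw [mul_assoc, inA_mul_inG, mul_sub, mul_assoc]
    have h2 : C.inG x * (C.inA m * e) = C.inA (C.actOf x m) * e + C.inA m * (C.inG x * e) := by
      rw [← mul_assoc, inG_mul_inA, add_mul, mul_assoc]
    rw [h1, h2]
    simp only [derT_one, map_zero, map_sub, map_add, LinearMap.sub_apply, LinearMap.zero_apply,
      C.pureT_nil _ ω hm, C.pureT_nil _ ω (hK x m hm)]
    abel
  · intro c ω m hm a t e
    have h1 : c * C.inA m * C.inG x = c * C.inG x * C.inA m - c * C.inA (C.actOf x m) := by
      rw [mul_assoc, inA_mul_inG, mul_sub, mul_assoc]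
    rw [h1]
    simp only [derT_mul, derT_ι, act_of_mul, map_sub, map_add, LinearMap.sub_apply,
      LinearMap.add_apply, add_mul, C.pureT_left _ ω hm, C.pureT_left _ ω (hK x m hm)]
    abel
  · intro c ω m hm s a b t e
    simp only [derT_mul, derT_ι, act_of_mul, map_add, LinearMap.add_apply, add_mul, mul_add,
      C.pureT_mid _ ω hm, C.pureT_mid _ ω (hK x m hm)]
    abel
  · intro c ω m hm s a e
    have h2 : C.inG x * (C.inA m * e) = C.inA (C.actOf x m) * e + C.inA m * (C.inG x * e) := by
      rw [← mul_assoc, inG_mul_inA, add_mul, mul_assoc]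
    rw [h2]
    simp only [derT_mul, derT_ι, act_of_mul, map_add, LinearMap.add_apply, mul_add,
      C.pureT_right _ ω hm, C.pureT_right _ ω (hK x m hm)]
    abel
  · intro c ω m hm s t e
    simp only [derT_mul, derT_ι, map_add, LinearMap.add_apply, mul_add,
      C.pureT_norm _ ω hm, C.pureT_norm _ ω (hK x m hm), add_zero, sub_zero]

/-- The operator `c ⊗ ω ⊗ t ⊗ e ↦ cx ⊗ ω ⊗ t ⊗ e - c ⊗ ω ⊗ tˣ ⊗ e - c ⊗ ω ⊗ t ⊗ xe` of `X`,
for `x` in `g`, where `t ↦ tˣ` is the derivation that extends the action of `x` on `A`. It is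
well defined since `K` is stable under the action of `g`. -/
def adX (hK : ∀ (x : g), ∀ m ∈ K, C.act (U.of k g x) m ∈ K) : g →ₗ[k] Module.End k (C.X K) where
  toFun x := C.liftX K (C.adT K x) (C.adT_rel hK x)
  map_add' x y := by
    apply X_hom_ext_pureT
    intro c ω t e
    have h := derT_lin 1 (C.actOf x) (C.actOf y) t
    simp only [one_smul] at h
    rw [LinearMap.add_apply]
    refine (C.adT_tmul K _ c ω t e).trans ?_
    refine Eq.trans ?_ (congrArg₂ (· + ·) (C.adT_tmul K x c ω t e) (C.adT_tmul K y c ω t e)).symm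
    have h' : C.actOf (x + y) = C.actOf x + C.actOf y := by simp [actOf]
    rw [h', h]
    simp only [map_add, mul_add, add_mul, LinearMap.add_apply]
    abel
  map_smul' r x := by
    apply X_hom_ext_pureT
    intro c ω t e
    have h := derT_lin r (C.actOf x) 0 t
    have h0 : derT (0 : A →ₗ[k] A) t = 0 := by
      have := derT_lin 1 (0 : A →ₗ[k] A) 0 t
      simpa using this
    rw [add_zero, h0, add_zero] at h
    rw [LinearMap.smul_apply]
    refine (C.adT_tmul K _ c ω t e).trans ?_
    refine Eq.trans ?_ (congrArg (r • ·) (C.adT_tmul K x c ω t e)).symm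
    have h' : C.actOf (r • x) = r • C.actOf x := by simp [actOf]
    rw [h', h]
    simp only [map_smul, mul_smul_comm, smul_mul_assoc, LinearMap.smul_apply, smul_sub]

variable (K)

/-- The elements of `A` whose commutators with the elements of `K` are in `K`. -/
def almostCentral : Submodule k A where
  carrier := {a | ∀ m ∈ K, a * m - m * a ∈ K}
  zero_mem' m hm := by simp
  add_mem' {a b} ha hb m hm := by
    have := K.add_mem (ha m hm) (hb m hm)
    rwa [show a * m - m * a + (b * m - m * b) = (a + b) * m - m * (a + b) by noncomm_ring] at this
  smul_mem' r a ha m hm := by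
    rw [smul_mul_assoc, mul_smul_comm, ← smul_sub]
    exact K.smul_mem (ha m hm) r

variable {K}

theorem pureT_almostCentral (c : C.E) (ω : Λ) {m : A} (hm : m ∈ K) (s t : TA)
    {z : A} (hz : z ∈ almostCentral K) (e : C.E) :
    C.pureT K c ω (s * (ιT (m * z) * t)) e = C.pureT K c ω (s * (ιT (z * m) * t)) e := by
  have h := C.pureT_norm c ω (hz m hm) s t e
  rw [map_sub, sub_mul, mul_sub, map_sub, LinearMap.sub_apply, sub_eq_zero] at h
  exact h.symm

variable (K)

/-- Auxiliary: the operator `insOp`, on `T`. -/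
def insOpT (z : A) : C.T →ₗ[k] C.X K :=
  C.mkX K ∘ₗ LinearMap.lTensor _ (LinearMap.lTensor _ (LinearMap.rTensor _ (insT k z)))

theorem insOpT_tmul (z : A) (c : C.E) (ω : Λ) (t : TA) (e : C.E) :
    C.insOpT K z (c ⊗ₜ (ω ⊗ₜ (t ⊗ₜ e))) = C.pureT K c ω (insT k z t) e := rfl

variable {K}

theorem insOpT_rel {z : A} (hz : z ∈ almostCentral K) (t : C.T) (ht : C.XRel K t) :
    C.insOpT K z t = 0 := by
  refine XRel.map_eq_zero' C K _ _ (C.insOpT_tmul K z) ?_ ?_ ?_ ?_ ?_ t ht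
  · intro c ω m hm e
    have h1 := C.pureT_left c ω hm 1 z e
    have h2 := C.pureT_right c ω hm 1 z e
    have h3 := C.pureT_almostCentral c ω hm 1 1 hz e
    simp only [one_mul, mul_one] at h1 h2 h3
    rw [insT_one, h1, h3, h2]
  · intro c ω m hm a t e
    have h2 := C.pureT_mid c ω hm 1 t z a e
    have h3 := C.pureT_almostCentral c ω hm 1 (ιT a * t) hz e
    simp only [one_mul] at h2 h3
    simp only [insT_ι_mul, map_sub, LinearMap.sub_apply, C.pureT_left c ω hm]
    rw [h3, h2]
  · intro c ω m hm s a b t e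
    have h1 := C.pureT_mid c ω hm (degPow (-1) s * ιT z) t a b e
    have h2 := C.pureT_mid c ω hm (degPow (-1) s) (ιT b * t) a z e
    have h3 := C.pureT_mid c ω hm (degPow (-1) s * ιT a) t z b e
    have h4 := C.pureT_almostCentral c ω hm (degPow (-1) s * ιT a) (ιT b * t) hz e
    simp only [mul_assoc] at h1 h2 h3 h4
    simp only [insT_mul _ s, insT_ι_mul, map_sub, map_add, LinearMap.sub_apply, LinearMap.add_apply,
      mul_sub, C.pureT_mid c ω hm (degPow (-1) s) (insT k z t),
      C.pureT_mid c ω hm (preInsT k z s)]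
    rw [h1, h2, h4, h3]
  · intro c ω m hm s a e
    have h1 := C.pureT_right c ω hm (degPow (-1) s * ιT z) a e
    have h2 := C.pureT_mid c ω hm (degPow (-1) s) 1 a z e
    have h3 := C.pureT_right c ω hm (degPow (-1) s * ιT a) z e
    have h4 := C.pureT_almostCentral c ω hm (degPow (-1) s * ιT a) 1 hz e
    simp only [mul_assoc, mul_one] at h1 h2 h3 h4
    have h5 : ∀ a, insT k z (ιT a) = ιT z * ιT a - ιT a * ιT z := fun a => by
      simpa [insT_one] using insT_ι_mul z a 1
    simp only [insT_mul _ s, h5, map_sub, map_add, LinearMap.sub_apply, LinearMap.add_apply,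
      mul_sub, C.pureT_right c ω hm (preInsT k z s)]
    rw [h1, h2, h4, h3]
  · intro c ω m hm s t e
    have h1 := C.pureT_norm c ω hm (degPow (-1) s * ιT z) t e
    rw [mul_assoc] at h1
    simp only [insT_mul _ s, insT_ι_mul, map_sub, map_add, LinearMap.sub_apply, LinearMap.add_apply,
      mul_sub, C.pureT_norm c ω hm, h1, sub_zero, add_zero]

variable (K)

/-- The signed sum of all the insertions of `z` among the tensor factors from `A`. It is well
defined on `X` for `z` in `almostCentral K`: to move an element of `K` past `z` costs a commutator
in `K`, which vanishes in `A / K`. -/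
def insOp : almostCentral K →ₗ[k] Module.End k (C.X K) where
  toFun z := C.liftX K (C.insOpT K z) (C.insOpT_rel z.2)
  map_add' x y := by
    apply X_hom_ext_pureT
    intro c ω t e
    have h := insT_lin (1 : k) (x : A) y t
    rw [one_smul, one_smul] at h
    rw [LinearMap.add_apply]
    refine (C.insOpT_tmul K _ c ω t e).trans ?_
    rw [Submodule.coe_add, h, map_add, LinearMap.add_apply]
    rfl
  map_smul' r x := by
    apply X_hom_ext_pureT
    intro c ω t e
    have h := insT_lin r (x : A) 0 t
    have h0 : insT k (0 : A) t = 0 := by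
      have := insT_lin (1 : k) (0 : A) 0 t
      simpa using this
    rw [add_zero, h0, add_zero] at h
    rw [LinearMap.smul_apply]
    refine (C.insOpT_tmul K _ c ω t e).trans ?_
    rw [Submodule.coe_smul, h, map_smul, LinearMap.smul_apply]
    rfl

theorem insOp_pureT (z : almostCentral K) (c : C.E) (ω : Λ) (t : TA) (e : C.E) :
    C.insOp K z (C.pureT K c ω t e) = C.pureT K c ω (insT k (z : A) t) e := rfl

theorem insOp_bimod (z : almostCentral K) : C.IsBimoduleMap K (C.insOp K z) :=
  C.isBimoduleMap_of_pureT K _ fun b c ω t e => by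
    simp only [insOp_pureT, lact_pureT, ract_pureT, and_self]

variable {K} (hK : ∀ (x : g), ∀ m ∈ K, C.act (U.of k g x) m ∈ K)

theorem adX_pureT (x : g) (c : C.E) (ω : Λ) (t : TA) (e : C.E) :
    C.adX hK x (C.pureT K c ω t e) = C.pureT K (c * C.inG x) ω t e -
      C.pureT K c ω (derT (C.actOf x) t) e - C.pureT K c ω t (C.inG x * e) := C.adT_tmul K x c ω t e

theorem adX_bimod (x : g) : C.IsBimoduleMap K (C.adX hK x) :=
  C.isBimoduleMap_of_pureT K _ fun b c ω t e => by
    simp only [adX_pureT, lact_pureT, ract_pureT, map_sub, mul_assoc, and_self]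

include hK in
/-- In `E`, the element `f̂(x, y)` is the commutator of `1 # x` and `1 # y`, minus `1 # [x, y]`.
Hence its commutator with `m` is `(mʸ)ˣ - (mˣ)ʸ` minus the image of `m` under `[x, y]`. -/
theorem fhat_mem (x y : g) : C.fhat x y ∈ almostCentral K := by
  intro m hm
  have h : C.fhat x y * m - m * C.fhat x y = C.actOf x (C.actOf y m) - C.actOf y (C.actOf x m) -
      C.actOf ⁅x, y⁆ m := by
    refine counit_right_injective (k := k) (g := g) ?_
    change C.inA _ = C.inA _
    have hf : C.inA (C.fhat x y) = C.inG x * C.inG y - C.inG y * C.inG x - C.inG ⁅x, y⁆ := by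
      rw [inG_commutator, add_sub_cancel_left]
    simp only [map_sub, inA_mul, hf]
    have h1 : ∀ (x : g) (a : A), C.inA (C.actOf x a) = C.inG x * C.inA a - C.inA a * C.inG x :=
      fun x a => by rw [inA_mul_inG]; abel
    simp only [h1]
    noncomm_ring
  rw [h]
  exact K.sub_mem (K.sub_mem (hK _ _ (hK _ _ hm)) (hK _ _ (hK _ _ hm))) (hK _ _ hm)

/-- The restriction of `f` to `g × g`. -/
def fG : g →ₗ[k] g →ₗ[k] A := C.f.compl₁₂ (U.of k g) (U.of k g)

/-- The map `f̂`, with values in `almostCentral K`. -/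
def fhatL : g →ₗ[k] g →ₗ[k] almostCentral K :=
  LinearMap.mk₂ k (fun x y => ⟨C.fhat x y, C.fhat_mem hK x y⟩)
    (fun x y z => Subtype.ext (by simp [fhat]; abel))
    (fun r x y => Subtype.ext (by simp [fhat, smul_sub]))
    (fun x y z => Subtype.ext (by simp [fhat]; abel))
    (fun r x y => Subtype.ext (by simp [fhat, smul_sub]))

theorem coe_fhatL (x y : g) : (C.fhatL hK x y : A) = C.fhat x y := rfl

theorem fhatL_self (x : g) : C.fhatL hK x x = 0 := Subtype.ext (sub_self _)

/-- The map `d¹`. -/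
def dOne : C.X K →ₗ[k] C.X K := C.contract K (C.adX hK) contr + C.extMap K ceDiff

/-- The map `d²`, up to the sign `(-1)ˢ`. -/
def insFhat : C.X K →ₗ[k] C.X K :=
  C.contract K (C.insOp K) (biContr (C.fhatL hK) (C.fhatL_self hK))

/-- The map `d²`. -/
def dTwo : C.X K →ₗ[k] C.X K := C.insFhat hK ∘ₗ C.signExt K

end Operators

/-! ### Compatibility of the operators with the homotopy -/

section Verification

variable {k : Type*} [Field k] {A : Type*} [Ring A] [Algebra k A]
  {g : Type*} [LieRing g] [LieAlgebra k g] (C : CrossedProduct k A g) (K : Subalgebra k A)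

local notation "Λ" => ExteriorAlgebra k g
local notation "TA" => TensorAlgebra k A
local notation "ιΛ" => ExteriorAlgebra.ι k
local notation "ιT" => TensorAlgebra.ι k

/-- The subspace spanned by the elements of `X` with last factor `1`. -/
def oneEnd : Submodule k (C.X K) :=
  Submodule.span k {p | ∃ c ω t, p = C.pureT K c ω t 1}

/-- The subspace spanned by the elements of `X` with last factor in `1 # U(g)`. It is in the
kernel of the homotopy, since the factor `1` that the homotopy inserts vanishes in `A / K`. -/
def hashEnd : Submodule k (C.X K) :=
  Submodule.span k {p | ∃ c ω t h, p = C.pureT K c ω t (C.hash 1 h)}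

theorem oneEnd_mem (c : C.E) (ω : Λ) (t : TA) : C.pureT K c ω t 1 ∈ C.oneEnd K :=
  Submodule.subset_span ⟨c, ω, t, rfl⟩

theorem hashEnd_mem (c : C.E) (ω : Λ) (t : TA) (h : U k g) :
    C.pureT K c ω t (C.hash 1 h) ∈ C.hashEnd K := Submodule.subset_span ⟨c, ω, t, h, rfl⟩

theorem hashEnd_mem_one (c : C.E) (ω : Λ) (t : TA) : C.pureT K c ω t 1 ∈ C.hashEnd K :=
  C.hashEnd_mem K c ω t 1

theorem hashEnd_mem_inG (c : C.E) (ω : Λ) (t : TA) (x : g) :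
    C.pureT K c ω t (C.inG x) ∈ C.hashEnd K := C.hashEnd_mem K c ω t (U.of k g x)

theorem oneEnd_le_hashEnd : C.oneEnd K ≤ C.hashEnd K := by
  rw [oneEnd, Submodule.span_le]
  rintro _ ⟨c, ω, t, rfl⟩
  exact C.hashEnd_mem_one K c ω t

theorem sigmaXAux_pureT (c : C.E) (ω : Λ) (t : TA) (a : A) (h : U k g) :
    C.sigmaXAux K (C.pureT K c ω t (C.hash a h)) =
      -C.pureT K c (invExt ω) (degPow (-1) t * ιT a) (C.hash 1 h) := by
  rw [sigmaXAux, LinearMap.neg_apply, LinearMap.comp_apply, LinearMap.comp_apply, signTens_pureT,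
    signExt_pureT, shift_pureT]

theorem sigmaXAux_hashEnd {p : C.X K} (hp : p ∈ C.hashEnd K) : C.sigmaXAux K p = 0 := by
  have : C.hashEnd K ≤ LinearMap.ker (C.sigmaXAux K) := by
    rw [hashEnd, Submodule.span_le]
    rintro _ ⟨c, ω, t, h, rfl⟩
    rw [SetLike.mem_coe, LinearMap.mem_ker, sigmaXAux_pureT,
      C.pureT_norm_concat c (invExt ω) K.one_mem, neg_zero]
  exact this hp

section

variable {M : Type*} [AddCommGroup M] [Module k M]

variable {C K} in
theorem lift_lTensor_mem (Φ : M →ₗ[k] Module.End k (C.X K)) (G : Λ →ₗ[k] C.X K)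
    (S : Submodule k (C.X K)) (h : ∀ m ω, Φ m (G ω) ∈ S) (w : M ⊗[k] Λ) :
    TensorProduct.lift Φ (LinearMap.lTensor M G w) ∈ S := by
  induction w using TensorProduct.induction_on with
  | zero => simp
  | tmul m ω => simpa using h m ω
  | add p q hp hq => simpa only [map_add] using S.add_mem hp hq

end

/-! ### The horizontal differential, modulo the elements with last factor `1` -/

/-- Among the terms of `d⁰`, all but the last one have last factor `1`. -/
theorem d0Aux_concat (xs : List g) (bs : List A) (b : A) :
    ∃ q ∈ C.oneEnd K, C.d0Aux K (C.gen K 1 xs (bs ++ [b]) 1) =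
      q + ((-1 : k) ^ (bs.length + 1 + xs.length)) •
        C.pureT K 1 (wedge xs) (tens bs) (C.inA b) := by
  have hne : bs ++ [b] ≠ [] := by simp
  have h := C.d0Aux_gen K xs (bs ++ [b]) hne
  refine ⟨_, ?_, h.trans (congrArg (HAdd.hAdd _) ?_)⟩
  · exact Submodule.add_mem _ (Submodule.smul_mem _ _ (C.oneEnd_mem K _ _ _))
      (Submodule.sum_mem _ fun i _ => Submodule.smul_mem _ _ (C.oneEnd_mem K _ _ _))
  · rw [List.dropLast_concat, List.getLast_append_singleton, List.length_append,
      List.length_singleton]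
    rfl

variable {K} (hK : ∀ (x : g), ∀ m ∈ K, C.act (U.of k g x) m ∈ K)

theorem dOne_pureT (c : C.E) (ω : Λ) (t : TA) (e : C.E) :
    C.dOne hK (C.pureT K c ω t e) =
      TensorProduct.lift (C.adX hK) (LinearMap.lTensor g (C.extLin K c t e) (contr ω)) +
        C.pureT K c (ceDiff ω) t e := by
  rw [dOne, LinearMap.add_apply, contract_pureT, extMap_pureT]

theorem insFhat_pureT (c : C.E) (ω : Λ) (t : TA) (e : C.E) :
    C.insFhat hK (C.pureT K c ω t e) = TensorProduct.lift (C.insOp K)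
      (LinearMap.lTensor _ (C.extLin K c t e) (biContr (C.fhatL hK) (C.fhatL_self hK) ω)) :=
  C.contract_pureT K _ _ c ω t e

theorem dOne_bimod : C.IsBimoduleMap K (C.dOne hK) := by
  intro b m
  have h1 := C.contract_bimod K (C.adX hK) contr (C.adX_bimod hK) b m
  have h2 := C.extMap_bimod K ceDiff b m
  simp only [dOne, LinearMap.add_apply, map_add, h1.1, h1.2, h2.1, h2.2, and_self]

theorem dTwo_bimod : C.IsBimoduleMap K (C.dTwo hK) := by
  intro b m
  simp only [dTwo, LinearMap.comp_apply, (C.signExt_bimod K b _).1, (C.signExt_bimod K b _).2]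
  exact C.contract_bimod K _ _ (C.insOp_bimod K) b _

theorem dOne_oneEnd {p : C.X K} (hp : p ∈ C.oneEnd K) : C.dOne hK p ∈ C.hashEnd K := by
  have : C.oneEnd K ≤ (C.hashEnd K).comap (C.dOne hK) := by
    rw [oneEnd, Submodule.span_le]
    rintro _ ⟨c, ω, t, rfl⟩
    rw [SetLike.mem_coe, Submodule.mem_comap, dOne_pureT]
    refine Submodule.add_mem _ (lift_lTensor_mem _ _ _ (fun x ω => ?_) _) (C.hashEnd_mem_one K _ _ _)
    rw [extLin_apply, adX_pureT, mul_one]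
    exact Submodule.sub_mem _ (Submodule.sub_mem _ (C.hashEnd_mem_one K _ _ _)
      (C.hashEnd_mem_one K _ _ _)) (C.hashEnd_mem_inG K _ _ _ _)
  exact this hp

theorem dTwo_hashEnd {p : C.X K} (hp : p ∈ C.hashEnd K) : C.dTwo hK p ∈ C.hashEnd K := by
  have : C.hashEnd K ≤ (C.hashEnd K).comap (C.dTwo hK) := by
    rw [hashEnd, Submodule.span_le]
    rintro _ ⟨c, ω, t, h, rfl⟩
    rw [SetLike.mem_coe, Submodule.mem_comap, dTwo, LinearMap.comp_apply, signExt_pureT,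
      insFhat_pureT]
    exact lift_lTensor_mem _ _ _ (fun z ω => C.hashEnd_mem K _ _ _ _) _
  exact this hp

theorem dTwo_oneEnd {p : C.X K} (hp : p ∈ C.oneEnd K) : C.dTwo hK p ∈ C.oneEnd K := by
  have : C.oneEnd K ≤ (C.oneEnd K).comap (C.dTwo hK) := by
    rw [oneEnd, Submodule.span_le]
    rintro _ ⟨c, ω, t, rfl⟩
    rw [SetLike.mem_coe, Submodule.mem_comap, dTwo, LinearMap.comp_apply, signExt_pureT,
      insFhat_pureT]
    exact lift_lTensor_mem _ _ _ (fun z ω => C.oneEnd_mem K _ _ _) _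
  exact this hp

/-! ### Commutation of the operators with the homotopy -/

theorem inA_mul_inG_eq_hash (a : A) (x : g) : C.inA a * C.inG x = C.hash a (U.of k g x) :=
  (C.hash_eq a _).symm

theorem signTens_dOne (c : C.E) (ω : Λ) (t : TA) (e : C.E) :
    C.signTens K (C.dOne hK (C.pureT K c ω t e)) =
      C.dOne hK (C.pureT K c ω (degPow (-1) t) e) := by
  have h : C.extLin K c (degPow (-1) t) e = C.signTens K ∘ₗ C.extLin K c t e :=
    LinearMap.ext fun ω => (C.signTens_pureT K c ω t e).symm
  rw [dOne_pureT, dOne_pureT, h, map_add, signTens_pureT,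
    C.lift_lTensor_comm K (C.adX hK) (C.adX hK) (C.signTens K) (C.signTens K)]
  intro x ω
  simp only [extLin_apply, signTens_pureT, adX_pureT, map_sub, degPow_derT]

theorem signExt_dOne (c : C.E) (ω : Λ) (t : TA) (e : C.E) :
    C.signExt K (C.dOne hK (C.pureT K c ω t e)) =
      -C.dOne hK (C.pureT K c (invExt ω) t e) := by
  have h : C.extLin K c t e ∘ₗ invExt = C.signExt K ∘ₗ C.extLin K c t e := rfl
  rw [dOne_pureT, dOne_pureT, contr_invExt, map_neg, map_neg,
    ← LinearMap.lTensor_comp_apply, h, ceDiff_invExt, map_add, signExt_pureT,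
    C.lift_lTensor_comm K (C.adX hK) (C.adX hK) (C.signExt K) (C.signExt K)]
  · simp only [map_neg, LinearMap.neg_apply, neg_add, neg_neg]
  intro x ω
  simp only [extLin_apply, signExt_pureT, adX_pureT, map_sub]

theorem shift_dOne (c : C.E) (ω : Λ) (t : TA) (b : A) :
    C.shift K (C.dOne hK (C.pureT K c ω t (C.inA b))) =
      C.dOne hK (C.pureT K c ω (t * ιT b) 1) := by
  have h : C.extLin K c (t * ιT b) 1 = C.shift K ∘ₗ C.extLin K c t (C.inA b) :=
    LinearMap.ext fun ω => (C.shift_pureT_inA K c ω t b).symm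
  rw [dOne_pureT, dOne_pureT, h, map_add, shift_pureT_inA,
    C.lift_lTensor_comm K (C.adX hK) (C.adX hK) (C.shift K) (C.shift K)]
  intro x ω
  simp only [extLin_apply, shift_pureT_inA, adX_pureT, map_sub, inG_mul_inA, map_add,
    inA_mul_inG_eq_hash, shift_pureT, derT_mul, derT_ι, LinearMap.add_apply, mul_one]
  have : C.inG x = C.hash 1 (U.of k g x) := rfl
  rw [this]
  abel

/-- Since `d¹` commutes with the shift of a factor from `A` across the last tensor sign, the
homotopy undoes the last term of `d⁰`. -/
theorem sigmaXAux_dOne (c : C.E) (ω : Λ) (t : TA) (b : A) :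
    C.sigmaXAux K (C.dOne hK (C.pureT K c ω t (C.inA b))) =
      C.dOne hK (C.pureT K c (invExt ω) (degPow (-1) t * ιT b) 1) := by
  rw [sigmaXAux, LinearMap.neg_apply, LinearMap.comp_apply, LinearMap.comp_apply, signTens_dOne,
    signExt_dOne, map_neg, shift_dOne, neg_neg]

theorem signTens_insFhat (c : C.E) (ω : Λ) (t : TA) (e : C.E) :
    C.signTens K (C.insFhat hK (C.pureT K c ω t e)) =
      -C.insFhat hK (C.pureT K c ω (degPow (-1) t) e) := by
  have h : C.extLin K c (degPow (-1) t) e = C.signTens K ∘ₗ C.extLin K c t e :=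
    LinearMap.ext fun ω => (C.signTens_pureT K c ω t e).symm
  rw [insFhat_pureT, insFhat_pureT, h,
    C.lift_lTensor_comm K (C.insOp K) (C.insOp K) (C.signTens K) (-C.signTens K),
    LinearMap.neg_apply, neg_neg]
  intro z ω
  simp only [extLin_apply, signTens_pureT, insOp_pureT, degPow_insT, map_neg, LinearMap.neg_apply,
    neg_neg]

theorem signExt_insFhat (c : C.E) (ω : Λ) (t : TA) (e : C.E) :
    C.signExt K (C.insFhat hK (C.pureT K c ω t e)) =
      C.insFhat hK (C.pureT K c (invExt ω) t e) := by
  have h : C.extLin K c t e ∘ₗ invExt = C.signExt K ∘ₗ C.extLin K c t e := rfl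
  rw [insFhat_pureT, insFhat_pureT, biContr_invExt, ← LinearMap.lTensor_comp_apply, h,
    C.lift_lTensor_comm K (C.insOp K) (C.insOp K) (C.signExt K) (C.signExt K)]
  intro z ω
  rfl

theorem sigmaXAux_dTwo (c : C.E) (ω : Λ) (t : TA) (e : C.E) :
    C.sigmaXAux K (C.dTwo hK (C.pureT K c ω t e)) =
      C.shift K (C.insFhat hK (C.pureT K c ω (degPow (-1) t) e)) := by
  rw [sigmaXAux, LinearMap.neg_apply, LinearMap.comp_apply, LinearMap.comp_apply, dTwo,
    LinearMap.comp_apply, signExt_pureT, signTens_insFhat, map_neg, signExt_insFhat, invExt_invExt,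
    map_neg, neg_neg]

/-- The operators `c ⊗ ω ⊗ t ⊗ 1 ↦ c ⊗ ω ⊗ t ⊗ z ⊗ 1`. -/
def appendOp : almostCentral K →ₗ[k] Module.End k (C.X K) :=
  LinearMap.llcomp k _ _ _ (C.shift K) ∘ₗ C.ractLin K ∘ₗ C.inA ∘ₗ (almostCentral K).subtype

theorem appendOp_pureT (z : almostCentral K) (c : C.E) (ω : Λ) (t : TA) :
    C.appendOp z (C.pureT K c ω t 1) = C.pureT K c ω (t * ιT (z : A)) 1 := by
  change C.shift K (C.ract K (C.inA z) (C.pureT K c ω t 1)) = _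
  rw [ract_pureT, one_mul, shift_pureT_inA]

/-- The part of `d²` where `f̂` is inserted in the last place. -/
def appendFhat : C.X K →ₗ[k] C.X K :=
  C.contract K C.appendOp (biContr (C.fhatL hK) (C.fhatL_self hK))

theorem insFhat_one (c : C.E) (ω : Λ) :
    C.insFhat hK (C.pureT K c ω 1 1) = C.appendFhat hK (C.pureT K c ω 1 1) := by
  rw [insFhat_pureT, appendFhat, contract_pureT]
  have := C.lift_lTensor_comm K (C.insOp K) C.appendOp LinearMap.id LinearMap.id
    (C.extLin K c 1 1) (fun z ω => by
      simp only [LinearMap.id_apply, extLin_apply, appendOp_pureT, insOp_pureT, insT_one, one_mul])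
  exact this _

/-- The insertions before `b` are obtained by moving `b` to the end and back, which leaves the
insertion after `b`. -/
theorem insFhat_concat (c : C.E) (ω : Λ) (t : TA) (b : A) :
    C.insFhat hK (C.pureT K c ω (t * ιT b) 1) =
      C.shift K (C.insFhat hK (C.pureT K c ω t (C.inA b))) +
        C.appendFhat hK (C.pureT K c ω (degPow (-1) (t * ιT b)) 1) := by
  rw [insFhat_pureT, insFhat_pureT, appendFhat, contract_pureT]
  generalize biContr (C.fhatL hK) (C.fhatL_self hK) ω = w
  induction w using TensorProduct.induction_on with
  | zero => simp
  | add p q hp hq => simp only [map_add, hp, hq]; abel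
  | tmul z ω =>
    have h5 : insT k (z : A) (ιT b) = ιT (z : A) * ιT b - ιT b * ιT (z : A) := by
      simpa [insT_one] using insT_ι_mul (z : A) b (1 : TA)
    have h6 : degPow (-1) (t * ιT b) = -(degPow (-1) t * ιT b) := by
      simp [degPow]
    simp only [LinearMap.lTensor_tmul, TensorProduct.lift.tmul, extLin_apply, insOp_pureT,
      appendOp_pureT, shift_pureT_inA, h6, insT_mul, h5, insT_eq (z : A) t]
    simp only [mul_sub, add_mul, map_add, map_sub, neg_mul, map_neg, LinearMap.add_apply,
      LinearMap.sub_apply, LinearMap.neg_apply, mul_assoc]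
    abel

/-! ### The square of `d¹` -/

/-- The operators `p ↦ px` of `X`, for `x` in `g`. -/
def ractG : g →ₗ[k] Module.End k (C.X K) := C.ractLin K ∘ₗ C.inG

/-- The operators `p ↦ pa` of `X`, for `a` in `A`. -/
def ractA : A →ₗ[k] Module.End k (C.X K) := C.ractLin K ∘ₗ C.inA

theorem ractG_pureT (x : g) (c : C.E) (ω : Λ) (t : TA) :
    C.ractG x (C.pureT K c ω t 1) = C.pureT K c ω t (C.inG x) := by
  change C.ract K (C.inG x) _ = _
  rw [ract_pureT, one_mul]

theorem ractA_pureT (a : A) (c : C.E) (ω : Λ) (t : TA) :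
    C.ractA a (C.pureT K c ω t 1) = C.pureT K c ω t (C.inA a) := by
  change C.ract K (C.inA a) _ = _
  rw [ract_pureT, one_mul]

/-- Modulo the elements with last factor `1`, only the terms of `d¹` with `xᵢ` on the right
remain. -/
theorem dOne_add_ractG (c : C.E) (ω : Λ) (t : TA) :
    C.dOne hK (C.pureT K c ω t 1) +
      TensorProduct.lift C.ractG (LinearMap.lTensor g (C.extLin K c t 1) (contr ω)) ∈
        C.oneEnd K := by
  rw [dOne_pureT, add_right_comm]
  refine Submodule.add_mem _ ?_ (C.oneEnd_mem K _ _ _)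
  generalize contr ω = w
  induction w using TensorProduct.induction_on with
  | zero => simp
  | add p q hp hq =>
    simp only [map_add]
    rw [add_add_add_comm]
    exact Submodule.add_mem _ hp hq
  | tmul x ω =>
    simp only [LinearMap.lTensor_tmul, TensorProduct.lift.tmul, extLin_apply, ractG_pureT,
      adX_pureT, mul_one, sub_add_cancel]
    exact Submodule.sub_mem _ (C.oneEnd_mem K _ _ _) (C.oneEnd_mem K _ _ _)

/-- Modulo `1 # U(g)`, the product of `1 # x'` and `1 # x` is `f(x', x)`. -/
theorem dOne_ractG (c : C.E) (t : TA) (w : g ⊗[k] Λ) :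
    C.dOne hK (TensorProduct.lift C.ractG (LinearMap.lTensor g (C.extLin K c t 1) w)) +
      TensorProduct.lift C.ractA (LinearMap.lTensor A (C.extLin K c t 1) (contrWith C.fG w)) ∈
        C.hashEnd K := by
  induction w using TensorProduct.induction_on with
  | zero => simp
  | add p q hp hq =>
    simp only [map_add]
    rw [add_add_add_comm]
    exact Submodule.add_mem _ hp hq
  | tmul x ω =>
    rw [LinearMap.lTensor_tmul, TensorProduct.lift.tmul, extLin_apply, ractG_pureT, dOne_pureT,
      contrWith_tmul, add_right_comm]
    refine Submodule.add_mem _ ?_ (C.hashEnd_mem_inG K _ _ _ _)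
    generalize contr ω = w
    induction w using TensorProduct.induction_on with
    | zero => simp
    | add p q hp hq =>
      simp only [map_add]
      rw [add_add_add_comm]
      exact Submodule.add_mem _ hp hq
    | tmul x' ω =>
      have hf : C.fG.flip x x' = C.f (U.of k g x') (U.of k g x) := rfl
      simp only [LinearMap.lTensor_tmul, LinearMap.rTensor_tmul, TensorProduct.lift.tmul,
        extLin_apply, adX_pureT, ractA_pureT, inG_mul_inG, map_add, hf]
      rw [sub_add, add_sub_cancel_left]
      exact Submodule.sub_mem _ (Submodule.sub_mem _ (C.hashEnd_mem_inG K _ _ _ _)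
        (C.hashEnd_mem_inG K _ _ _ _)) (C.hashEnd_mem K _ _ _ _)

theorem sigmaXAux_dOne_dOne (c : C.E) (ω : Λ) (t : TA) :
    C.sigmaXAux K (C.dOne hK (C.dOne hK (C.pureT K c ω t 1))) =
      -C.appendFhat hK (C.pureT K c (invExt ω) (degPow (-1) t) 1) := by
  set w := TensorProduct.lift C.ractG (LinearMap.lTensor g (C.extLin K c t 1) (contr ω)) with hw
  have h1 : C.sigmaXAux K (C.dOne hK (C.dOne hK (C.pureT K c ω t 1))) =
      -C.sigmaXAux K (C.dOne hK w) := by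
    have := C.sigmaXAux_hashEnd K (C.dOne_oneEnd hK (C.dOne_add_ractG hK c ω t))
    rwa [map_add, map_add, add_eq_zero_iff_eq_neg] at this
  have h2 := C.sigmaXAux_hashEnd K (C.dOne_ractG hK c t (contr ω))
  rw [map_add, add_eq_zero_iff_eq_neg] at h2
  rw [h1, h2, neg_neg]
  have hβ : ∀ x : g, (C.fG - C.fG.flip) x x = 0 := fun x => by simp
  rw [contrWith_contr C.fG (C.fG - C.fG.flip) hβ (fun x y => by simp),
    ← rTensor_biContr (almostCentral K).subtype (C.fhatL hK) (C.fhatL_self hK) _ hβ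
      (fun x y => rfl), appendFhat, contract_pureT, biContr_invExt]
  generalize biContr (C.fhatL hK) (C.fhatL_self hK) ω = v
  induction v using TensorProduct.induction_on with
  | zero => simp
  | add p q hp hq => simp only [map_add, hp, hq]; abel
  | tmul z ω =>
    simp only [LinearMap.lTensor_tmul, LinearMap.rTensor_tmul, TensorProduct.lift.tmul,
      extLin_apply, ractA_pureT, appendOp_pureT, Submodule.subtype_apply, inA_eq_hash,
      sigmaXAux_pureT]
    rfl

end Verification

/-! ### The boundary of `Y` -/

section ColumnZero

variable {k : Type*} [Field k] {A : Type*} [Ring A] [Algebra k A]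
  {g : Type*} [LieRing g] [LieAlgebra k g] (C : CrossedProduct k A g)

local notation "Λ" => ExteriorAlgebra k g
local notation "ιΛ" => ExteriorAlgebra.ι k

theorem wedge_hom_ext {N : Type*} [AddCommGroup N] [Module k N] {φ ψ : Λ →ₗ[k] N}
    (h : ∀ xs, φ (wedge xs) = ψ (wedge xs)) : φ = ψ := by
  refine LinearMap.ext fun ω => ?_
  refine LinearMap.eqOn_span (f := φ) (g := ψ) (s := Set.range (wedge (k := k) (g := g))) ?_
    (mem_span_wedge ω)
  rintro _ ⟨xs, rfl⟩
  exact h xs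

/-- The map `x ↦ e_x`. -/
def YeL : g →ₗ[k] C.Y where
  toFun := C.Ye
  map_add' x y := by simpa using C.Ye_lin 1 x y
  map_smul' r x := by simpa [Ye_zero] using C.Ye_lin r x 0

/-- The map `x ↦ y_x`. -/
def YyL : g →ₗ[k] C.Y where
  toFun := C.Yy
  map_add' x y := by simpa using C.Yy_lin 1 x y
  map_smul' r x := by simpa [Yy_zero] using C.Yy_lin r x 0

/-- The map `x ↦ z_x`. -/
def YzL : g →ₗ[k] C.Y where
  toFun := C.Yz
  map_add' x y := by simpa using C.Yz_lin 1 x y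
  map_smul' r x := by simpa [Yz_zero] using C.Yz_lin r x 0

/-- The algebra map from `⋀ g` to `Y` with `x ↦ e_x`; it restricts to `μ`. -/
def extY : Λ →ₐ[k] C.Y := ExteriorAlgebra.lift k ⟨C.YeL, C.Ye_e⟩

theorem extY_ι (x : g) : C.extY (ιΛ x) = C.Ye x := ExteriorAlgebra.lift_ι_apply k _ _ x

theorem extY_wedge (xs : List g) : C.extY (wedge xs) = C.mu xs := by
  rw [mu, wedge, map_list_prod, List.map_map]
  congr 2
  funext x
  exact C.extY_ι x

/-- The map `x ⊗ ω ↦ ω z_x - y_x ω` from `g ⊗ ⋀ g` to `Y`. -/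
def boundY : g ⊗[k] Λ →ₗ[k] C.Y :=
  TensorProduct.lift (((LinearMap.mul k C.Y).flip ∘ₗ C.YzL).compl₂ C.extY.toLinearMap -
    (LinearMap.mul k C.Y ∘ₗ C.YyL).compl₂ C.extY.toLinearMap)

theorem boundY_tmul (x : g) (ω : Λ) :
    C.boundY (x ⊗ₜ ω) = C.extY ω * C.Yz x - C.Yy x * C.extY ω := rfl

theorem Yz_mul_extY (x : g) (ω : Λ) : C.Yz x * C.extY ω = C.extY ω * C.Yz x := by
  induction ω using exterior_induction with
  | scalar r => rw [AlgHom.commutes, Algebra.commutes]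
  | add p q hp hq => rw [map_add, mul_add, add_mul, hp, hq]
  | ι_mul y ω h => rw [map_mul, extY_ι, ← mul_assoc, ← Ye_z, mul_assoc, h, mul_assoc]

theorem Ye_mul_boundY (x : g) (w : g ⊗[k] Λ) : C.Ye x * C.boundY w =
    C.boundY (wedgeL k g x w) - C.extY (wedgeMul (LinearMap.rTensor Λ (bracket k g x) w)) := by
  induction w using TensorProduct.induction_on with
  | zero => simp
  | add p q hp hq => simp only [map_add, mul_add, hp, hq]; abel
  | tmul y ω =>
    simp only [wedgeL_tmul, boundY_tmul, LinearMap.rTensor_tmul, wedgeMul_tmul, map_mul, extY_ι,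
      mul_sub, bracket_apply, ← mul_assoc, Ye_y, add_mul]
    abel

/-- The boundary of `e_{x₁} ⋯ e_{xₛ}`. Moving the `y_x` to the left past the `e_{x'}` produces the
Chevalley–Eilenberg differential. -/
theorem delAux_extY (ω : Λ) :
    C.delAux (C.extY ω) = C.boundY (contr ω) - C.extY (ceDiff ω) := by
  have h1 : C.delAux 1 = 0 := by
    rw [delAux_apply, map_one, Matrix.one_apply_ne (by decide)]
  induction ω using exterior_induction with
  | scalar r =>
    rw [AlgHom.commutes, Algebra.algebraMap_eq_smul_one, map_smul, h1, contr_algebraMap,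
      ceDiff_algebraMap]
    simp
  | add p q hp hq => simp only [map_add, hp, hq]; abel
  | ι_mul x ω h =>
    have hd := C.delAux_mul (C.yGen_mem (.e x)) (C.extY ω)
    have hx : C.yGen (.e x) = C.Ye x := rfl
    rw [hx, delAux_e, h] at hd
    simp only [YGen.deg, pow_one] at hd
    rw [map_mul, extY_ι, hd, contr_mul, ceDiff_mul, map_sub, map_sub, boundY_tmul, map_neg, map_mul,
      extY_ι, mul_sub, Ye_mul_boundY, sub_mul, Yz_mul_extY]
    noncomm_ring

variable (K : Subalgebra k A)

theorem sigmaYAux_extY (ω : Λ) : C.sigmaYAux K (C.extY ω) = C.pureT K 1 ω 1 1 := by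
  have h : C.sigmaYAux K ∘ₗ C.extY.toLinearMap = C.extLin K 1 1 1 := by
    refine wedge_hom_ext fun xs => ?_
    have := C.sigmaYAux_e_z K xs [] (fun _ : Fin 1 => 1) (fun _ => 1) (by simp [one_eq_hash])
    simpa [extY_wedge, mu, inA_one, gen, ← one_eq_hash, pureX_eq_pureT, tens_nil] using this
  exact LinearMap.congr_fun h ω

theorem sigmaYAux_extY_mul (ω : Λ) (x : g) :
    C.sigmaYAux K (C.extY ω * C.Yz x) = C.pureT K 1 ω 1 (C.inG x) := by
  have h : C.sigmaYAux K ∘ₗ LinearMap.mulRight k (C.Yz x) ∘ₗ C.extY.toLinearMap =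
      C.extLin K 1 1 (C.inG x) := by
    refine wedge_hom_ext fun xs => ?_
    have hx : C.inG x = C.hash 1 (U.of k g x) := rfl
    have := C.sigmaYAux_e_z K xs [x] (fun _ : Fin 1 => 1) (fun _ => U.of k g x) (by simp [hx])
    simpa [extY_wedge, mu, inA_one, gen, hx, pureX_eq_pureT, tens_nil] using this
  exact LinearMap.congr_fun h ω

variable {K} (hK : ∀ (x : g), ∀ m ∈ K, C.act (U.of k g x) m ∈ K)

theorem dOne_column_zero (ω : Λ) :
    C.dOne hK (C.pureT K 1 ω 1 1) = -C.sigmaYAux K (C.delAux (C.extY ω)) := by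
  rw [delAux_extY, map_sub, sigmaYAux_extY, dOne_pureT, neg_sub, sub_eq_neg_add]
  congr 1
  generalize contr ω = w
  induction w using TensorProduct.induction_on with
  | zero => simp
  | add p q hp hq => simp only [map_add, hp, hq, neg_add]
  | tmul x ω =>
    rw [LinearMap.lTensor_tmul, TensorProduct.lift.tmul, extLin_apply, adX_pureT, boundY_tmul,
      map_sub, sigmaYAux_extY_mul, sigmaYAux_y, sigmaYAux_extY, lact_pureT, derT_one]
    simp

end ColumnZero

/-! ### Existence of the differentials -/

section Existence

variable {k : Type*} [Field k] {A : Type*} [Ring A] [Algebra k A]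
  {g : Type*} [LieRing g] [LieAlgebra k g] (C : CrossedProduct k A g) {K : Subalgebra k A}
  (hK : ∀ (x : g), ∀ m ∈ K, C.act (U.of k g x) m ∈ K)

/-- The family of the `dˡ`, by their explicit formulas; they are zero for `l ≥ 3`. -/
def diff : ℕ → C.X K →ₗ[k] C.X K
  | 0 => C.d0Aux K
  | 1 => C.dOne hK
  | 2 => C.dTwo hK
  | _ => 0

theorem diff_eq_zero {l : ℕ} (hl : 3 ≤ l) : C.diff hK l = 0 := by
  obtain ⟨n, rfl⟩ := Nat.exists_eq_add_of_le' hl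
  rfl

theorem pureT_smul_ext (r : k) (c : C.E) (ω : ExteriorAlgebra k g) (t : TensorAlgebra k A)
    (e : C.E) : C.pureT K c (r • ω) t e = r • C.pureT K c ω t e := by
  rw [map_smul, LinearMap.smul_apply, LinearMap.smul_apply]

theorem dTwo_gen (xs : List g) (as : List A) : C.dTwo hK (C.gen K 1 xs as 1) =
    ((-1 : k) ^ xs.length) • C.insFhat hK (C.gen K 1 xs as 1) := by
  rw [dTwo, LinearMap.comp_apply, signExt_gen, map_smul]

theorem gen_eq_pureT (c : C.E) (xs : List g) (as : List A) (e : C.E) :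
    C.gen K c xs as e = C.pureT K c (wedge xs) (tens as) e := rfl

theorem neg_one_pow_mul_self {k : Type*} [Field k] (n : ℕ) : (-1 : k) ^ n * (-1) ^ n = 1 := by
  rw [← mul_pow, neg_one_mul, neg_neg, one_pow]

theorem dOne_one_pos (xs : List g) (bs : List A) (b : A) :
    C.dOne hK (C.gen K 1 xs (bs ++ [b]) 1) =
      -C.sigmaXAux K (C.dOne hK (C.d0Aux K (C.gen K 1 xs (bs ++ [b]) 1))) := by
  obtain ⟨q, hq, h⟩ := C.d0Aux_concat K xs bs b
  rw [h, map_add, map_add, C.sigmaXAux_hashEnd K (C.dOne_oneEnd hK hq), zero_add, map_smul,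
    map_smul, sigmaXAux_dOne, invExt_wedge, degPow_tens, gen_eq_pureT, tens_append, tens_cons,
    tens_nil, mul_one]
  simp only [smul_mul_assoc, map_smul, LinearMap.smul_apply, smul_smul, ← neg_smul]
  have h1 := neg_one_pow_mul_self (k := k) xs.length
  have h2 := neg_one_pow_mul_self (k := k) bs.length
  have h3 : -((-1 : k) ^ (bs.length + 1 + xs.length) * ((-1) ^ bs.length * (-1) ^ xs.length)) =
      1 := by
    rw [pow_add, pow_succ]
    linear_combination (-1 : k) ^ xs.length * (-1) ^ xs.length * h2 + h1
  rw [h3, one_smul]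

theorem sigmaXAux_dOne_dOne_gen (xs : List g) (as : List A) :
    -C.sigmaXAux K (C.dOne hK (C.dOne hK (C.gen K 1 xs as 1))) =
      ((-1 : k) ^ xs.length) •
        C.appendFhat hK (C.pureT K 1 (wedge xs) (degPow (-1) (tens as)) 1) := by
  rw [gen_eq_pureT, sigmaXAux_dOne_dOne, neg_neg, invExt_wedge, pureT_smul_ext, map_smul]

theorem dTwo_rec_nil (xs : List g) : C.dTwo hK (C.gen K 1 xs [] 1) =
    -C.sigmaXAux K (C.dOne hK (C.dOne hK (C.gen K 1 xs [] 1))) := by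
  rw [sigmaXAux_dOne_dOne_gen, dTwo_gen, gen_eq_pureT, tens_nil, map_one (degPow (-1)), insFhat_one]

theorem dTwo_rec_pos (xs : List g) (bs : List A) (b : A) :
    C.dTwo hK (C.gen K 1 xs (bs ++ [b]) 1) =
      -(C.sigmaXAux K (C.dTwo hK (C.d0Aux K (C.gen K 1 xs (bs ++ [b]) 1))) +
        C.sigmaXAux K (C.dOne hK (C.dOne hK (C.gen K 1 xs (bs ++ [b]) 1)))) := by
  obtain ⟨q, hq, h⟩ := C.d0Aux_concat K xs bs b
  have hq' := C.sigmaXAux_hashEnd K (C.oneEnd_le_hashEnd K (C.dTwo_oneEnd hK hq))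
  have ht : tens (k := k) (bs ++ [b]) = tens bs * TensorAlgebra.ι k b := by
    rw [tens_append, tens_cons, tens_nil, mul_one]
  rw [neg_add, sigmaXAux_dOne_dOne_gen, dTwo_gen, h, map_add, map_add, hq', zero_add, map_smul,
    map_smul, sigmaXAux_dTwo, gen_eq_pureT, ht, insFhat_concat, smul_add, degPow_tens]
  congr 1
  simp only [map_smul, LinearMap.smul_apply, smul_smul, ← neg_smul]
  congr 1
  have h2 := neg_one_pow_mul_self (k := k) bs.length
  rw [pow_add, pow_succ]
  linear_combination (-(-1 : k) ^ xs.length) * h2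

theorem dOne_gen_mem (xs : List g) (as : List A) :
    C.dOne hK (C.gen K 1 xs as 1) ∈ C.hashEnd K :=
  C.dOne_oneEnd hK (C.oneEnd_mem K _ _ _)

/-- The recursion yields zero for `l ≥ 3`, since the elements to which the homotopy is applied
have last factor in `1 # U(g)`. -/
theorem sigmaXAux_diff_diff {l j : ℕ} (hl : 3 ≤ l) (hj : j < l) (xs : List g) (as : List A) :
    C.sigmaXAux K (C.diff hK (l - j) (C.diff hK j (C.gen K 1 xs as 1))) = 0 := by
  have h2 : C.dTwo hK (C.gen K 1 xs as 1) ∈ C.oneEnd K :=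
    C.dTwo_oneEnd hK (C.oneEnd_mem K _ _ _)
  by_cases h : 3 ≤ l - j
  · rw [C.diff_eq_zero hK h, LinearMap.zero_apply, map_zero]
  match j with
  | 0 => exact absurd hl h
  | 1 =>
    obtain rfl : l = 3 := by omega
    exact C.sigmaXAux_hashEnd K (C.dTwo_hashEnd hK (C.dOne_gen_mem hK xs as))
  | 2 =>
    obtain rfl | rfl : l = 3 ∨ l = 4 := by omega
    · exact C.sigmaXAux_hashEnd K (C.dOne_oneEnd hK h2)
    · exact C.sigmaXAux_hashEnd K (C.dTwo_hashEnd hK (C.oneEnd_le_hashEnd K h2))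
  | n + 3 => simp [diff]

theorem diff_isDifferential : C.IsDifferential K (C.diff hK) where
  bimod l := by
    match l with
    | 0 => exact C.d0Aux_bimod K
    | 1 => exact C.dOne_bimod hK
    | 2 => exact C.dTwo_bimod hK
    | n + 3 => intro b m; simp [diff]
  zero := rfl
  out_of_range l xs as h := by
    match l, xs, h with
    | 1, [], _ =>
      change C.dOne hK (C.pureT K 1 (wedge []) _ 1) = 0
      rw [dOne_pureT, wedge_nil, contr_one]
      have : ceDiff (1 : ExteriorAlgebra k g) = 0 := by simpa using ceDiff_algebraMap (g := g) (1 : k)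
      simp [this]
    | 2, [], _ =>
      change C.dTwo hK (C.gen K 1 [] as 1) = 0
      rw [dTwo_gen, gen_eq_pureT, insFhat_pureT, wedge_nil, biContr_one]
      simp
    | 2, [x], _ =>
      change C.dTwo hK (C.gen K 1 [x] as 1) = 0
      rw [dTwo_gen, gen_eq_pureT, insFhat_pureT, biContr_singleton]
      simp
    | n + 3, xs, _ => rfl
  one_nil xs _ := by
    change C.dOne hK (C.pureT K 1 (wedge xs) 1 1) = -C.sigmaYAux K (C.delAux (C.mu xs))
    rw [dOne_column_zero, extY_wedge]
  one_pos xs as _ h := by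
    rcases list_cases_append as with rfl | ⟨bs, b, rfl⟩
    · exact absurd rfl h
    · exact C.dOne_one_pos hK xs bs b
  rec_nil l xs h1 _ := by
    match l, h1 with
    | 2, _ =>
      rw [show Finset.Ico 1 2 = {1} from rfl, Finset.sum_singleton]
      exact C.dTwo_rec_nil hK xs
    | n + 3, _ =>
      refine Eq.trans ?_ (congrArg Neg.neg (Finset.sum_eq_zero fun j hj =>
        C.sigmaXAux_diff_diff hK (Nat.le_add_left 3 n) (Finset.mem_Ico.1 hj).2 xs [])).symm
      rw [neg_zero]
      rfl
  rec_pos l xs as h1 _ h := by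
    match l, h1 with
    | 2, _ =>
      rcases list_cases_append as with rfl | ⟨bs, b, rfl⟩
      · exact absurd rfl h
      rw [Finset.sum_range_succ, Finset.sum_range_one]
      exact C.dTwo_rec_pos hK xs bs b
    | n + 3, _ =>
      refine Eq.trans ?_ (congrArg Neg.neg (Finset.sum_eq_zero fun j hj =>
        C.sigmaXAux_diff_diff hK (Nat.le_add_left 3 n) (Finset.mem_range.1 hj) xs as)).symm
      rw [neg_zero]
      rfl

end Existence

/-! ### Uniqueness of the differentials -/

section Uniqueness

variable {k : Type*} [Field k] {A : Type*} [Ring A] [Algebra k A]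
  {g : Type*} [LieRing g] [LieAlgebra k g] (C : CrossedProduct k A g) {K : Subalgebra k A}

variable {C} in
theorem IsBimoduleMap.congr_gen {φ ψ : C.X K →ₗ[k] C.X K} (hφ : C.IsBimoduleMap K φ)
    (hψ : C.IsBimoduleMap K ψ) {xs : List g} {as : List A}
    (h : φ (C.gen K 1 xs as 1) = ψ (C.gen K 1 xs as 1)) (c e : C.E) :
    φ (C.gen K c xs as e) = ψ (C.gen K c xs as e) := by
  have hg : C.gen K c xs as e = C.lact K c (C.ract K e (C.gen K 1 xs as 1)) := by
    rw [gen, gen, ract_pureX, lact_pureX, one_mul, mul_one]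
  rw [hg, (hφ c _).1, (hφ e _).2, h, (hψ c _).1, (hψ e _).2]

variable {C} in
theorem IsBimoduleMap.ext_gen {φ ψ : C.X K →ₗ[k] C.X K} (hφ : C.IsBimoduleMap K φ)
    (hψ : C.IsBimoduleMap K ψ)
    (h : ∀ xs as, φ (C.gen K 1 xs as 1) = ψ (C.gen K 1 xs as 1)) : φ = ψ := by
  refine X_hom_ext _ _ fun c ω as e => ?_
  have : φ ∘ₗ C.extLin K c (tens as) e = ψ ∘ₗ C.extLin K c (tens as) e :=
    wedge_hom_ext fun xs => hφ.congr_gen hψ (h xs as) c e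
  exact LinearMap.congr_fun this ω

theorem length_merge (as : List A) (i : Fin (as.length - 1)) :
    (merge as i).length + 1 = as.length := by
  have := i.2
  rw [merge, List.length_append, List.length_cons, List.length_take, List.length_drop]
  omega

variable {C} in
/-- Since `d⁰` lowers the number of tensor factors from `A`, it carries agreement on the elements
with fewer than `r` factors to the elements with `r` factors. -/
theorem IsBimoduleMap.congr_d0 {φ ψ : C.X K →ₗ[k] C.X K} (hφ : C.IsBimoduleMap K φ)
    (hψ : C.IsBimoduleMap K ψ) {xs : List g} {as : List A} (has : as ≠ [])
    (h : ∀ bs : List A, bs.length < as.length → φ (C.gen K 1 xs bs 1) = ψ (C.gen K 1 xs bs 1)) :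
    φ (C.d0Aux K (C.gen K 1 xs as 1)) = ψ (C.d0Aux K (C.gen K 1 xs as 1)) := by
  have hpos := List.length_pos_iff.2 has
  have h' := fun bs hb => hφ.congr_gen hψ (h bs hb)
  rw [C.d0Aux_gen K xs as has]
  simp only [map_add, map_sum, map_smul]
  rw [h' as.tail (by rw [List.length_tail]; omega),
    h' as.dropLast (by rw [List.length_dropLast]; omega),
    Finset.sum_congr rfl fun (i : Fin (as.length - 1)) _ => by
      rw [h' (merge as i) (by have := length_merge as i; omega)]]

theorem IsDifferential.unique {d d' : ℕ → C.X K →ₗ[k] C.X K} (hd : C.IsDifferential K d)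
    (hd' : C.IsDifferential K d') : d = d' := by
  funext l
  induction l using Nat.strong_induction_on with
  | _ l ihl =>
  refine (hd.bimod l).ext_gen (hd'.bimod l) fun xs as => ?_
  rcases Nat.eq_zero_or_pos l with rfl | hl
  · rw [hd.zero, hd'.zero]
  induction hn : as.length using Nat.strong_induction_on generalizing as with
  | _ n iha =>
  subst hn
  rcases lt_or_ge xs.length l with hxs | hxs
  · rw [hd.out_of_range l xs as hxs, hd'.out_of_range l xs as hxs]
  have h0 : as ≠ [] → d l (d 0 (C.gen K 1 xs as 1)) = d' l (d' 0 (C.gen K 1 xs as 1)) := by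
    intro has
    rw [hd.zero, hd'.zero]
    exact (hd.bimod l).congr_d0 (hd'.bimod l) has fun bs hb => iha bs.length hb bs rfl
  have hj : ∀ j, 1 ≤ j → j < l → d (l - j) (d j (C.gen K 1 xs as 1)) =
      d' (l - j) (d' j (C.gen K 1 xs as 1)) := by
    intro j h1 h2
    rw [ihl j h2, ihl (l - j) (by omega)]
  rcases Nat.lt_or_ge 1 l with h1 | h1
  · by_cases has : as = []
    · subst has
      rw [hd.rec_nil l xs h1 hxs, hd'.rec_nil l xs h1 hxs]
      congr 1
      refine Finset.sum_congr rfl fun j hm => ?_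
      rw [hj j (Finset.mem_Ico.1 hm).1 (Finset.mem_Ico.1 hm).2]
    · rw [hd.rec_pos l xs as h1 hxs has, hd'.rec_pos l xs as h1 hxs has]
      congr 1
      refine Finset.sum_congr rfl fun j hm => ?_
      rcases Nat.eq_zero_or_pos j with rfl | hp
      · rw [Nat.sub_zero, h0 has]
      · rw [hj j hp (Finset.mem_range.1 hm)]
  · obtain rfl : l = 1 := by omega
    by_cases has : as = []
    · subst has
      rw [hd.one_nil xs hxs, hd'.one_nil xs hxs]
    · rw [hd.one_pos xs as hxs has, hd'.one_pos xs as hxs has, h0 has]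

end Uniqueness

/-! ### The explicit formulas -/

section Formulas

variable {k : Type*} [Field k] {A : Type*} [Ring A] [Algebra k A]
  {g : Type*} [LieRing g] [LieAlgebra k g] (C : CrossedProduct k A g) {K : Subalgebra k A}
  (hK : ∀ (x : g), ∀ m ∈ K, C.act (U.of k g x) m ∈ K)

theorem dOne_formula (xs : List g) (as : List A) :
    C.dOne hK (C.gen K 1 xs as 1) =
      ∑ i : Fin xs.length,
        ((-1 : k) ^ (i : ℕ)) • C.gen K (C.inG (xs.get i)) (xs.eraseIdx i) as 1 +
      ∑ i : Fin xs.length,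
        ((-1 : k) ^ ((i : ℕ) + 1)) • C.gen K 1 (xs.eraseIdx i) as (C.inG (xs.get i)) +
      ∑ i : Fin xs.length, ∑ h : Fin as.length,
        ((-1 : k) ^ ((i : ℕ) + 1)) • C.gen K 1 (xs.eraseIdx i)
          (as.set h (C.act (U.of k g (xs.get i)) (as.get h))) 1 +
      ∑ j : Fin xs.length, ∑ i ∈ Finset.Iio j,
        ((-1 : k) ^ ((i : ℕ) + (j : ℕ))) •
          C.gen K 1 (⁅xs.get i, xs.get j⁆ :: (xs.eraseIdx j).eraseIdx i) as 1 := by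
  simp only [gen_eq_pureT]
  rw [dOne_pureT, contr_wedge, ceDiff_wedge]
  simp only [map_sum, map_smul, LinearMap.sum_apply, LinearMap.smul_apply]
  congr 1
  rw [← Finset.sum_add_distrib, ← Finset.sum_add_distrib]
  refine Finset.sum_congr rfl fun i _ => ?_
  rw [LinearMap.lTensor_tmul, TensorProduct.lift.tmul, extLin_apply, adX_pureT, one_mul, mul_one,
    derT_tens, map_sum, LinearMap.sum_apply, ← Finset.smul_sum]
  simp only [pow_succ, mul_neg_one, neg_smul, smul_sub]
  abel

theorem dTwo_formula (xs : List g) (as : List A) :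
    C.dTwo hK (C.gen K 1 xs as 1) =
      ∑ j : Fin xs.length, ∑ i ∈ Finset.Iio j, ∑ h ∈ Finset.range (as.length + 1),
        ((-1 : k) ^ ((i : ℕ) + (j : ℕ) + h + xs.length)) •
          C.gen K 1 ((xs.eraseIdx j).eraseIdx i)
            (as.insertIdx h (C.fhat (xs.get i) (xs.get j))) 1 := by
  rw [dTwo_gen]
  simp only [gen_eq_pureT]
  rw [insFhat_pureT, biContr_wedge]
  simp only [map_sum, map_smul, Finset.smul_sum]
  refine Finset.sum_congr rfl fun j _ => Finset.sum_congr rfl fun i _ => ?_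
  rw [LinearMap.lTensor_tmul, TensorProduct.lift.tmul, extLin_apply, insOp_pureT, insT_tens,
    coe_fhatL]
  simp only [map_sum, map_smul, LinearMap.sum_apply, LinearMap.smul_apply, Finset.smul_sum,
    smul_smul]
  refine Finset.sum_congr rfl fun h _ => ?_
  congr 1
  ring

end Formulas

end CrossedProduct

end DiffOp

end

theorem theorem1p4 {k : Type*} [Field k] {A : Type*} [Ring A] [Algebra k A]
    {g : Type*} [LieRing g] [LieAlgebra k g] (C : DiffOp.CrossedProduct k A g)
    (K : Subalgebra k A)
    (hK : ∀ (x : g), ∀ m ∈ K, C.act (DiffOp.U.of k g x) m ∈ K) :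
    (∃! d : ℕ → C.X K →ₗ[k] C.X K, C.IsDifferential K d) ∧
    ∀ d : ℕ → C.X K →ₗ[k] C.X K, C.IsDifferential K d →
      (∀ (xs : List g) (as : List A),
        d 1 (C.gen K 1 xs as 1) =
          ∑ i : Fin xs.length,
            ((-1 : k) ^ (i : ℕ)) • C.gen K (C.inG xs[i]) (xs.eraseIdx i) as 1 +
          ∑ i : Fin xs.length,
            ((-1 : k) ^ ((i : ℕ) + 1)) • C.gen K 1 (xs.eraseIdx i) as (C.inG xs[i]) +
          ∑ i : Fin xs.length, ∑ h : Fin as.length,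
            ((-1 : k) ^ ((i : ℕ) + 1)) • C.gen K 1 (xs.eraseIdx i)
              (as.set h (C.act (DiffOp.U.of k g xs[i]) as[h])) 1 +
          ∑ j : Fin xs.length, ∑ i ∈ Finset.Iio j,
            ((-1 : k) ^ ((i : ℕ) + (j : ℕ))) •
              C.gen K 1 (⁅xs[i], xs[j]⁆ :: (xs.eraseIdx j).eraseIdx i) as 1) ∧
      (∀ (xs : List g) (as : List A),
        d 2 (C.gen K 1 xs as 1) =
          ∑ j : Fin xs.length, ∑ i ∈ Finset.Iio j, ∑ h ∈ Finset.range (as.length + 1),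
            ((-1 : k) ^ ((i : ℕ) + (j : ℕ) + h + xs.length)) •
              C.gen K 1 ((xs.eraseIdx j).eraseIdx i)
                (as.insertIdx h (C.fhat xs[i] xs[j])) 1) ∧
      ∀ l, 3 ≤ l → d l = 0 := by
  have hD := C.diff_isDifferential hK
  refine ⟨⟨_, hD, fun d hd => hd.unique C hD⟩, fun d hd => ?_⟩
  obtain rfl := hd.unique C hD
  exact ⟨C.dOne_formula hK, C.dTwo_formula hK, fun l hl => C.diff_eq_zero hK hl⟩
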